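/- Let $L>0$ and $\mu>0$. On $(L^2)^2=L^2((0,L);\mathbb C^2)$ use the inner product $\langle f,g\rangle=\frac1{2L}\int_0^L (f_1\overline{g_1}+f_2\overline{g_2})\,dx$. For small $\gamma>0$ put $L_\gamma=\frac2\gamma\big(\sqrt{1+\gamma L/2}-\sqrt{1-\gamma L/2}\big)$, $$\delta(x)=-\frac{3L_\gamma}{4L}\,\frac{\gamma}{\sqrt{1+\gamma L/2}-\frac{\gamma L_\gamma x}{2L}},\quad \Lambda=\begin{pmatrix}1&0\\0&-1\end{pmatrix},\quad J=\begin{pmatrix}0&\frac13\\-\frac13&0\end{pmatrix},\quad \mathcal I(x)=e^{\int_0^x\delta(y)\,dy}\begin{pmatrix}1\\1\end{pmatrix}.$$ Let $\mathcal A$ and $\widetilde{\mathcal A}$ both act as $\Lambda\partial_x+\delta J$, with the domains $$D(\mathcal A)=\{f\in H^1((0,L);\mathbb C^2): f_1(0)+f_2(0)=0,\ f_1(L)+f_2(L)=0\},$$ $$D(\widetilde{\mathcal A})=\{f\in H^1((0,L);\mathbb C^2): f_1(0)+e^{-2\mu L}f_2(0)=0,\ f_1(L)+f_2(L)=0\},$$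 endowed with the graph norms. A Riesz basis of a Hilbert space is the image of an orthonormal basis under a bounded bijective linear operator. There is $\gamma_0>0$, depending only on $L$ and $\mu$, such that for every $\gamma\in(0,\gamma_0)$ the following holds. 1. There is an orthonormal basis $(f_n)_{n\in\mathbb Z}$ of $(L^2)^2$ made of eigenfunctions of $\mathcal A$, with eigenvalues $\mu_n$ satisfying $|\mu_n-\frac{i\pi n}{L}|<\frac1{4L}$ and with the phases normalized by $\langle f_n,E_n\rangle>0$, where $E_n(x)=(e^{i\pi nx/L},-e^{-i\pi nx/L})$. There is a Riesz basis $(\widetilde f_n)_{n\in\mathbb Z}$ of $(L^2)^2$ made of eigenfunctions of $\widetilde{\mathcal A}$, with eigenvalues $\widetilde\mu_n$ satisfying $|\widetilde\mu_n-\mu-\frac{i\pi n}{L}|<\frac1{4L}$, and a biorthonormal family $(\widetilde\phi_n)_{n\in\mathbb Z}$, that is, $\langle\widetilde f_n,\widetilde\phi_p\rangle=1$ if $n=p$ and $0$ otherwise. 2. Take any such families, any $\nu>0$, put $\mathcal I_\nu=\mathcal I+\nu f_0$, and let $F$ be any linear form $\alpha\mapsto\langle\alpha,F\rangle$ on the space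 $\mathcal E$ of finite linear combinations of the $f_n$. Then $\widetilde\mu_p\neq\mu_n$ for all $n,p\in\mathbb Z$, and for each $n\in\mathbb Z$ there is exactly one $g_n\in D(\widetilde{\mathcal A})$ with $\widetilde{\mathcal A}g_n-\mu_ng_n=-\langle f_n,F\rangle\,\mathcal I_\nu$; it is given by $$g_n=-\langle f_n,F\rangle\sum_{p\in\mathbb Z}\frac{\langle\mathcal I_\nu,\widetilde\phi_p\rangle}{\widetilde\mu_p-\mu_n}\,\widetilde f_p\quad\text{in }(L^2)^2 .$$ (a) If $\langle f_n,F\rangle\ne0$ for all $n\in\mathbb Z$, then $\big(\frac{1}{\langle f_n,F\rangle}g_n\big)_{n\in\mathbb Z}$ is a Riesz basis of $D(\widetilde{\mathcal A})$. (b) If there are constants $c,C>0$ with $c(1+|n|)\le|\langle f_n,F\rangle|\le C(1+|n|)$ for all $n\in\mathbb Z$, then $$T\alpha=\sum_{n\in\mathbb Z}\langle\alpha,f_n\rangle\,g_n\qquad(\alpha\in D(\mathcal A)),$$ with convergence in $D(\widetilde{\mathcal A})$, defines an isomorphism (a linear homeomorphism) $T:D(\mathcal A)\to D(\widetilde{\mathcal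 A})$. If moreover $F$ takes real values on the real-valued elements of $\mathcal E$, then $T$ maps real-valued functions to real-valued functions. -/

import Mathlib

open MeasureTheory Complex
open scoped ENNReal InnerProductSpace

noncomputable section

/-! ### The space `(L²)² = L²((0,L); ℂ²)` -/

/-- `ℂ²` with its Hermitian norm. -/
abbrev C2 : Type := EuclideanSpace ℂ (Fin 2)

/-- The measure `dx / (2L)` on `(0, L)`. -/
def tankMeasure (L : ℝ) : Measure ℝ :=
  ENNReal.ofReal (1 / (2 * L)) • (volume.restrict (Set.Ioo 0 L))

instance tankMeasure_finite (L : ℝ) : IsFiniteMeasure (tankMeasure L) := by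
  unfold tankMeasure
  exact Measure.smul_finite _ ENNReal.ofReal_ne_top

/-- The Hilbert space `L²((0,L); ℂ²)`, with the inner product
`⟨f, g⟩ = 1/(2L) ∫₀ᴸ (f₁ \bar g₁ + f₂ \bar g₂) dx`. -/
abbrev TankL2 (L : ℝ) : Type := Lp C2 2 (tankMeasure L)

/-- The inner product of `TankL2 L`, linear in its first argument
(Mathlib's `inner` is linear in the second one). -/
def tankInner {L : ℝ} (f g : TankL2 L) : ℂ := inner ℂ g f

/-- A function of `L²((0,L); ℂ²)` that takes real values almost everywhere. -/
def IsRealValued {L : ℝ} (f : TankL2 L) : Prop :=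
  ∀ᵐ x ∂(tankMeasure L), ∀ i : Fin 2, (f x i).im = 0

open Classical in
/-- The class in `L²((0,L); ℂ²)` of a square integrable function (and `0` for other functions). -/
def tankClass (L : ℝ) (u : ℝ → C2) : TankL2 L :=
  if h : MemLp u 2 (tankMeasure L) then h.toLp u else 0

/-! ### The coefficients of the system -/

/-- `L_γ = (2/γ) (√(1 + γL/2) - √(1 - γL/2))`. -/
def tankLen (L γ : ℝ) : ℝ :=
  2 / γ * (Real.sqrt (1 + γ * L / 2) - Real.sqrt (1 - γ * L / 2))

/-- The coupling coefficient
`δ(x) = - (3 L_γ / (4 L)) γ / (√(1 + γL/2) - γ L_γ x / (2L))`. -/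
def tankDelta (L γ x : ℝ) : ℝ :=
  -(3 * tankLen L γ / (4 * L)) *
    (γ / (Real.sqrt (1 + γ * L / 2) - γ * tankLen L γ * x / (2 * L)))

/-- The matrix `Λ = diag(1, -1)`. -/
def matLambda (v : C2) : C2 := !₂[v 0, -v 1]

/-- The matrix `J = (0, 1/3; -1/3, 0)`. -/
def matJ (v : C2) : C2 := !₂[v 1 / 3, -(v 0) / 3]

/-- The control profile `𝓘(x) = exp(∫₀ˣ δ(y) dy) (1, 1)`. -/
def tankProfile (L γ x : ℝ) : C2 :=
  !₂[(Real.exp (∫ y in (0 : ℝ)..x, tankDelta L γ y) : ℂ),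
     (Real.exp (∫ y in (0 : ℝ)..x, tankDelta L γ y) : ℂ)]

/-- The function `E_n(x) = (e^{iπnx/L}, -e^{-iπnx/L})`, the `n`-th eigenfunction of the
uncoupled system `δ = 0`. -/
def freeEigenfunction (L : ℝ) (n : ℤ) (x : ℝ) : C2 :=
  !₂[Complex.exp (I * Real.pi * n * x / L), -Complex.exp (-(I * Real.pi * n * x / L))]

/-- For a small acceleration, the control profile belongs to `L²((0,L); ℂ²)`. -/
lemma tankProfile_memLp {L γ : ℝ} (hL : 0 < L) (hγ : 0 < γ) (h : γ * L < 2) :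
    MemLp (tankProfile L γ) 2 (tankMeasure L) := by
  set a := Real.sqrt (1 + γ * L / 2) with ha
  set b := Real.sqrt (1 - γ * L / 2) with hb
  have hb0 : 0 < b := Real.sqrt_pos.2 (by linarith)
  have hab : b ≤ a := Real.sqrt_le_sqrt (by nlinarith [mul_pos hγ hL])
  have hden : ∀ x ∈ Set.Icc 0 L, 0 < a - γ * tankLen L γ * x / (2 * L) := by
    intro x hx
    have e : γ * tankLen L γ * x / (2 * L) = (a - b) * (x / L) := by
      unfold tankLen
      rw [← ha, ← hb]
      field_simp
    rw [e]
    have hx1 : x / L ≤ 1 := (div_le_one hL).2 hx.2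
    nlinarith
  have hδ : ContinuousOn (tankDelta L γ) (Set.Icc 0 L) := by
    unfold tankDelta
    refine continuousOn_const.mul (continuousOn_const.div ?_ fun x hx => (hden x hx).ne')
    fun_prop
  have hp : ContinuousOn (fun x => Real.exp (∫ y in (0 : ℝ)..x, tankDelta L γ y))
      (Set.Icc 0 L) := by
    have := intervalIntegral.continuousOn_primitive_interval'
      (hδ.intervalIntegrable_of_Icc (μ := volume) hL.le) Set.left_mem_uIcc
    rw [Set.uIcc_of_le hL.le] at this
    exact Real.continuous_exp.comp_continuousOn this
  have hcont : ContinuousOn (tankProfile L γ) (Set.Icc 0 L) := by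
    unfold tankProfile
    refine (PiLp.continuous_toLp 2 _).comp_continuousOn (continuousOn_pi.2 fun i => ?_)
    fin_cases i
    · exact Complex.continuous_ofReal.comp_continuousOn hp
    · exact Complex.continuous_ofReal.comp_continuousOn hp
  obtain ⟨C, hC⟩ := isCompact_Icc.exists_bound_of_continuousOn hcont
  have h1 : MemLp (tankProfile L γ) 2 (volume.restrict (Set.Ioo 0 L)) := by
    refine MemLp.of_bound ((hcont.mono Set.Ioo_subset_Icc_self).aestronglyMeasurable
      measurableSet_Ioo) C ?_
    filter_upwards [ae_restrict_mem measurableSet_Ioo] with x hx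
      using hC x (Set.Ioo_subset_Icc_self hx)
  exact h1.smul_measure ENNReal.ofReal_ne_top

lemma freeEigenfunction_memLp (L : ℝ) (n : ℤ) :
    MemLp (freeEigenfunction L n) 2 (tankMeasure L) := by
  have hcont : Continuous (freeEigenfunction L n) := by
    unfold freeEigenfunction
    refine (PiLp.continuous_toLp 2 _).comp (continuous_pi fun i => ?_)
    fin_cases i
    · exact Continuous.cexp (by fun_prop)
    · exact (Continuous.cexp (by fun_prop)).neg
  have hcont' := hcont.continuousOn (s := Set.Icc 0 L)
  obtain ⟨C, hC⟩ := isCompact_Icc.exists_bound_of_continuousOn hcont'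
  have h1 : MemLp (freeEigenfunction L n) 2 (volume.restrict (Set.Ioo 0 L)) := by
    refine MemLp.of_bound hcont.aestronglyMeasurable C ?_
    filter_upwards [ae_restrict_mem measurableSet_Ioo] with x hx
      using hC x (Set.Ioo_subset_Icc_self hx)
  exact h1.smul_measure ENNReal.ofReal_ne_top

/-! ### The operators `Λ ∂ₓ + δ J` and their domains -/

/-- `u` is, on `[0, L]`, the continuous representative of an element of `H¹((0,L); ℂ²)` with
weak derivative `v`: `v` is square integrable and `u` is a primitive of `v`. -/
def IsH1Rep (L : ℝ) (u v : ℝ → C2) : Prop :=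
  MemLp v 2 (tankMeasure L) ∧ ∀ x ∈ Set.Icc 0 L, u x = u 0 + ∫ t in (0 : ℝ)..x, v t

lemma intervalIntegrable_of_memLp_tank {L : ℝ} {v : ℝ → C2}
    (hv : MemLp v 2 (tankMeasure L)) {x : ℝ} (hx : x ∈ Set.Icc 0 L) :
    IntervalIntegrable v volume 0 x := by
  rcases (hx.1.trans hx.2).eq_or_lt with hL | hL
  · have : x = 0 := le_antisymm (hL ▸ hx.2) hx.1
    simp [this]
  · have h1 : Integrable v (tankMeasure L) := hv.integrable (by norm_num)
    unfold tankMeasure at h1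
    rw [integrable_smul_measure (by simpa using hL) ENNReal.ofReal_ne_top] at h1
    have h2 : IntegrableOn v (Set.Ioo 0 L) volume := h1
    rw [← integrableOn_Ioc_iff_integrableOn_Ioo] at h2
    rw [intervalIntegrable_iff_integrableOn_Ioc_of_le hx.1]
    exact h2.mono_set (Set.Ioc_subset_Ioc_right hx.2)

lemma isH1Rep_zero (L : ℝ) : IsH1Rep L 0 0 := by
  refine ⟨MemLp.zero, fun x _ => ?_⟩
  simp

lemma IsH1Rep.add {L : ℝ} {u u' v v' : ℝ → C2} (h : IsH1Rep L u v)
    (h' : IsH1Rep L u' v') : IsH1Rep L (u + u') (v + v') := by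
  refine ⟨h.1.add h'.1, fun x hx => ?_⟩
  have e := intervalIntegral.integral_add (intervalIntegrable_of_memLp_tank h.1 hx)
    (intervalIntegrable_of_memLp_tank h'.1 hx)
  simp only [Pi.add_apply]
  rw [e, h.2 x hx, h'.2 x hx]
  abel

lemma IsH1Rep.smul {L : ℝ} {u v : ℝ → C2} (c : ℂ) (h : IsH1Rep L u v) :
    IsH1Rep L (c • u) (c • v) := by
  refine ⟨h.1.const_smul c, fun x hx => ?_⟩
  simp only [Pi.smul_apply]
  rw [intervalIntegral.integral_smul, h.2 x hx, smul_add]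

/-- `(f, h)` belongs to the graph of the operator `Λ ∂ₓ + δ J` with domain
`{f ∈ (H¹)² : f₁(0) + κ f₂(0) = 0, f₁(L) + f₂(L) = 0}`. -/
def InTankGraph (L γ κ : ℝ) (f h : TankL2 L) : Prop :=
  ∃ u v : ℝ → C2, IsH1Rep L u v ∧
    f =ᵐ[tankMeasure L] u ∧
    h =ᵐ[tankMeasure L] (fun x => matLambda (v x) + (tankDelta L γ x : ℂ) • matJ (u x)) ∧
    u 0 0 + κ * u 0 1 = 0 ∧ u L 0 + u L 1 = 0

lemma InTankGraph.zero {L γ κ : ℝ} : InTankGraph L γ κ 0 0 := by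
  refine ⟨0, 0, isH1Rep_zero L, Lp.coeFn_zero _ _ _, ?_, by simp, by simp⟩
  filter_upwards [Lp.coeFn_zero C2 2 (tankMeasure L)] with x hx
  rw [hx]
  ext i
  fin_cases i <;> simp [matLambda, matJ]

lemma InTankGraph.add {L γ κ : ℝ} {f h f' h' : TankL2 L}
    (H : InTankGraph L γ κ f h) (H' : InTankGraph L γ κ f' h') :
    InTankGraph L γ κ (f + f') (h + h') := by
  obtain ⟨u, v, h1, h2, h3, h4, h5⟩ := H
  obtain ⟨u', v', h1', h2', h3', h4', h5'⟩ := H'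
  refine ⟨u + u', v + v', h1.add h1', (Lp.coeFn_add f f').trans (h2.add h2'), ?_, ?_, ?_⟩
  · filter_upwards [Lp.coeFn_add h h', h3, h3'] with x a b c
    rw [a, Pi.add_apply, b, c]
    ext i
    fin_cases i <;> simp [matLambda, matJ] <;> ring
  · simp only [Pi.add_apply, PiLp.add_apply]
    linear_combination h4 + h4'
  · simp only [Pi.add_apply, PiLp.add_apply]
    linear_combination h5 + h5'

lemma InTankGraph.smul {L γ κ : ℝ} (c : ℂ) {f h : TankL2 L} (H : InTankGraph L γ κ f h) :
    InTankGraph L γ κ (c • f) (c • h) := by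
  obtain ⟨u, v, h1, h2, h3, h4, h5⟩ := H
  refine ⟨c • u, c • v, h1.smul c, (Lp.coeFn_smul c f).trans (h2.const_smul c), ?_, ?_, ?_⟩
  · filter_upwards [Lp.coeFn_smul c h, h3] with x a b
    rw [a, Pi.smul_apply, b]
    ext i
    fin_cases i <;> simp [matLambda, matJ] <;> ring
  · simp only [Pi.smul_apply, PiLp.smul_apply, smul_eq_mul]
    linear_combination c * h4
  · simp only [Pi.smul_apply, PiLp.smul_apply, smul_eq_mul]
    linear_combination c * h5

/-- The operator `Λ ∂ₓ + δ J` is well defined: its value is determined by the function. -/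
lemma InTankGraph.eq_zero {L γ κ : ℝ} {h : TankL2 L} (H : InTankGraph L γ κ 0 h) : h = 0 := by
  obtain ⟨u, v, h1, h2, h3, -, -⟩ := H
  have ac : ∀ {P : ℝ → Prop}, (∀ᵐ x ∂(volume.restrict (Set.Ioo 0 L)), P x) →
      ∀ᵐ x ∂(tankMeasure L), P x := fun hP => Measure.ae_smul_measure hP _
  rcases le_or_gt L 0 with hL | hL
  · have h0 : tankMeasure L = 0 := by simp [tankMeasure, Set.Ioo_eq_empty hL.not_gt]
    apply Lp.ext
    have h1 : ∀ P : ℝ → Prop, ∀ᵐ x ∂(tankMeasure L), P x := by simp [h0]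
    exact h1 _
  have ca : ∀ {P : ℝ → Prop}, (∀ᵐ x ∂(tankMeasure L), P x) →
      ∀ᵐ x ∂(volume.restrict (Set.Ioo 0 L)), P x := by
    intro P hP
    have hne : ENNReal.ofReal (1 / (2 * L)) ≠ 0 := by simpa using hL
    rw [ae_iff] at hP ⊢
    rw [tankMeasure, Measure.smul_apply, smul_eq_mul, mul_eq_zero] at hP
    exact hP.resolve_left hne
  have hv := intervalIntegrable_of_memLp_tank h1.1 (Set.right_mem_Icc.2 hL.le)
  have hc : ContinuousOn (fun x => ∫ t in (0 : ℝ)..x, v t) (Set.Icc 0 L) := by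
    have := intervalIntegral.continuousOn_primitive_interval' hv Set.left_mem_uIcc
    rwa [Set.uIcc_of_le hL.le] at this
  have hu : u =ᵐ[volume.restrict (Set.Ioo 0 L)] fun _ => 0 := by
    filter_upwards [ca h2, ca (Lp.coeFn_zero C2 2 (tankMeasure L))] with x a b
    rw [← a, b]
    rfl
  have hw : (fun x => ∫ t in (0 : ℝ)..x, v t) =ᵐ[volume.restrict (Set.Ioo 0 L)]
      fun _ => -u 0 := by
    filter_upwards [hu, ae_restrict_mem measurableSet_Ioo] with x a b
    have e := h1.2 x (Set.Ioo_subset_Icc_self b)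
    rw [a] at e
    exact eq_neg_of_add_eq_zero_right e.symm
  have hw' := Measure.eqOn_open_of_ae_eq hw isOpen_Ioo (hc.mono Set.Ioo_subset_Icc_self)
    continuousOn_const
  have hv0 : ∀ᵐ x ∂(volume.restrict (Set.Ioo 0 L)), v x = 0 := by
    filter_upwards [ae_restrict_of_ae hv.ae_hasDerivAt_integral,
      ae_restrict_mem measurableSet_Ioo] with x a b
    have a' := a (by rw [Set.uIcc_of_le hL.le]; exact Set.Ioo_subset_Icc_self b) 0
      Set.left_mem_uIcc
    have e : (fun y => ∫ t in (0 : ℝ)..y, v t) =ᶠ[nhds x] fun _ => -u 0 := by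
      filter_upwards [isOpen_Ioo.mem_nhds b] with y hy using hw' hy
    exact a'.unique ((hasDerivAt_const x (-u 0)).congr_of_eventuallyEq e)
  apply Lp.ext
  filter_upwards [h3, ac hv0, ac hu, Lp.coeFn_zero C2 2 (tankMeasure L)] with x a b c d
  rw [a, b, c, d]
  ext i
  fin_cases i <;> simp [matLambda, matJ]

/-- The domain `D = {f ∈ (H¹)² : f₁(0) + κ f₂(0) = 0, f₁(L) + f₂(L) = 0}` of the operator
`Λ ∂ₓ + δ J`, with its graph norm `(‖f‖² + ‖(Λ ∂ₓ + δ J) f‖²)^{1/2}`. The function `f` is represented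
by the point `(f, (Λ ∂ₓ + δ J) f)` of the graph. -/
def tankDomain (L γ κ : ℝ) : Submodule ℂ (WithLp 2 (TankL2 L × TankL2 L)) where
  carrier := {z | InTankGraph L γ κ z.fst z.snd}
  zero_mem' := InTankGraph.zero
  add_mem' := fun h h' => h.add h'
  smul_mem' := fun c _ h => h.smul c

/-- The element of `L²((0,L); ℂ²)` underlying an element of the domain. -/
def tankFun {L γ κ : ℝ} (α : tankDomain L γ κ) : TankL2 L := α.1.fst

/-- The operator `Λ ∂ₓ + δ J` on its domain. -/
def tankOp {L γ κ : ℝ} (α : tankDomain L γ κ) : TankL2 L := α.1.snd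

lemma tankFun_injective {L γ κ : ℝ} :
    Function.Injective (tankFun : tankDomain L γ κ → TankL2 L) := by
  intro α β h
  have e1 : (α - β).1.fst = 0 := by
    change α.1.fst - β.1.fst = 0
    exact sub_eq_zero.2 h
  have e2 : InTankGraph L γ κ (α - β).1.fst (α - β).1.snd := (α - β).2
  rw [e1] at e2
  have e3 : α.1.snd - β.1.snd = 0 := e2.eq_zero
  apply Subtype.ext
  apply (WithLp.ofLp_injective 2)
  exact Prod.ext h (sub_eq_zero.1 e3)

lemma tankDomain_norm_sq {L γ κ : ℝ} (α : tankDomain L γ κ) :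
    ‖α‖ ^ 2 = ‖tankFun α‖ ^ 2 + ‖tankOp α‖ ^ 2 := by
  exact WithLp.prod_norm_sq_eq_of_L2 α.1

/-- `D(𝒜)`: the boundary conditions are `f₁(0) + f₂(0) = 0`, `f₁(L) + f₂(L) = 0`. -/
abbrev DomA (L γ : ℝ) : Type := tankDomain L γ 1

/-- `D(𝒜̃)`: the boundary conditions are `f₁(0) + e^{-2μL} f₂(0) = 0`, `f₁(L) + f₂(L) = 0`. -/
abbrev DomAtilde (L γ mu : ℝ) : Type := tankDomain L γ (Real.exp (-2 * mu * L))

/-! ### Riesz bases and the families of eigenfunctions -/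

/-- A family of a Hilbert space is a Riesz basis if it is the image of the canonical orthonormal
basis of `ℓ²` under an isomorphism (a bounded bijective linear operator with bounded inverse). -/
def IsRieszBasis {X : Type*} [NormedAddCommGroup X] [InnerProductSpace ℂ X] (e : ℤ → X) : Prop :=
  ∃ U : lp (fun _ : ℤ => ℂ) 2 ≃L[ℂ] X, ∀ n, U (lp.single 2 n (1 : ℂ)) = e n

/-- `(f_n)` is the orthonormal basis of `L²((0,L); ℂ²)` made of eigenfunctions of `𝒜`,
with eigenvalues `(μ_n)`; the eigenvalue `μ_n` is the one which is close to `iπn/L`, and the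
phase of `f_n` is fixed by `⟨f_n, E_n⟩ > 0`. -/
structure IsEigenbasisA (L γ : ℝ) (f : ℤ → TankL2 L) (lam : ℤ → ℂ) : Prop where
  eigen : ∀ n, ∃ a : DomA L γ, tankFun a = f n ∧ tankOp a = lam n • f n
  orthonormal : Orthonormal ℂ f
  complete : (Submodule.span ℂ (Set.range f)).topologicalClosure = ⊤
  eigenvalue_near : ∀ n : ℤ, ‖lam n - I * Real.pi * n / L‖ < 1 / (4 * L)
  phase_re : ∀ n, 0 < (tankInner (f n) (tankClass L (freeEigenfunction L n))).re
  phase_im : ∀ n, (tankInner (f n) (tankClass L (freeEigenfunction L n))).im = 0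

/-- `(f̃_n)` is a Riesz basis of `L²((0,L); ℂ²)` made of eigenfunctions of `𝒜̃`, with
eigenvalues `(μ̃_n)`, where `μ̃_n` is the one which is close to `μ + iπn/L`, and `(φ̃_n)` is
the biorthonormal family. -/
structure IsEigenbasisAtilde (L γ mu : ℝ) (ft φt : ℤ → TankL2 L) (lamt : ℤ → ℂ) : Prop where
  eigen : ∀ n, ∃ a : DomAtilde L γ mu, tankFun a = ft n ∧ tankOp a = lamt n • ft n
  riesz : IsRieszBasis ft
  biorthonormal : ∀ n p, tankInner (ft n) (φt p) = if n = p then 1 else 0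
  eigenvalue_near : ∀ n : ℤ, ‖lamt n - (mu + I * Real.pi * n / L)‖ < 1 / (4 * L)

/-- The virtual control profile `𝓘_ν = 𝓘 + ν f₀`. -/
def tankControl (L γ ν : ℝ) (f : ℤ → TankL2 L) : TankL2 L :=
  tankClass L (tankProfile L γ) + (ν : ℂ) • f 0

/-! ### Feedback laws -/

/-- The space `ℰ` of finite linear combinations of the `f_n`. -/
abbrev finiteCombinations {L : ℝ} (f : ℤ → TankL2 L) : Submodule ℂ (TankL2 L) :=
  Submodule.span ℂ (Set.range f)

/-- The coefficient `⟨f_n, F⟩` of a linear form `F` on `ℰ`. -/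
def feedbackCoeff {L : ℝ} (f : ℤ → TankL2 L) (F : Module.Dual ℂ (finiteCombinations f))
    (n : ℤ) : ℂ :=
  F ⟨f n, Submodule.subset_span (Set.mem_range_self n)⟩

/-- `F` takes real values on the real-valued elements of `ℰ`. -/
def IsRealFeedback {L : ℝ} (f : ℤ → TankL2 L) (F : Module.Dual ℂ (finiteCombinations f)) : Prop :=
  ∀ α : finiteCombinations f, IsRealValued (α : TankL2 L) → (F α).im = 0

end

/-! In suitable coordinates everything becomes a matrix on `ℓ²(ℤ)`. When `δ = 0`, multiplication by
`diag(e^{μ(L-x)}, e^{-μ(L-x)})` turns the boundary conditions of `𝒜̃` into those of `𝒜` at the price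
of adding `μ` to the operator. Both uncoupled operators are thus diagonal in Fourier-type
coefficients (`tankCoef`, `inTankGraph_zero_iff`), with entries `iπn/L` and `s_n = μ + iπn/L`. The
coupling `δJ` is a bounded perturbation of size `O(γ)`. Since the diagonal entries `d_j` are equally
spaced, dividing matrix entries by `d_j - d_k` is a bounded operation (`exists_commutator_inverse`).
A contraction argument then yields an isomorphism `V`, close to the coefficient map, in which the
coupled operator is diagonal with eigenvalues `σ_n` at distance `O(γ)` from the free ones
(`exists_diagonalization`, `exists_tank_diagonalization`). This produces both eigenbases; any other
admissible family differs from the constructed one by scalar factors (`Diagonalizes.eigen_unique`).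

In these coordinates the equation for `g_n` reads `(σ_p - μ_n) (V g_n)_p = -⟨f_n, F⟩ (V 𝓘_ν)_p`. The
map `σ V` identifies `D(𝒜̃)` with `ℓ²`, and there `g_n / ⟨f_n, F⟩` is the `n`-th column of the
Cauchy matrix `1 / (σ_p - μ_n)` multiplied by the diagonal matrix `-σ_p (V 𝓘_ν)_p`. The Riesz basis
property rests on two facts.

The Cauchy matrix is invertible (`exists_cauchy_equiv`): for the free spectra it is, up to the
factor `sinh(μL)/L`, the matrix of the weighted coefficients of the functions `E_n`, that is, a
change of basis; the Schur test controls the perturbation.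

The diagonal is bounded above and below (`exists_control_bounds`): by integration by parts, `s_p`
times the `p`-th coefficient is within `O(γ)` of `(cosh(μL) - (-1)^p)/L` for `𝓘` and of `sinh(μL)/L`
for `f_0`. Both limits are positive, so nothing cancels in `𝓘 + ν f_0` and the smallness of `γ` does
not depend on `ν`. These weighted coefficients are bounded but not square summable, so passing from
the free coefficients to `V` needs a sup-norm estimate, the last clause of `exists_diagonalization`.

Finally `T` is the expansion of `D(𝒜)` along `f_n`, followed by a diagonal isomorphism and the Riesz
basis map (`exists_feedback_isomorphism`). Reality holds because conjugation exchanges the indices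
`n` and `-n` throughout. -/

noncomputable section

/-! ### Operators on `ℓ²(ℤ)` -/

/-- The Hilbert space `ℓ²(ℤ; ℂ)`. -/
abbrev L2Z : Type := lp (fun _ : ℤ => ℂ) 2

/-- The canonical orthonormal basis of `ℓ²(ℤ; ℂ)`. -/
def l2e (k : ℤ) : L2Z := lp.single 2 k (1 : ℂ)

/-- The `j`-th coordinate as a continuous linear form. -/
def l2coord (j : ℤ) : L2Z →L[ℂ] ℂ := lp.evalCLM ℂ (fun _ : ℤ => ℂ) 2 j

@[simp] lemma l2coord_apply (j : ℤ) (x : L2Z) : l2coord j x = x j := rfl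

lemma l2e_apply (k j : ℤ) : l2e k j = if j = k then 1 else 0 := by
  unfold l2e
  rw [lp.single_apply]
  split_ifs with h
  · subst h; simp
  · simp [h]

@[simp] lemma l2e_self (k : ℤ) : l2e k k = 1 := by simp [l2e_apply]

@[simp] lemma norm_l2e (k : ℤ) : ‖l2e k‖ = 1 := by
  unfold l2e
  rw [lp.norm_single (by norm_num)]
  simp

lemma l2_coord_norm_le (x : L2Z) (j : ℤ) : ‖x j‖ ≤ ‖x‖ :=
  lp.norm_apply_le_norm (by norm_num) x j

lemma inner_l2e_left (k : ℤ) (x : L2Z) : inner ℂ (l2e k) x = x k := by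
  unfold l2e
  rw [lp.inner_single_left]
  simp

lemma l2_hasSum_sq (x : L2Z) : HasSum (fun j => ‖x j‖ ^ 2) (‖x‖ ^ 2) := by
  have h := lp.hasSum_norm (p := 2) (by norm_num) x
  simpa using h

lemma l2_hasSum (x : L2Z) : HasSum (fun k => x k • l2e k) x := by
  have h := lp.hasSum_single (p := 2) (by norm_num) x
  refine h.congr_fun ?_ |> fun h => h
  intro k
  unfold l2e
  rw [← lp.single_smul]
  simp

lemma l2_op_hasSum {X : Type*} [NormedAddCommGroup X] [NormedSpace ℂ X] (A : L2Z →L[ℂ] X)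
    (x : L2Z) : HasSum (fun k => x k • A (l2e k)) (A x) := by
  have h := A.hasSum (l2_hasSum x)
  simpa using h

lemma l2_op_coord_hasSum (A : L2Z →L[ℂ] L2Z) (x : L2Z) (j : ℤ) :
    HasSum (fun k => x k * A (l2e k) j) (A x j) := by
  have h := l2_op_hasSum ((l2coord j).comp A) x
  simpa using h

lemma l2_op_ext {A B : L2Z →L[ℂ] L2Z} (h : ∀ j k, A (l2e k) j = B (l2e k) j) : A = B := by
  ext x j
  refine (l2_op_coord_hasSum A x j).unique ?_
  simpa only [h] using l2_op_coord_hasSum B x j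

/-- Rows of `A` are columns of its adjoint up to conjugation; this transfers to rows the evident
bounds on columns. -/
lemma l2_row_norm (A : L2Z →L[ℂ] L2Z) (j k : ℤ) :
    ‖A (l2e k) j‖ = ‖(ContinuousLinearMap.adjoint A (l2e j)) k‖ := by
  rw [← inner_l2e_left, ← inner_l2e_left, ← ContinuousLinearMap.adjoint_inner_left,
    norm_inner_symm]

lemma tsum_mul_sq_le {f g : ℤ → ℝ} (hf : ∀ k, 0 ≤ f k) (hg : ∀ k, 0 ≤ g k)
    (hf2 : Summable fun k => f k ^ 2) (hg2 : Summable fun k => g k ^ 2) :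
    Summable (fun k => f k * g k) ∧
      (∑' k, f k * g k) ^ 2 ≤ (∑' k, f k ^ 2) * ∑' k, g k ^ 2 := by
  have hs : Summable (fun k => f k * g k) := by
    refine Summable.of_nonneg_of_le (fun k => mul_nonneg (hf k) (hg k)) (fun k => ?_)
      (hf2.add hg2)
    nlinarith [sq_nonneg (f k - g k), sq_nonneg (f k), sq_nonneg (g k)]
  refine ⟨hs, ?_⟩
  have h0 : ∑' k, f k * g k ≤ Real.sqrt ((∑' k, f k ^ 2) * ∑' k, g k ^ 2) := by
    refine hs.tsum_le_of_sum_le fun s => Real.le_sqrt_of_sq_le ?_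
    refine (Finset.sum_mul_sq_le_sq_mul_sq s f g).trans ?_
    exact mul_le_mul (hf2.sum_le_tsum s fun k _ => sq_nonneg _)
      (hg2.sum_le_tsum s fun k _ => sq_nonneg _) (Finset.sum_nonneg fun k _ => sq_nonneg _)
      (tsum_nonneg fun k => sq_nonneg _)
  have h1 : 0 ≤ (∑' k, f k ^ 2) * ∑' k, g k ^ 2 :=
    mul_nonneg (tsum_nonneg fun k => sq_nonneg _) (tsum_nonneg fun k => sq_nonneg _)
  calc _ ≤ Real.sqrt ((∑' k, f k ^ 2) * ∑' k, g k ^ 2) ^ 2 :=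
        pow_le_pow_left₀ (tsum_nonneg fun k => mul_nonneg (hf k) (hg k)) h0 2
    _ = _ := Real.sq_sqrt h1

/-- The Schur test. -/
theorem exists_op_of_schur (a : ℤ → ℤ → ℂ) {R : ℝ} (hR : 0 ≤ R)
    (hr : ∀ j, Summable fun k => ‖a j k‖) (hr' : ∀ j, ∑' k, ‖a j k‖ ≤ R)
    (hc : ∀ k, Summable fun j => ‖a j k‖) (hc' : ∀ k, ∑' j, ‖a j k‖ ≤ R) :
    ∃ T : L2Z →L[ℂ] L2Z, ‖T‖ ≤ R ∧ ∀ j k, T (l2e k) j = a j k := by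
  have hs : ∀ (x : L2Z) j, Summable fun k => ‖a j k * x k‖ := fun x j => by
    refine Summable.of_nonneg_of_le (fun k => norm_nonneg _) (fun k => ?_)
      ((hr j).mul_right ‖x‖)
    rw [norm_mul]
    exact mul_le_mul_of_nonneg_left (l2_coord_norm_le x k) (norm_nonneg _)
  have hs2 : ∀ (x : L2Z) j, Summable fun k => ‖a j k‖ * ‖x k‖ ^ 2 := fun x j => by
    refine Summable.of_nonneg_of_le (fun k => by positivity) (fun k => ?_)
      ((hr j).mul_right (‖x‖ ^ 2))
    exact mul_le_mul_of_nonneg_left (pow_le_pow_left₀ (norm_nonneg _) (l2_coord_norm_le x k) 2)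
      (norm_nonneg _)
  -- Cauchy–Schwarz with `|a x| = √|a| · (√|a| |x|)`: the row sum absorbs the first factor, and the
  -- column sum will absorb what remains of the second.
  have hb : ∀ (x : L2Z) j, ‖∑' k, a j k * x k‖ ^ 2 ≤ R * ∑' k, ‖a j k‖ * ‖x k‖ ^ 2 := by
    intro x j
    have e1 : ∀ k, Real.sqrt ‖a j k‖ ^ 2 = ‖a j k‖ := fun k => Real.sq_sqrt (norm_nonneg _)
    have h := tsum_mul_sq_le (f := fun k => Real.sqrt ‖a j k‖)
      (g := fun k => Real.sqrt ‖a j k‖ * ‖x k‖) (fun k => Real.sqrt_nonneg _)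
      (fun k => by positivity) (by simpa only [e1] using hr j)
      (by simpa only [mul_pow, e1] using hs2 x j)
    have e2 : ∀ k, Real.sqrt ‖a j k‖ * (Real.sqrt ‖a j k‖ * ‖x k‖) = ‖a j k * x k‖ := fun k => by
      rw [norm_mul, ← mul_assoc, ← sq, e1]
    simp only [mul_pow, e1, e2] at h
    calc _ ≤ (∑' k, ‖a j k * x k‖) ^ 2 :=
          pow_le_pow_left₀ (norm_nonneg _) (norm_tsum_le_tsum_norm (hs x j)) 2
      _ ≤ _ := h.2
      _ ≤ _ := mul_le_mul_of_nonneg_right (hr' j) (tsum_nonneg fun k => by positivity)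
  have hfin : ∀ (x : L2Z) (s : Finset ℤ), ∑ j ∈ s, ‖∑' k, a j k * x k‖ ^ 2 ≤ (R * ‖x‖) ^ 2 := by
    intro x s
    calc _ ≤ ∑ j ∈ s, R * ∑' k, ‖a j k‖ * ‖x k‖ ^ 2 := Finset.sum_le_sum fun j _ => hb x j
      _ = R * ∑' k, ∑ j ∈ s, ‖a j k‖ * ‖x k‖ ^ 2 := by
          rw [← Finset.mul_sum, Summable.tsum_finsetSum fun j _ => hs2 x j]
      _ ≤ R * ∑' k, R * ‖x k‖ ^ 2 := by
          refine mul_le_mul_of_nonneg_left ?_ hR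
          refine Summable.tsum_le_tsum (fun k => ?_) (summable_sum fun j _ => hs2 x j)
            ((l2_hasSum_sq x).summable.mul_left R)
          rw [← Finset.sum_mul]
          exact mul_le_mul_of_nonneg_right
            (((hc k).sum_le_tsum s fun j _ => norm_nonneg _).trans (hc' k)) (sq_nonneg _)
      _ = (R * ‖x‖) ^ 2 := by
          rw [tsum_mul_left, (l2_hasSum_sq x).tsum_eq]; ring
  have hmem : ∀ x : L2Z, Memℓp (fun j => ∑' k, a j k * x k) 2 := fun x =>
    memℓp_gen' (C := (R * ‖x‖) ^ 2) fun s => by simpa using hfin x s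
  let T0 : L2Z →ₗ[ℂ] L2Z :=
    { toFun := fun x => ⟨fun j => ∑' k, a j k * x k, hmem x⟩
      map_add' := fun x y => by
        ext j
        change ∑' k, a j k * (x k + y k) = ∑' k, a j k * x k + ∑' k, a j k * y k
        rw [← Summable.tsum_add (hs x j).of_norm (hs y j).of_norm]
        simp only [mul_add]
      map_smul' := fun c x => by
        ext j
        change ∑' k, a j k * (c * x k) = c * ∑' k, a j k * x k
        rw [← tsum_mul_left]
        exact tsum_congr fun k => by ring }
  have hT0 : ∀ x, ‖T0 x‖ ≤ R * ‖x‖ := fun x =>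
    lp.norm_le_of_forall_sum_le (by norm_num) (by positivity) fun s => by
      simp only [ENNReal.toReal_ofNat, Real.rpow_ofNat]
      exact hfin x s
  refine ⟨T0.mkContinuous R hT0, LinearMap.mkContinuous_norm_le _ hR _, fun j k => ?_⟩
  change ∑' i, a j i * l2e k i = a j k
  rw [tsum_eq_single k fun i hi => by simp [l2e_apply, hi]]
  simp

/-- The diagonal operator with bounded coefficients. -/
theorem exists_diag_op (m : ℤ → ℂ) {R : ℝ} (hR : 0 ≤ R) (hm : ∀ k, ‖m k‖ ≤ R) :
    ∃ T : L2Z →L[ℂ] L2Z, ‖T‖ ≤ R ∧ ∀ x j, T x j = m j * x j := by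
  have hr : ∀ j, HasSum (fun k => ‖if j = k then m k else 0‖) ‖m j‖ := fun j => by
    convert! hasSum_ite_eq j ‖m j‖ using 2 with k
    by_cases h : j = k
    · subst h; simp
    · simp [h, Ne.symm h]
  have hc : ∀ k, HasSum (fun j => ‖if j = k then m k else 0‖) ‖m k‖ := fun k => by
    convert! hasSum_ite_eq k ‖m k‖ using 2 with j
    split_ifs <;> simp
  obtain ⟨T, hT, hT'⟩ := exists_op_of_schur (fun j k => if j = k then m k else 0) hR
    (fun j => (hr j).summable) (fun j => (hr j).tsum_eq.trans_le (hm j))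
    (fun k => (hc k).summable) (fun k => (hc k).tsum_eq.trans_le (hm k))
  refine ⟨T, hT, fun x j => (l2_op_coord_hasSum T x j).unique ?_⟩
  simp only [hT']
  convert! hasSum_ite_eq j (m j * x j) using 2 with k
  by_cases h : j = k
  · subst h; simp [mul_comm]
  · simp [h, Ne.symm h]

/-- The invertible diagonal operator with coefficients bounded from above and below. -/
theorem exists_diag_equiv (m : ℤ → ℂ) {c R : ℝ} (hc : 0 < c) (hm : ∀ k, ‖m k‖ ≤ R)
    (hm' : ∀ k, c ≤ ‖m k‖) :
    ∃ T : L2Z ≃L[ℂ] L2Z, ∀ x j, T x j = m j * x j := by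
  obtain ⟨T, -, hT⟩ := exists_diag_op m ((norm_nonneg _).trans (hm 0)) hm
  obtain ⟨S, -, hS⟩ := exists_diag_op (fun k => (m k)⁻¹) (R := c⁻¹) (by positivity) fun k => by
    rw [norm_inv]; exact inv_anti₀ hc (hm' k)
  have h0 : ∀ k, m k ≠ 0 := fun k => norm_pos_iff.1 (hc.trans_le (hm' k))
  refine ⟨ContinuousLinearEquiv.equivOfInverse T S (fun x => ?_) (fun x => ?_), hT⟩
  · ext j; rw [hS, hT, inv_mul_cancel_left₀ (h0 j)]
  · ext j; rw [hT, hS, mul_inv_cancel_left₀ (h0 j)]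

/-! ### Bounded perturbations of diagonal operators with equally spaced entries -/

lemma l2_row_summable (A : L2Z →L[ℂ] L2Z) (j : ℤ) :
    Summable (fun k => ‖A (l2e k) j‖ ^ 2) ∧ ∑' k, ‖A (l2e k) j‖ ^ 2 ≤ ‖A‖ ^ 2 := by
  have h := l2_hasSum_sq (ContinuousLinearMap.adjoint A (l2e j))
  simp only [← l2_row_norm] at h
  refine ⟨h.summable, h.tsum_eq.trans_le (pow_le_pow_left₀ (norm_nonneg _) ?_ 2)⟩
  refine (ContinuousLinearMap.le_opNorm _ _).trans_eq ?_
  rw [norm_l2e, mul_one, LinearIsometryEquiv.norm_map]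

lemma l2_col_summable (A : L2Z →L[ℂ] L2Z) (k : ℤ) :
    Summable (fun j => ‖A (l2e k) j‖ ^ 2) ∧ ∑' j, ‖A (l2e k) j‖ ^ 2 ≤ ‖A‖ ^ 2 := by
  have h := l2_hasSum_sq (A (l2e k))
  refine ⟨h.summable, h.tsum_eq.trans_le (pow_le_pow_left₀ (norm_nonneg _) ?_ 2)⟩
  refine (ContinuousLinearMap.le_opNorm _ _).trans_eq ?_
  rw [norm_l2e, mul_one]

lemma l2_entry_norm_le (A : L2Z →L[ℂ] L2Z) (j k : ℤ) : ‖A (l2e k) j‖ ≤ ‖A‖ := by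
  refine (l2_coord_norm_le _ j).trans ((A.le_opNorm _).trans_eq ?_)
  rw [norm_l2e, mul_one]

/-- The term `k = j` is harmless: `‖d j - d j‖⁻¹` and `1 / 0 ^ 2` are both `0` by convention. -/
lemma hasSum_inv_spacing_sq {d : ℤ → ℂ} {c : ℂ} (hd : ∀ j k : ℤ, d j - d k = c * (j - k)) (j : ℤ) :
    HasSum (fun k : ℤ => (‖d j - d k‖⁻¹) ^ 2) ((‖c‖⁻¹) ^ 2 * ∑' n : ℤ, 1 / (n : ℝ) ^ 2) := by
  have h := ((Real.summable_one_div_int_pow (p := 2)).2 (by norm_num)).hasSum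
  have h1 := ((Equiv.subLeft j).hasSum_iff.2 h).mul_left ((‖c‖⁻¹) ^ 2)
  convert! h1 using 2 with k
  rw [hd, norm_mul, mul_inv, mul_pow]
  congr 1
  simp only [Function.comp_apply, Equiv.subLeft_apply]
  rw [← Int.cast_sub, Complex.norm_intCast, inv_pow, sq_abs, one_div]

/-- Division of the matrix entries by the differences of the diagonal entries is a bounded
operation, and the resulting operators have summable rows. -/
theorem exists_commutator_inverse {d : ℤ → ℂ} {c : ℂ}
    (hd : ∀ j k : ℤ, d j - d k = c * (j - k)) :
    ∃ C : ℝ, 0 ≤ C ∧ ∀ X : L2Z →L[ℂ] L2Z,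
      (∃ T : L2Z →L[ℂ] L2Z, ‖T‖ ≤ C * ‖X‖ ∧
        ∀ j k, T (l2e k) j = X (l2e k) j / (d j - d k)) ∧
      ∀ j, Summable (fun k => ‖X (l2e k) j / (d j - d k)‖) ∧
        ∑' k, ‖X (l2e k) j / (d j - d k)‖ ≤ C * ‖X‖ := by
  set Z : ℝ := (‖c‖⁻¹) ^ 2 * ∑' n : ℤ, 1 / (n : ℝ) ^ 2 with hZ
  have hZ0 : 0 ≤ Z := by
    rw [hZ, ← (hasSum_inv_spacing_sq hd 0).tsum_eq]
    exact tsum_nonneg fun k => by positivity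
  -- Rows and columns of `X` have `ℓ²` norm at most `‖X‖`, and the inverse spacings are square
  -- summable. Cauchy–Schwarz then bounds the absolute row and column sums, as the Schur test
  -- requires.
  have key : ∀ {f g : ℤ → ℝ} {M : ℝ}, (∀ k, 0 ≤ f k) → (∀ k, 0 ≤ g k) → 0 ≤ M →
      Summable (fun k => f k ^ 2) → ∑' k, f k ^ 2 ≤ M ^ 2 → HasSum (fun k => g k ^ 2) Z →
      Summable (fun k => f k * g k) ∧ ∑' k, f k * g k ≤ Real.sqrt Z * M := by
    intro f g M hf hg hM h1 h2 h3
    obtain ⟨h4, h5⟩ := tsum_mul_sq_le hf hg h1 h3.summable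
    refine ⟨h4, le_of_sq_le_sq ?_ (by positivity)⟩
    rw [mul_pow, Real.sq_sqrt hZ0, mul_comm]
    refine h5.trans ?_
    rw [h3.tsum_eq]
    exact mul_le_mul_of_nonneg_right h2 hZ0
  have e : ∀ (X : L2Z →L[ℂ] L2Z) j k, ‖X (l2e k) j / (d j - d k)‖ =
      ‖X (l2e k) j‖ * ‖d j - d k‖⁻¹ := fun X j k => by rw [norm_div, div_eq_mul_inv]
  have hrow : ∀ (X : L2Z →L[ℂ] L2Z) j, Summable (fun k => ‖X (l2e k) j / (d j - d k)‖) ∧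
        ∑' k, ‖X (l2e k) j / (d j - d k)‖ ≤ Real.sqrt Z * ‖X‖ := by
    intro X j
    simp only [e]
    exact key (fun k => norm_nonneg _) (fun k => by positivity) (norm_nonneg _)
      (l2_row_summable X j).1 (l2_row_summable X j).2 (hasSum_inv_spacing_sq hd j)
  refine ⟨Real.sqrt Z, Real.sqrt_nonneg _, fun X => ⟨?_, hrow X⟩⟩
  have hcol : ∀ k, Summable (fun j => ‖X (l2e k) j / (d j - d k)‖) ∧
        ∑' j, ‖X (l2e k) j / (d j - d k)‖ ≤ Real.sqrt Z * ‖X‖ := by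
    intro k
    simp only [e]
    refine key (fun k => norm_nonneg _) (fun k => by positivity) (norm_nonneg _)
      (l2_col_summable X k).1 (l2_col_summable X k).2 ?_
    simpa only [norm_sub_rev] using hasSum_inv_spacing_sq hd k
  exact exists_op_of_schur (fun j k => X (l2e k) j / (d j - d k)) (by positivity)
    (fun j => (hrow X j).1) (fun j => (hrow X j).2) (fun k => (hcol k).1) (fun k => (hcol k).2)

/-- The diagonal part of an operator. -/
lemma exists_diag_part (X : L2Z →L[ℂ] L2Z) :
    ∃ T : L2Z →L[ℂ] L2Z, ‖T‖ ≤ ‖X‖ ∧ ∀ x j, T x j = X (l2e j) j * x j :=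
  exists_diag_op _ (norm_nonneg _) fun k => l2_entry_norm_le X k k

lemma op_mul_diag_entry (Y T : L2Z →L[ℂ] L2Z) {m : ℤ → ℂ} (hT : ∀ x j, T x j = m j * x j)
    (j k : ℤ) : (Y * T) (l2e k) j = Y (l2e k) j * m k := by
  have : T (l2e k) = m k • l2e k := by
    ext i
    rw [hT, lp.coeFn_smul, Pi.smul_apply, smul_eq_mul, l2e_apply]
    split_ifs with h
    · rw [h]
    · simp
  rw [mul_apply_eq_comp, this, map_smul, lp.coeFn_smul, Pi.smul_apply, smul_eq_mul,
    mul_comm]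

/-- Fixed point equation for the matrix which diagonalizes a perturbed diagonal operator. -/
theorem exists_diagonalizer {d : ℤ → ℂ} {C : ℝ} (hC : 0 ≤ C)
    (hS : ∀ X : L2Z →L[ℂ] L2Z, ∃ T : L2Z →L[ℂ] L2Z, ‖T‖ ≤ C * ‖X‖ ∧
        ∀ j k, T (l2e k) j = X (l2e k) j / (d j - d k)) (hdd : ∀ j k, j ≠ k → d j ≠ d k)
    (B : L2Z →L[ℂ] L2Z) (hB : 16 * (C * ‖B‖) ≤ 1) :
    ∃ (Y : L2Z →L[ℂ] L2Z) (Γ : ℤ → ℂ), ‖Y‖ ≤ 4 * (C * ‖B‖) ∧ (∀ j, Y (l2e j) j = 0) ∧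
      (∀ j, ‖Γ j‖ ≤ 2 * ‖B‖) ∧
      ∀ j k, (1 + Y) (l2e k) j * (d k + Γ k) - (B * (1 + Y)) (l2e k) j =
        d j * (1 + Y) (l2e k) j := by
  choose S hSn hSe using hS
  choose Dg hDn hDe using exists_diag_part
  have hSsub : ∀ X X', S X - S X' = S (X - X') := fun X X' => l2_op_ext fun j k => by
    change S X (l2e k) j - S X' (l2e k) j = _
    rw [hSe, hSe, hSe, ← sub_div]
    rfl
  have hDsub : ∀ X X', Dg X - Dg X' = Dg (X - X') := fun X X' => by
    ext x j
    change Dg X x j - Dg X' x j = _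
    rw [hDe, hDe, hDe, ← sub_mul]
    rfl
  set b := ‖B‖ with hb
  have hb0 : 0 ≤ b := norm_nonneg _
  have hBW : ∀ Y : L2Z →L[ℂ] L2Z, ‖Y‖ ≤ 1 → ‖B * (1 + Y)‖ ≤ 2 * b := fun Y hY => by
    refine (norm_mul_le _ _).trans ?_
    have h1 : ‖(1 : L2Z →L[ℂ] L2Z) + Y‖ ≤ 2 :=
      (norm_add_le _ _).trans (by linarith [show ‖(1 : L2Z →L[ℂ] L2Z)‖ ≤ 1 from ContinuousLinearMap.norm_id_le])
    nlinarith
  -- The equation to solve is `(D + B)(1 + Y) = (1 + Y)(D + Γ)`, with `D`, `Γ` diagonal and `Y` of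
  -- zero diagonal. Its diagonal forces `Γ` to be the diagonal part of `B (1 + Y)`; off the diagonal
  -- it reads `(d j - d k) Y_jk = G(Y)_jk`. As `S` divides by `0` on the diagonal, `S (G Y)`
  -- automatically has zero diagonal.
  set G : (L2Z →L[ℂ] L2Z) → (L2Z →L[ℂ] L2Z) :=
    fun Y => -(B * (1 + Y)) + Y * Dg (B * (1 + Y)) with hG
  set Φ : (L2Z →L[ℂ] L2Z) → (L2Z →L[ℂ] L2Z) := fun Y => S (G Y) with hΦ
  have hGn : ∀ Y, ‖Y‖ ≤ 1 → ‖G Y‖ ≤ 4 * b := fun Y hY => by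
    have h1 := hBW Y hY
    have h2 : ‖Y * Dg (B * (1 + Y))‖ ≤ 1 * (2 * b) :=
      (norm_mul_le _ _).trans (mul_le_mul hY ((hDn _).trans h1) (norm_nonneg _) zero_le_one)
    calc ‖G Y‖ ≤ ‖-(B * (1 + Y))‖ + ‖Y * Dg (B * (1 + Y))‖ := norm_add_le _ _
      _ ≤ 4 * b := by rw [norm_neg]; linarith
  have hΦn : ∀ Y, ‖Y‖ ≤ 1 → ‖Φ Y‖ ≤ 4 * (C * b) := fun Y hY =>
    (hSn _).trans ((mul_le_mul_of_nonneg_left (hGn Y hY) hC).trans_eq (by ring))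
  have hGl : ∀ Y Y', ‖Y‖ ≤ 1 → ‖Y'‖ ≤ 1 → ‖G Y - G Y'‖ ≤ 4 * b * ‖Y - Y'‖ := by
    intro Y Y' hY hY'
    have e : G Y - G Y' = -(B * (Y - Y')) + ((Y - Y') * Dg (B * (1 + Y)) +
        Y' * Dg (B * (Y - Y'))) := by
      have e1 : Dg (B * (Y - Y')) = Dg (B * (1 + Y)) - Dg (B * (1 + Y')) := by
        rw [hDsub]; congr 1; noncomm_ring
      rw [e1, hG]
      noncomm_ring
    have h0 : ‖B * (Y - Y')‖ ≤ b * ‖Y - Y'‖ := norm_mul_le _ _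
    have h1 : ‖(Y - Y') * Dg (B * (1 + Y))‖ ≤ ‖Y - Y'‖ * (2 * b) :=
      (norm_mul_le _ _).trans (mul_le_mul_of_nonneg_left ((hDn _).trans (hBW Y hY))
        (norm_nonneg _))
    have h2 : ‖Y' * Dg (B * (Y - Y'))‖ ≤ 1 * (b * ‖Y - Y'‖) :=
      (norm_mul_le _ _).trans (mul_le_mul hY' ((hDn _).trans h0) (norm_nonneg _) zero_le_one)
    rw [e]
    refine (norm_add_le _ _).trans ?_
    have h3 := norm_add_le ((Y - Y') * Dg (B * (1 + Y))) (Y' * Dg (B * (Y - Y')))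
    rw [norm_neg]
    linarith
  have hmaps : Set.MapsTo Φ (Metric.closedBall 0 1) (Metric.closedBall 0 1) := fun Y hY => by
    rw [mem_closedBall_zero_iff] at hY ⊢
    have := hΦn Y hY
    linarith
  -- The Lipschitz constant found is `4 C ‖B‖`, at most `1/4` by `hB`.
  have hcontr : ContractingWith (1 / 2) (hmaps.restrict Φ _ _) := by
    refine ⟨by rw [← NNReal.coe_lt_coe]; norm_num, LipschitzWith.of_dist_le_mul fun Y Y' => ?_⟩
    have hY := mem_closedBall_zero_iff.1 Y.2
    have hY' := mem_closedBall_zero_iff.1 Y'.2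
    change dist (Φ Y) (Φ Y') ≤ _ * dist (Y : L2Z →L[ℂ] L2Z) Y'
    rw [dist_eq_norm, dist_eq_norm, hΦ]
    simp only [hSsub]
    refine (hSn _).trans ((mul_le_mul_of_nonneg_left (hGl _ _ hY hY') hC).trans ?_)
    have h3 : C * (4 * b * ‖(Y : L2Z →L[ℂ] L2Z) - Y'‖) = 4 * (C * b) * ‖(Y : L2Z →L[ℂ] L2Z) - Y'‖ := by
      ring
    rw [h3]
    refine mul_le_mul_of_nonneg_right ?_ (norm_nonneg _)
    norm_num
    linarith
  obtain ⟨Y, hYm, hYf, -⟩ := hcontr.exists_fixedPoint' Metric.isClosed_closedBall.isComplete hmaps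
    (x := 0) (by simp) (edist_ne_top _ _)
  have hY1 : ‖Y‖ ≤ 1 := mem_closedBall_zero_iff.1 hYm
  have hYe : ∀ j k, Y (l2e k) j = G Y (l2e k) j / (d j - d k) := fun j k => by
    rw [← hSe]
    exact congrArg (fun T : L2Z →L[ℂ] L2Z => T (l2e k) j) hYf.symm
  have hY0 : ∀ j, Y (l2e j) j = 0 := fun j => by rw [hYe, sub_self, div_zero]
  refine ⟨Y, fun j => (B * (1 + Y)) (l2e j) j, ?_, hY0, fun j => ?_, fun j k => ?_⟩
  · conv_lhs => rw [← hYf]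
    exact hΦn Y hY1
  · exact (l2_entry_norm_le _ _ _).trans (hBW Y hY1)
  · have h1 : (1 + Y) (l2e k) j = l2e k j + Y (l2e k) j := rfl
    rw [h1]
    by_cases h : j = k
    · subst h
      rw [hY0, l2e_self]
      ring
    · have h2 : d j - d k ≠ 0 := sub_ne_zero.2 (hdd j k h)
      have h3 : (d j - d k) * Y (l2e k) j = G Y (l2e k) j := by
        rw [hYe]; field_simp
      have h4 : G Y (l2e k) j = -(B * (1 + Y)) (l2e k) j +
          (Y * Dg (B * (1 + Y))) (l2e k) j := rfl
      rw [op_mul_diag_entry Y _ (hDe _)] at h4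
      rw [l2e_apply, if_neg h]
      linear_combination -h3 - h4

/-- Diagonalization of a small bounded perturbation of a diagonal operator whose entries are
equally spaced. The operator is described by its graph. -/
theorem exists_diagonalization {d : ℤ → ℂ} {c : ℂ} (hc : c ≠ 0)
    (hd : ∀ j k : ℤ, d j - d k = c * (j - k)) {t : ℂ} (ht : ∀ j, 1 ≤ ‖d j - t‖) :
    ∃ K ε : ℝ, 0 < K ∧ 0 < ε ∧ ∀ B : L2Z →L[ℂ] L2Z, ‖B‖ ≤ ε →
      ∃ (W : L2Z ≃L[ℂ] L2Z) (σ : ℤ → ℂ),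
        (∀ x, ‖W x - x‖ ≤ K * ‖B‖ * ‖x‖) ∧ (∀ j, W (l2e j) j = 1) ∧
        (∀ j, ‖σ j - d j‖ ≤ K * ‖B‖) ∧
        (∀ x y : L2Z, (∀ j, (y - B x) j = d j * x j) ↔
          ∀ j, W.symm y j = σ j * W.symm x j) ∧
        ∀ (x : L2Z) (R : ℝ), ‖x‖ ≤ R → (∀ j, ‖d j * x j‖ ≤ R) →
          ∀ j, ‖d j * W.symm x j - d j * x j‖ ≤ K * ‖B‖ * R := by
  obtain ⟨C, hC, hS⟩ := exists_commutator_inverse hd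
  have hdd : ∀ j k, j ≠ k → d j ≠ d k := fun j k h => by
    rw [← sub_ne_zero, hd]
    exact mul_ne_zero hc (sub_ne_zero.2 (by exact_mod_cast h))
  -- The bound `1/4` keeps `σ` at distance `1/2` from `t` and gives uniqueness below; `1/(16 C + 1)`
  -- is what `exists_diagonalizer` needs. The sum `8 C + 6 C + 6` of the three errors in the last
  -- clause is `14 C + 6`.
  refine ⟨14 * C + 6, min (1 / 4) (1 / (16 * C + 1)), by positivity, by positivity,
    fun B hB => ?_⟩
  have hb0 := norm_nonneg B
  have hb1 : ‖B‖ ≤ 1 / 4 := hB.trans (min_le_left _ _)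
  have hb2 : 16 * (C * ‖B‖) ≤ 1 := by
    have h1 := hB.trans (min_le_right _ _)
    rw [le_div_iff₀ (by positivity)] at h1
    nlinarith
  obtain ⟨Y, Γ, hY, hY0, hΓ, hrel⟩ := exists_diagonalizer hC (fun X => (hS X).1) hdd B hb2
  set b := ‖B‖ with hb
  have hYlt : ‖-Y‖ < 1 := by rw [norm_neg]; linarith
  set U := Units.oneSub (-Y) hYlt with hU
  set W := ContinuousLinearEquiv.ofUnit U with hW
  have hWx : ∀ x, W x = x + Y x := fun x => by
    change (1 - (-Y)) x = _
    rw [sub_neg_eq_add]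
    rfl
  have hPx : ∀ x, W.symm x + Y (W.symm x) = x := fun x => by
    rw [← hWx, ContinuousLinearEquiv.apply_symm_apply]
  have hPn : ∀ x, ‖W.symm x‖ ≤ 2 * ‖x‖ := fun x => by
    have h1 := norm_sub_norm_le (W.symm x) (-Y (W.symm x))
    rw [sub_neg_eq_add, hPx, norm_neg] at h1
    have h2 := Y.le_opNorm (W.symm x)
    nlinarith [norm_nonneg (W.symm x)]
  -- The intertwining relation is summed along row `j` against `z`; this is legitimate because `η =
  -- (D + Γ) z` is a given element of `ℓ²`.
  have hfwd : ∀ z η : L2Z, (∀ j, η j = (d j + Γ j) * z j) →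
      ∀ j, (W η - B (W z)) j = d j * (W z) j := by
    intro z η h j
    have e1 := l2_op_coord_hasSum (1 + Y) η j
    have e2 := l2_op_coord_hasSum (B * (1 + Y)) z j
    have e3 := (l2_op_coord_hasSum (1 + Y) z j).mul_left (d j)
    have e4 := e1.sub e2
    have e5 : (W η - B (W z)) j = ((1 + Y) η) j - ((B * (1 + Y)) z) j := by
      rw [hWx, hWx]; rfl
    rw [e5, hWx]
    refine e4.unique (e3.congr_fun fun k => ?_)
    rw [h]
    linear_combination z k * hrel j k
  have hgraph : ∀ x y : L2Z, (∀ j, (y - B x) j = d j * x j) ↔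
      ∀ j, W.symm y j = (d j + Γ j) * W.symm x j := by
    intro x y
    constructor
    · intro h
      -- Resolvent argument at `t`: if `z` solves `(σ - t) z = W⁻¹ (y - t x)`, then `u = x - W z`
      -- satisfies `(t - D) u = B u`. Since `|t - d j| ≥ 1` and `‖B‖ ≤ 1/4`, it vanishes.
      have hσ : ∀ j, 1 / 2 ≤ ‖d j + Γ j - t‖ := fun j => by
        have h1 := norm_sub_norm_le (d j - t) (-Γ j)
        rw [norm_neg, sub_neg_eq_add, show d j - t + Γ j = d j + Γ j - t by ring] at h1
        linarith [ht j, hΓ j]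
      obtain ⟨T, -, hT⟩ := exists_diag_op (fun j => (d j + Γ j - t)⁻¹) (R := 2) (by norm_num)
        fun j => by
          rw [norm_inv]
          exact (inv_anti₀ (by norm_num) (hσ j)).trans_eq (by norm_num)
      set z := T (W.symm (y - t • x)) with hz
      set η := W.symm (y - t • x) + t • z with hη
      have h1 : ∀ j, η j = (d j + Γ j) * z j := fun j => by
        have h2 : d j + Γ j - t ≠ 0 := norm_pos_iff.1 (lt_of_lt_of_le (by norm_num) (hσ j))
        have h3 : (d j + Γ j - t) * z j = W.symm (y - t • x) j := by
          rw [hz, hT]; field_simp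
        have h4 : η j = W.symm (y - t • x) j + t * z j := rfl
        rw [h4, ← h3]; ring
      have h2 := hfwd z η h1
      have h3 : W η = y - t • x + t • W z := by
        rw [hη, map_add, ContinuousLinearEquiv.apply_symm_apply, map_smul]
      set u := x - W z with hu
      have h4 : ∀ j, (t - d j) * u j = B u j := fun j => by
        have h5 := h j
        have h6 := h2 j
        rw [h3] at h6
        have h7 : (y - t • x + t • W z - B (W z)) j = y j - t * x j + t * W z j - B (W z) j := rfl
        have h8 : (y - B x) j = y j - B x j := rfl
        have h9 : B u j = B x j - B (W z) j := by rw [hu, map_sub]; rfl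
        have h10 : u j = x j - W z j := rfl
        rw [h9, h10]
        rw [h7] at h6
        rw [h8] at h5
        linear_combination h5 - h6
      have h5 : ‖u‖ ≤ ‖B u‖ := lp.norm_mono (by norm_num) fun j => by
        rw [← h4, norm_mul, norm_sub_rev]
        nlinarith [ht j, norm_nonneg (u j)]
      have h6 : u = 0 := by
        have h7 := B.le_opNorm u
        have h8 : ‖u‖ ≤ 0 := by nlinarith [norm_nonneg u]
        exact norm_le_zero_iff.1 h8
      have h7 : x = W z := sub_eq_zero.1 h6
      have h8 : W.symm x = z := by rw [h7, ContinuousLinearEquiv.symm_apply_apply]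
      have h9 : W.symm y = η := by
        rw [hη, map_sub, map_smul, h8, sub_add_cancel]
      rw [h8, h9]
      exact h1
    · intro h j
      have := hfwd _ _ h j
      simpa using this
  refine ⟨W, fun j => d j + Γ j, fun x => ?_, fun j => ?_, fun j => ?_, hgraph, ?_⟩
  · rw [hWx, add_sub_cancel_left]
    exact (Y.le_opNorm x).trans (mul_le_mul_of_nonneg_right
      (by nlinarith [mul_nonneg hC hb0]) (norm_nonneg x))
  · rw [hWx]
    change l2e j j + Y (l2e j) j = 1
    rw [hY0, l2e_self, add_zero]
  · rw [add_sub_cancel_left]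
    exact (hΓ j).trans (by nlinarith [mul_nonneg hC hb0])
  · intro x R hxR hR j
    have hR0 : 0 ≤ R := (norm_nonneg _).trans hxR
    set P : L2Z →L[ℂ] L2Z := (W.symm : L2Z →L[ℂ] L2Z) with hP
    have hPn' : ‖P‖ ≤ 2 := P.opNorm_le_bound (by norm_num) hPn
    obtain ⟨D, hDn, hD⟩ := exists_diag_op Γ (R := 2 * b) (by positivity) hΓ
    -- In this clause `D` is the diagonal operator of `Γ`. The intertwining relation for `P = W⁻¹`
    -- becomes `(d k - d j) P_jk = Q_jk` with `Q` bounded of size `O(‖B‖)`. The off-diagonal rows of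
    -- `P` are therefore absolutely summable, which suffices against the merely bounded sequence `d
    -- k * x k`.
    set Q := D * P - P * B with hQ
    have hQn : ‖Q‖ ≤ 6 * b := by
      have h1 : ‖D * P‖ ≤ 2 * b * 2 :=
        (norm_mul_le _ _).trans (mul_le_mul hDn hPn' (norm_nonneg _) (by positivity))
      have h2 : ‖P * B‖ ≤ 2 * b :=
        (norm_mul_le _ _).trans (mul_le_mul_of_nonneg_right hPn' hb0)
      exact (norm_sub_le _ _).trans (by linarith)
    have hZn : ∀ k, ‖P (l2e k) k - 1‖ ≤ 8 * (C * b) := fun k => by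
      have h1 : P (l2e k) k - 1 = -(Y (P (l2e k)) k) := by
        have h2 : P (l2e k) k + Y (P (l2e k)) k = l2e k k :=
          congrArg (fun v : L2Z => v k) (hPx (l2e k))
        rw [l2e_self] at h2
        linear_combination h2
      rw [h1, norm_neg]
      refine (l2_coord_norm_le _ k).trans ((Y.le_opNorm _).trans ?_)
      have h3 := hPn (l2e k)
      rw [norm_l2e, mul_one] at h3
      have h4 : ‖P (l2e k)‖ ≤ 2 := h3
      nlinarith [norm_nonneg (P (l2e k)), norm_nonneg Y, mul_nonneg hC hb0]
    have hQe : ∀ k, (d k - d j) * P (l2e k) j = Q (l2e k) j := fun k => by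
      have h1 := (hgraph (l2e k) (d k • l2e k + B (l2e k))).1 (fun i => by
        rw [add_sub_cancel_right, lp.coeFn_smul, Pi.smul_apply, smul_eq_mul, l2e_apply]
        split_ifs with h
        · rw [h]
        · simp) j
      rw [map_add, map_smul] at h1
      have h2 : (d k • W.symm (l2e k) + W.symm (B (l2e k))) j =
        d k * P (l2e k) j + (P * B) (l2e k) j := rfl
      have h3 : Q (l2e k) j = Γ j * P (l2e k) j - (P * B) (l2e k) j := by
        rw [← hD]; rfl
      have h4 : W.symm (l2e k) j = P (l2e k) j := rfl
      rw [h2, h4] at h1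
      rw [h3]
      linear_combination h1
    have hrow := (hS Q).2 j
    -- This is row `j` of `P` off the diagonal; division by zero makes it `0` at `k = j`, where the
    -- entry is treated through `P_jj - 1`.
    set a : ℤ → ℂ := fun k => -(Q (l2e k) j / (d j - d k)) with ha
    have ha0 : a j = 0 := by simp [ha]
    have hPa : ∀ k, k ≠ j → P (l2e k) j = a k := fun k hk => by
      have h1 : d k - d j ≠ 0 := sub_ne_zero.2 (hdd k j hk)
      have h2 : d j - d k ≠ 0 := sub_ne_zero.2 (hdd k j hk).symm
      rw [ha]
      simp only
      rw [← hQe k]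
      field_simp
      ring
    have han : Summable fun k => ‖a k * (d k * x k)‖ := by
      refine Summable.of_nonneg_of_le (fun k => norm_nonneg _) (fun k => ?_) (hrow.1.mul_right R)
      rw [norm_mul, ha, norm_neg]
      exact mul_le_mul_of_nonneg_left (hR k) (norm_nonneg _)
    have e1 : HasSum (fun k => (if k = j then (P (l2e j) j - 1) * (d j * x j) else 0) +
        a k * (d k * x k) - x k * Q (l2e k) j)
        ((P (l2e j) j - 1) * (d j * x j) + ∑' k, a k * (d k * x k) - Q x j) :=
      ((hasSum_ite_eq j _).add han.of_norm.hasSum).sub (l2_op_coord_hasSum Q x j)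
    have e2 : HasSum (fun k => d j * (x k * P (l2e k) j) - (if k = j then d j * x j else 0))
        (d j * P x j - d j * x j) :=
      ((l2_op_coord_hasSum P x j).mul_left (d j)).sub (hasSum_ite_eq j _)
    -- The identity `d j * P_jk = P_jk * d k - Q_jk` moves the weight from the output to the input.
    have e3 : d j * P x j - d j * x j =
        (P (l2e j) j - 1) * (d j * x j) + ∑' k, a k * (d k * x k) - Q x j := by
      refine e2.unique (e1.congr_fun fun k => ?_)
      rw [← hQe k]
      by_cases hk : k = j
      · subst hk
        simp only [if_true, ha0]
        ring
      · rw [if_neg hk, if_neg hk, hPa k hk]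
        ring
    change ‖d j * P x j - d j * x j‖ ≤ _
    rw [e3]
    have b1 : ‖(P (l2e j) j - 1) * (d j * x j)‖ ≤ 8 * (C * b) * R := by
      rw [norm_mul]
      exact mul_le_mul (hZn j) (hR j) (norm_nonneg _) (by positivity)
    have b2 : ‖∑' k, a k * (d k * x k)‖ ≤ C * (6 * b) * R := by
      refine (norm_tsum_le_tsum_norm han).trans ?_
      refine (han.tsum_le_tsum (fun k => ?_) (hrow.1.mul_right R)).trans ?_
      · rw [norm_mul, ha, norm_neg]
        exact mul_le_mul_of_nonneg_left (hR k) (norm_nonneg _)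
      · rw [tsum_mul_right]
        exact mul_le_mul_of_nonneg_right
          (hrow.2.trans (mul_le_mul_of_nonneg_left hQn hC)) hR0
    have b3 : ‖Q x j‖ ≤ 6 * b * R :=
      (l2_coord_norm_le _ j).trans ((Q.le_opNorm x).trans
        (mul_le_mul hQn hxR (norm_nonneg _) (by positivity)))
    calc _ ≤ ‖(P (l2e j) j - 1) * (d j * x j)‖ + ‖∑' k, a k * (d k * x k)‖ + ‖Q x j‖ :=
          (norm_sub_le _ _).trans (by gcongr; exact norm_add_le _ _)
      _ ≤ 8 * (C * b) * R + C * (6 * b) * R + 6 * b * R := by gcongr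
      _ = _ := by ring

/-! ### Integration by parts against primitives -/

lemma AbsolutelyContinuousOnInterval.ofReal {g : ℝ → ℝ} {a b : ℝ}
    (hg : AbsolutelyContinuousOnInterval g a b) :
    AbsolutelyContinuousOnInterval (fun x => (g x : ℂ)) a b := by
  rw [absolutelyContinuousOnInterval_iff] at hg ⊢
  simpa only [Complex.isometry_ofReal.dist_eq] using hg

lemma absolutelyContinuous_complex_primitive {v : ℝ → ℂ} {a b : ℝ}
    (hv : IntervalIntegrable v volume a b) :
    AbsolutelyContinuousOnInterval (fun x => ∫ t in a..x, v t) a b := by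
  have hre : IntervalIntegrable (fun t => (v t).re) volume a b :=
    ⟨hv.1.re, hv.2.re⟩
  have him : IntervalIntegrable (fun t => (v t).im) volume a b :=
    ⟨hv.1.im, hv.2.im⟩
  have h1 := (hre.absolutelyContinuousOnInterval_intervalIntegral (c := a) Set.left_mem_uIcc).ofReal
  have h2 := ((him.absolutelyContinuousOnInterval_intervalIntegral (c := a)
    Set.left_mem_uIcc).ofReal).const_smul I
  have h3 := h1.add h2
  rw [absolutelyContinuousOnInterval_iff] at h3 ⊢
  intro ε hε
  obtain ⟨δ, hδ, h4⟩ := h3 ε hε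
  refine ⟨δ, hδ, fun E hE hE' => ?_⟩
  have e : ∀ x ∈ Set.uIcc a b, ∫ t in a..x, v t =
      ((∫ t in a..x, (v t).re : ℝ) : ℂ) + I • ((∫ t in a..x, (v t).im : ℝ) : ℂ) := by
    intro x hx
    have hvx : IntervalIntegrable v volume a x :=
      hv.mono_set (Set.uIcc_subset_uIcc_left hx)
    have e1 := reCLM.intervalIntegral_comp_comm (μ := volume) hvx
    have e2 := imCLM.intervalIntegral_comp_comm (μ := volume) hvx
    simp only [reCLM_apply, imCLM_apply] at e1 e2
    rw [e1, e2, smul_eq_mul, mul_comm, re_add_im]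
  refine lt_of_eq_of_lt (Finset.sum_congr rfl fun i hi => ?_) (h4 E hE hE')
  have hm := hE.1 i hi
  rw [e _ hm.1, e _ hm.2]
  rfl

/-- Here `u` is only a primitive of an integrable function. The difference between `u G` and the
primitive of `v G + u G'` is absolutely continuous with zero derivative almost everywhere, hence
constant. -/
theorem integral_mul_deriv_of_primitive {u v G G' : ℝ → ℂ} {L : ℝ} (hL : 0 ≤ L)
    (hv : IntervalIntegrable v volume 0 L)
    (hu : ∀ x ∈ Set.Icc 0 L, u x = u 0 + ∫ t in (0 : ℝ)..x, v t)
    (hG : ∀ x, HasDerivAt G (G' x) x) (hG' : Continuous G') :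
    ∫ x in (0 : ℝ)..L, u x * G' x =
      u L * G L - u 0 * G 0 - ∫ x in (0 : ℝ)..L, v x * G x := by
  set U : ℝ → ℂ := fun x => u 0 + ∫ t in (0 : ℝ)..x, v t with hU
  have hUac : AbsolutelyContinuousOnInterval U 0 L :=
    (contDiff_const.contDiffOn.absolutelyContinuousOnInterval).add
      (absolutelyContinuous_complex_primitive hv)
  have hGc : Continuous G := continuous_iff_continuousAt.2 fun x => (hG x).continuousAt
  have hGac : AbsolutelyContinuousOnInterval G 0 L := by
    refine ContDiffOn.absolutelyContinuousOnInterval (ContDiff.contDiffOn ?_)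
    refine contDiff_one_iff_deriv.2 ⟨fun x => (hG x).differentiableAt, ?_⟩
    rwa [show deriv G = G' from funext fun x => (hG x).deriv]
  have hUG : IntervalIntegrable (fun x => U x * G' x) volume 0 L :=
    (hUac.continuousOn.mul hG'.continuousOn).intervalIntegrable
  have hvG : IntervalIntegrable (fun x => v x * G x) volume 0 L :=
    hv.mul_continuousOn hGc.continuousOn
  have hw := hvG.add hUG
  have hac := (hUac.smul hGac).sub (absolutelyContinuous_complex_primitive hw)
  obtain ⟨c, hc⟩ := hac.const_of_ae_hasDerivAt_zero (by
    filter_upwards [hv.ae_hasDerivAt_integral, hw.ae_hasDerivAt_integral] with x h1 h2 hx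
    have e1 := ((h1 hx 0 Set.left_mem_uIcc).const_add (u 0)).mul (hG x)
    have e2 := h2 hx 0 Set.left_mem_uIcc
    have e3 := e1.sub e2
    convert! e3 using 1
    simp [hU])
  have h0 : U L * G L - (∫ x in (0 : ℝ)..L, (v x * G x + U x * G' x)) =
      U 0 * G 0 - ∫ x in (0 : ℝ)..0, (v x * G x + U x * G' x) :=
    (hc L Set.right_mem_uIcc).trans (hc 0 Set.left_mem_uIcc).symm
  have hU0 : U 0 = u 0 := by simp [hU]
  have hUL : U L = u L := (hu L (Set.right_mem_Icc.2 hL)).symm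
  rw [hU0, hUL, intervalIntegral.integral_same, intervalIntegral.integral_add hvG hUG] at h0
  have e5 : ∫ x in (0 : ℝ)..L, u x * G' x = ∫ x in (0 : ℝ)..L, U x * G' x :=
    intervalIntegral.integral_congr fun x hx => by
      rw [Set.uIcc_of_le hL] at hx
      simp only [hu x hx, hU]
  rw [e5]
  linear_combination -h0

/-! ### The measure and multiplication operators -/

lemma tank_factor_ne_zero {L : ℝ} (hL : 0 < L) : ENNReal.ofReal (1 / (2 * L)) ≠ 0 := by
  simpa using hL

lemma ae_tank_iff {L : ℝ} (hL : 0 < L) {P : ℝ → Prop} :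
    (∀ᵐ x ∂(tankMeasure L), P x) ↔ ∀ᵐ x ∂(volume.restrict (Set.Ioo 0 L)), P x := by
  rw [tankMeasure, Measure.ae_ennreal_smul_measure_iff (tank_factor_ne_zero hL)]

lemma ae_tank_mem {L : ℝ} (hL : 0 < L) : ∀ᵐ x ∂(tankMeasure L), x ∈ Set.Ioo 0 L :=
  (ae_tank_iff hL).2 (ae_restrict_mem measurableSet_Ioo)

lemma memLp_tank_iff {L : ℝ} (hL : 0 < L) {u : ℝ → C2} :
    MemLp u 2 (tankMeasure L) ↔ MemLp u 2 (volume.restrict (Set.Ioo 0 L)) := by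
  refine ⟨fun h => ?_, fun h => h.smul_measure ENNReal.ofReal_ne_top⟩
  have h1 := h.smul_measure (c := (ENNReal.ofReal (1 / (2 * L)))⁻¹)
    (ENNReal.inv_ne_top.2 (tank_factor_ne_zero hL))
  rwa [tankMeasure, smul_smul, ENNReal.inv_mul_cancel (tank_factor_ne_zero hL)
    ENNReal.ofReal_ne_top, one_smul] at h1

lemma integral_tank {L : ℝ} (hL : 0 < L) (φ : ℝ → ℂ) :
    ∫ x, φ x ∂(tankMeasure L) = 1 / (2 * L) * ∫ x in (0 : ℝ)..L, φ x := by
  rw [tankMeasure, integral_smul_measure, intervalIntegral.integral_of_le hL.le,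
    integral_Ioc_eq_integral_Ioo, ENNReal.toReal_ofReal (by positivity), real_smul]
  push_cast
  rfl

lemma continuousOn_memLp_tank {L : ℝ} (hL : 0 < L) {u : ℝ → C2}
    (hu : ContinuousOn u (Set.Icc 0 L)) : MemLp u 2 (tankMeasure L) := by
  obtain ⟨C, hC⟩ := isCompact_Icc.exists_bound_of_continuousOn hu
  refine (memLp_tank_iff hL).2 (MemLp.of_bound ((hu.mono
    Set.Ioo_subset_Icc_self).aestronglyMeasurable measurableSet_Ioo) C ?_)
  filter_upwards [ae_restrict_mem measurableSet_Ioo] with x hx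
    using hC x (Set.Ioo_subset_Icc_self hx)

lemma IsH1Rep.continuousOn {L : ℝ} (hL : 0 < L) {u v : ℝ → C2} (h : IsH1Rep L u v) :
    ContinuousOn u (Set.Icc 0 L) := by
  have hv := intervalIntegrable_of_memLp_tank h.1 (Set.right_mem_Icc.2 hL.le)
  have := intervalIntegral.continuousOn_primitive_interval' hv Set.left_mem_uIcc
  rw [Set.uIcc_of_le hL.le] at this
  exact (continuousOn_const.add this).congr h.2

lemma coeFn_tankClass {L : ℝ} {u : ℝ → C2} (hu : MemLp u 2 (tankMeasure L)) :
    tankClass L u =ᵐ[tankMeasure L] u := by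
  rw [tankClass, dif_pos hu]
  exact hu.coeFn_toLp

/-- Multiplication by a bounded matrix-valued function. -/
theorem exists_mulOp {L : ℝ} (m : ℝ → C2 →L[ℂ] C2)
    (hm : AEStronglyMeasurable m (tankMeasure L)) {K : ℝ} (hK0 : 0 ≤ K)
    (hK : ∀ᵐ x ∂(tankMeasure L), ‖m x‖ ≤ K) :
    ∃ T : TankL2 L →L[ℂ] TankL2 L, ‖T‖ ≤ K ∧
      ∀ f : TankL2 L, T f =ᵐ[tankMeasure L] fun x => m x (f x) := by
  have hb : ∀ f : TankL2 L, ∀ᵐ x ∂(tankMeasure L), ‖m x (f x)‖ ≤ K * ‖f x‖ := fun f => by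
    filter_upwards [hK] with x hx
    exact ((m x).le_opNorm _).trans (mul_le_mul_of_nonneg_right hx (norm_nonneg _))
  have hmem : ∀ f : TankL2 L, MemLp (fun x => m x (f x)) 2 (tankMeasure L) := fun f => by
    refine (Lp.memLp f).of_le_mul ?_ (hb f)
    exact isBoundedBilinearMap_apply.continuous.comp_aestronglyMeasurable
      (hm.prodMk (Lp.aestronglyMeasurable f))
  let T0 : TankL2 L →ₗ[ℂ] TankL2 L :=
    { toFun := fun f => (hmem f).toLp _
      map_add' := fun f g => by
        apply Lp.ext
        filter_upwards [(hmem (f + g)).coeFn_toLp, Lp.coeFn_add ((hmem f).toLp _)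
          ((hmem g).toLp _), (hmem f).coeFn_toLp, (hmem g).coeFn_toLp, Lp.coeFn_add f g]
          with x h1 h2 h3 h4 h5
        rw [h1, h2, Pi.add_apply, h3, h4, h5, Pi.add_apply, map_add]
      map_smul' := fun c f => by
        apply Lp.ext
        filter_upwards [(hmem (c • f)).coeFn_toLp, Lp.coeFn_smul c ((hmem f).toLp _),
          (hmem f).coeFn_toLp, Lp.coeFn_smul c f] with x h1 h2 h3 h4
        rw [h1, RingHom.id_apply, h2, Pi.smul_apply, h3, h4, Pi.smul_apply, map_smul] }
  have hT0 : ∀ f, ‖T0 f‖ ≤ K * ‖f‖ := fun f => by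
    refine Lp.norm_le_mul_norm_of_ae_le_mul ?_
    filter_upwards [(hmem f).coeFn_toLp, hb f] with x h1 h2
    exact h1 ▸ h2
  exact ⟨T0.mkContinuous K hT0, LinearMap.mkContinuous_norm_le _ hK0 _,
    fun f => (hmem f).coeFn_toLp⟩

/-- The diagonal matrix `diag(a, b)` acting on `ℂ²`. -/
def diagC2 (a b : ℂ) : C2 →L[ℂ] C2 :=
  a • (EuclideanSpace.proj 0 : C2 →L[ℂ] ℂ).smulRight (EuclideanSpace.single 0 1) +
    b • (EuclideanSpace.proj 1 : C2 →L[ℂ] ℂ).smulRight (EuclideanSpace.single 1 1)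

@[simp] lemma diagC2_apply_zero (a b : ℂ) (v : C2) : diagC2 a b v 0 = a * v 0 := by
  simp [diagC2]

@[simp] lemma diagC2_apply_one (a b : ℂ) (v : C2) : diagC2 a b v 1 = b * v 1 := by
  simp [diagC2]

/-- The antisymmetric matrix `J` as an operator on `ℂ²`. -/
def matJL : C2 →L[ℂ] C2 :=
  (1 / 3 : ℂ) • ((EuclideanSpace.proj 1 : C2 →L[ℂ] ℂ).smulRight (EuclideanSpace.single 0 1) -
    (EuclideanSpace.proj 0 : C2 →L[ℂ] ℂ).smulRight (EuclideanSpace.single 1 1))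

lemma matJL_apply (v : C2) : matJL v = matJ v := by
  ext i
  fin_cases i <;> simp [matJL, matJ] <;> ring

lemma exists_weightOp {L : ℝ} (hL : 0 < L) (mu : ℝ) :
    ∃ T : TankL2 L →L[ℂ] TankL2 L, ∀ f : TankL2 L, T f =ᵐ[tankMeasure L] fun x =>
      diagC2 (exp (mu * (L - x))) (exp (-(mu * (L - x)))) (f x) := by
  have hc : Continuous fun x : ℝ =>
      diagC2 (exp (mu * (L - x))) (exp (-(mu * (L - x)))) := by
    unfold diagC2
    fun_prop
  obtain ⟨K, hK⟩ := (isCompact_Icc (a := 0) (b := L)).exists_bound_of_continuousOn hc.continuousOn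
  obtain ⟨T, -, hT⟩ := exists_mulOp _ hc.aestronglyMeasurable
    (K := K) ((norm_nonneg _).trans (hK 0 (Set.left_mem_Icc.2 hL.le))) (by
      filter_upwards [ae_tank_mem hL] with x hx using hK x (Set.Ioo_subset_Icc_self hx))
  exact ⟨T, hT⟩

/-- Multiplication by `diag(e^{μ(L-x)}, e^{-μ(L-x)})` is an isomorphism of `(L²)²`. -/
lemma exists_weightEquiv {L : ℝ} (hL : 0 < L) (mu : ℝ) :
    ∃ T : TankL2 L ≃L[ℂ] TankL2 L, ∀ f : TankL2 L, T f =ᵐ[tankMeasure L] fun x =>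
      diagC2 (exp (mu * (L - x))) (exp (-(mu * (L - x)))) (f x) := by
  obtain ⟨T, hT⟩ := exists_weightOp hL mu
  obtain ⟨S, hS⟩ := exists_weightOp hL (-mu)
  refine ⟨ContinuousLinearEquiv.equivOfInverse T S (fun f => ?_) (fun f => ?_), hT⟩
  · apply Lp.ext
    filter_upwards [hS (T f), hT f] with x h1 h2
    rw [h1, h2]
    ext i
    fin_cases i <;> simp [← mul_assoc, ← exp_add]
  · apply Lp.ext
    filter_upwards [hT (S f), hS f] with x h1 h2
    rw [h1, h2]
    ext i
    fin_cases i <;> simp [← mul_assoc, ← exp_add]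

/-! ### Coefficients with respect to the eigenfunctions of the uncoupled system -/

/-- The eigenvalue `μ + iπn/L` of the uncoupled system. -/
def tankFreq (L mu : ℝ) (n : ℤ) : ℂ := mu + I * Real.pi * n / L

/-- The `n`-th coefficient of a function with respect to the eigenfunctions of the
uncoupled system. -/
def tankCoefInt (L mu : ℝ) (n : ℤ) (u : ℝ → C2) : ℂ :=
  1 / (2 * L) * ∫ x in (0 : ℝ)..L, (exp (mu * L) * exp (-(tankFreq L mu n * x)) * u x 0 -
    exp (-(mu * L)) * exp (tankFreq L mu n * x) * u x 1)

lemma tankCoefInt_congr {L : ℝ} (hL : 0 < L) (mu : ℝ) (n : ℤ) {u u' : ℝ → C2}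
    (h : u =ᵐ[tankMeasure L] u') : tankCoefInt L mu n u = tankCoefInt L mu n u' := by
  unfold tankCoefInt
  congr 1
  rw [intervalIntegral.integral_of_le hL.le, intervalIntegral.integral_of_le hL.le,
    integral_Ioc_eq_integral_Ioo, integral_Ioc_eq_integral_Ioo]
  refine integral_congr_ae ?_
  filter_upwards [(ae_tank_iff hL).1 h] with x hx
  rw [hx]

lemma exp_tankFreq_mul {L : ℝ} (hL : 0 < L) (mu : ℝ) (n : ℤ) :
    exp (tankFreq L mu n * L) = exp (mu * L) * (-1) ^ n := by
  have hL' : (L : ℂ) ≠ 0 := by exact_mod_cast hL.ne'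
  have e : tankFreq L mu n * L = mu * L + n * (Real.pi * I) := by
    unfold tankFreq; field_simp
  rw [e, exp_add, exp_int_mul, exp_pi_mul_I]

lemma neg_one_zpow_inv (n : ℤ) : ((-1 : ℂ) ^ n)⁻¹ = (-1) ^ n := by
  rcases Int.even_or_odd n with h | h
  · simp [h.neg_one_zpow]
  · simp [h.neg_one_zpow]

lemma exp_neg_tankFreq_mul {L : ℝ} (hL : 0 < L) (mu : ℝ) (n : ℤ) :
    exp (-(tankFreq L mu n * L)) = exp (-(mu * L)) * (-1) ^ n := by
  rw [exp_neg, exp_tankFreq_mul hL, mul_inv, neg_one_zpow_inv, ← exp_neg]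

lemma intervalIntegrable_coord {L : ℝ} {v : ℝ → C2} (hv : IntervalIntegrable v volume 0 L)
    (i : Fin 2) : IntervalIntegrable (fun x => v x i) volume 0 L :=
  ⟨(EuclideanSpace.proj i : C2 →L[ℂ] ℂ).integrable_comp hv.1,
    (EuclideanSpace.proj i : C2 →L[ℂ] ℂ).integrable_comp hv.2⟩

lemma IsH1Rep.coord {L : ℝ} {u v : ℝ → C2} (h : IsH1Rep L u v) (i : Fin 2) :
    ∀ x ∈ Set.Icc 0 L, u x i = u 0 i + ∫ t in (0 : ℝ)..x, v t i := by
  intro x hx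
  have e : ∫ t in (0 : ℝ)..x, v t i = (∫ t in (0 : ℝ)..x, v t) i :=
    (EuclideanSpace.proj i : C2 →L[ℂ] ℂ).intervalIntegral_comp_comm (μ := volume)
      (intervalIntegrable_of_memLp_tank h.1 hx)
  rw [e, h.2 x hx]
  rfl

/-- Integration by parts for the coefficients. -/
theorem tankCoefInt_ibp {L : ℝ} (hL : 0 < L) (mu : ℝ) (n : ℤ) {u v : ℝ → C2}
    (h : IsH1Rep L u v) :
    tankFreq L mu n * tankCoefInt L mu n u =
      1 / (2 * L) * (exp (mu * L) * u 0 0 + exp (-(mu * L)) * u 0 1 -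
        (-1) ^ n * (u L 0 + u L 1)) + tankCoefInt L mu n fun x => matLambda (v x) := by
  set s := tankFreq L mu n with hs
  have hv := intervalIntegrable_of_memLp_tank h.1 (Set.right_mem_Icc.2 hL.le)
  have hd1 : ∀ x : ℝ, HasDerivAt (fun x : ℝ => exp (-(s * x))) (-s * exp (-(s * x))) x := by
    intro x
    have h1 : HasDerivAt (fun x : ℝ => -(s * (x : ℂ))) (-(s * 1)) x :=
      (ofRealCLM.hasDerivAt.const_mul s).neg
    convert! h1.cexp using 1
    ring
  have hd2 : ∀ x : ℝ, HasDerivAt (fun x : ℝ => exp (s * x)) (s * exp (s * x)) x := by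
    intro x
    have h1 : HasDerivAt (fun x : ℝ => s * (x : ℂ)) (s * 1) x :=
      (ofRealCLM.hasDerivAt.const_mul s)
    convert! h1.cexp using 1
    ring
  have i1 := integral_mul_deriv_of_primitive hL.le (intervalIntegrable_coord hv 0) (h.coord 0)
    hd1 (by fun_prop)
  have i2 := integral_mul_deriv_of_primitive hL.le (intervalIntegrable_coord hv 1) (h.coord 1)
    hd2 (by fun_prop)
  have hu := h.continuousOn hL
  have huc : ∀ i : Fin 2, ContinuousOn (fun x => u x i) (Set.uIcc 0 L) := fun i => by
    rw [Set.uIcc_of_le hL.le]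
    exact (EuclideanSpace.proj i : C2 →L[ℂ] ℂ).continuous.comp_continuousOn hu
  have c1 : Continuous fun x : ℝ => exp (-(s * x)) := by fun_prop
  have c2 : Continuous fun x : ℝ => exp (s * x) := by fun_prop
  have j1 : s * ∫ x in (0 : ℝ)..L, exp (mu * L) * exp (-(s * x)) * u x 0 =
      -exp (mu * L) * ∫ x in (0 : ℝ)..L, u x 0 * (-s * exp (-(s * x))) := by
    rw [← intervalIntegral.integral_const_mul, ← intervalIntegral.integral_const_mul]
    exact intervalIntegral.integral_congr fun x _ => by ring
  have j2 : s * ∫ x in (0 : ℝ)..L, exp (-(mu * L)) * exp (s * x) * u x 1 =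
      exp (-(mu * L)) * ∫ x in (0 : ℝ)..L, u x 1 * (s * exp (s * x)) := by
    rw [← intervalIntegral.integral_const_mul, ← intervalIntegral.integral_const_mul]
    exact intervalIntegral.integral_congr fun x _ => by ring
  have k1 : ∫ x in (0 : ℝ)..L, exp (mu * L) * exp (-(s * x)) * v x 0 =
      exp (mu * L) * ∫ x in (0 : ℝ)..L, v x 0 * exp (-(s * x)) := by
    rw [← intervalIntegral.integral_const_mul]
    exact intervalIntegral.integral_congr fun x _ => by ring
  have k2 : ∫ x in (0 : ℝ)..L, exp (-(mu * L)) * exp (s * x) * v x 1 =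
      exp (-(mu * L)) * ∫ x in (0 : ℝ)..L, v x 1 * exp (s * x) := by
    rw [← intervalIntegral.integral_const_mul]
    exact intervalIntegral.integral_congr fun x _ => by ring
  have e1 : tankCoefInt L mu n u = 1 / (2 * L) *
      ((∫ x in (0 : ℝ)..L, exp (mu * L) * exp (-(s * x)) * u x 0) -
        ∫ x in (0 : ℝ)..L, exp (-(mu * L)) * exp (s * x) * u x 1) := by
    rw [tankCoefInt, intervalIntegral.integral_sub]
    · exact ((continuousOn_const.mul c1.continuousOn).mul (huc 0)).intervalIntegrable
    · exact ((continuousOn_const.mul c2.continuousOn).mul (huc 1)).intervalIntegrable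
  have e2 : (tankCoefInt L mu n fun x => matLambda (v x)) = 1 / (2 * L) *
      ((∫ x in (0 : ℝ)..L, exp (mu * L) * exp (-(s * x)) * v x 0) +
        ∫ x in (0 : ℝ)..L, exp (-(mu * L)) * exp (s * x) * v x 1) := by
    rw [tankCoefInt, ← intervalIntegral.integral_add]
    · simp [matLambda]
      left
      rfl
    · exact (intervalIntegrable_coord hv 0).continuousOn_mul
        (continuousOn_const.mul c1.continuousOn)
    · exact (intervalIntegrable_coord hv 1).continuousOn_mul
        (continuousOn_const.mul c2.continuousOn)
  rw [e1, e2, k1, k2]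
  rw [i1, hs, exp_neg_tankFreq_mul hL, ← hs] at j1
  rw [i2, hs, exp_tankFreq_mul hL, ← hs] at j2
  -- The weights `e^{±μL}` in the coefficients cancel the growth of `e^{∓s L}`, so that `u₁(L)` and
  -- `u₂(L)` enter with the same factor `(-1)^n`, as in the boundary condition.
  have hE : exp (mu * L) * exp (-(mu * L)) = 1 := by rw [← exp_add]; simp
  simp only [ofReal_zero, mul_zero, neg_zero, exp_zero, mul_one] at j1 j2
  linear_combination 1 / (2 * L) * j1 - 1 / (2 * L) * j2 -
    1 / (2 * L) * (-1) ^ n * (u L 0 + u L 1) * hE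

/-- The class of `E_n`. -/
def freeE (L : ℝ) (n : ℤ) : TankL2 L := tankClass L (freeEigenfunction L n)

lemma coeFn_freeE (L : ℝ) (n : ℤ) : freeE L n =ᵐ[tankMeasure L] freeEigenfunction L n :=
  coeFn_tankClass (freeEigenfunction_memLp L n)

lemma inner_freeE {L : ℝ} (hL : 0 < L) (n : ℤ) (f : TankL2 L) :
    inner ℂ (freeE L n) f = tankCoefInt L 0 n f := by
  rw [L2.inner_def, tankCoefInt, ← integral_tank hL]
  refine integral_congr_ae ?_
  filter_upwards [coeFn_freeE L n] with x hx
  rw [hx, PiLp.inner_apply, Fin.sum_univ_two]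
  simp only [RCLike.inner_apply, freeEigenfunction, tankFreq]
  simp [← exp_conj]
  ring_nf

/-- The weight absorbs the real part `μ` of the frequency, so the `μ`-coefficients of `f` are
orthonormal coefficients of the weighted function. -/
lemma inner_freeE_weight {L : ℝ} (hL : 0 < L) (mu : ℝ) (n : ℤ) (f g : TankL2 L)
    (h : g =ᵐ[tankMeasure L] fun x =>
      diagC2 (exp (mu * (L - x))) (exp (-(mu * (L - x)))) (f x)) :
    inner ℂ (freeE L n) g = tankCoefInt L mu n f := by
  rw [inner_freeE hL, tankCoefInt_congr hL 0 n h]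
  unfold tankCoefInt
  congr 1
  refine intervalIntegral.integral_congr fun x _ => ?_
  have e1 : exp (-(tankFreq L 0 n * x)) * exp (mu * (L - x)) =
      exp (mu * L) * exp (-(tankFreq L mu n * x)) := by
    rw [← exp_add, ← exp_add]
    congr 1
    simp only [tankFreq, ofReal_zero]
    ring
  have e2 : exp (tankFreq L 0 n * x) * exp (-(mu * (L - x))) =
      exp (-(mu * L)) * exp (tankFreq L mu n * x) := by
    rw [← exp_add, ← exp_add]
    congr 1
    simp only [tankFreq, ofReal_zero]
    ring
  simp only [diagC2_apply_zero, diagC2_apply_one, ofReal_zero, zero_mul, exp_zero, neg_zero,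
    one_mul, ← mul_assoc]
  rw [e1, e2]

lemma isH1Rep_of_hasDerivAt {L : ℝ} (hL : 0 < L) {u v : ℝ → C2}
    (hu : ContinuousOn u (Set.Icc 0 L)) (hv : ContinuousOn v (Set.Icc 0 L))
    (hd : ∀ x ∈ Set.Ioo 0 L, ∀ i, HasDerivAt (fun y => u y i) (v x i) x) : IsH1Rep L u v := by
  have hm := continuousOn_memLp_tank hL hv
  refine ⟨hm, fun x hx => ?_⟩
  have hs : Set.Icc 0 x ⊆ Set.Icc 0 L := Set.Icc_subset_Icc_right hx.2
  ext i
  have e : ∫ t in (0 : ℝ)..x, v t i = (∫ t in (0 : ℝ)..x, v t) i :=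
    (EuclideanSpace.proj i : C2 →L[ℂ] ℂ).intervalIntegral_comp_comm (μ := volume)
      (intervalIntegrable_of_memLp_tank hm hx)
  rw [PiLp.add_apply, ← e, intervalIntegral.integral_eq_sub_of_hasDerivAt_of_le hx.1
    (((EuclideanSpace.proj i : C2 →L[ℂ] ℂ).continuous.comp_continuousOn hu).mono hs)
    (fun y hy => hd y ⟨hy.1, hy.2.trans_le hx.2⟩ i)]
  · simp
  · refine ContinuousOn.intervalIntegrable ?_
    rw [Set.uIcc_of_le hx.1]
    exact ((EuclideanSpace.proj i : C2 →L[ℂ] ℂ).continuous.comp_continuousOn hv).mono hs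

lemma continuous_matLambda : Continuous matLambda := by
  unfold matLambda
  refine (PiLp.continuous_toLp 2 _).comp (continuous_pi fun i => ?_)
  fin_cases i <;> simp <;> fun_prop

@[simp] lemma matLambda_matLambda (v : C2) : matLambda (matLambda v) = v := by
  ext i
  fin_cases i <;> simp [matLambda]

lemma matLambda_smul (c : ℂ) (v : C2) : matLambda (c • v) = c • matLambda v := by
  ext i
  fin_cases i <;> simp [matLambda]

lemma continuous_freeEigenfunction (L : ℝ) (n : ℤ) : Continuous (freeEigenfunction L n) := by
  unfold freeEigenfunction
  refine (PiLp.continuous_toLp 2 _).comp (continuous_pi fun i => ?_)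
  fin_cases i
  · exact Continuous.cexp (by fun_prop)
  · exact (Continuous.cexp (by fun_prop)).neg

lemma freeEigenfunction_isH1Rep {L : ℝ} (hL : 0 < L) (n : ℤ) :
    IsH1Rep L (freeEigenfunction L n)
      (fun x => tankFreq L 0 n • matLambda (freeEigenfunction L n x)) := by
  have hc := continuous_freeEigenfunction L n
  refine isH1Rep_of_hasDerivAt hL hc.continuousOn
    ((continuous_matLambda.comp hc).const_smul (tankFreq L 0 n)).continuousOn fun x _ i => ?_
  have h1 : HasDerivAt (fun x : ℝ => I * Real.pi * n * (x : ℂ) / L)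
      (I * Real.pi * n * 1 / L) x :=
    (ofRealCLM.hasDerivAt.const_mul _).div_const _
  fin_cases i
  · convert! h1.cexp using 1
    simp [freeEigenfunction, matLambda, tankFreq]
    ring
  · convert! h1.neg.cexp.neg using 1
    simp [freeEigenfunction, matLambda, tankFreq]
    ring

lemma tankCoefInt_smul (L mu : ℝ) (n : ℤ) (c : ℂ) (u : ℝ → C2) :
    tankCoefInt L mu n (fun x => c • u x) = c * tankCoefInt L mu n u := by
  unfold tankCoefInt
  rw [mul_left_comm c, ← intervalIntegral.integral_const_mul c]
  simp only [PiLp.smul_apply, smul_eq_mul, mul_sub, mul_left_comm c]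

lemma freeEigenfunction_zero (L : ℝ) (n : ℤ) :
    freeEigenfunction L n 0 0 = 1 ∧ freeEigenfunction L n 0 1 = -1 := by
  simp [freeEigenfunction]

lemma freeEigenfunction_end {L : ℝ} (hL : 0 < L) (n : ℤ) :
    freeEigenfunction L n L 0 + freeEigenfunction L n L 1 = 0 := by
  have hL' : (L : ℂ) ≠ 0 := by exact_mod_cast hL.ne'
  have e : I * Real.pi * n * L / L = n * (Real.pi * I) := by field_simp
  simp only [freeEigenfunction, e]
  have h := neg_one_zpow_inv n
  simp [exp_neg, exp_int_mul, exp_pi_mul_I, h]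

/-- The coefficients of `E_n` in the weighted basis. -/
lemma tankCoefInt_freeEigenfunction {L : ℝ} (hL : 0 < L) (mu : ℝ) (p n : ℤ) :
    (tankFreq L mu p - tankFreq L 0 n) * tankCoefInt L mu p (freeEigenfunction L n) =
      1 / (2 * L) * (exp (mu * L) - exp (-(mu * L))) := by
  have h := tankCoefInt_ibp hL mu p (freeEigenfunction_isH1Rep hL n)
  rw [freeEigenfunction_end hL, (freeEigenfunction_zero L n).1, (freeEigenfunction_zero L n).2]
    at h
  simp only [matLambda_smul, matLambda_matLambda, tankCoefInt_smul] at h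
  linear_combination h

lemma tankFreq_injective {L : ℝ} (hL : 0 < L) (mu : ℝ) : Function.Injective (tankFreq L mu) := by
  intro m n h
  have hL' : (L : ℂ) ≠ 0 := by exact_mod_cast hL.ne'
  have hpi : (Real.pi : ℂ) ≠ 0 := by exact_mod_cast Real.pi_ne_zero
  unfold tankFreq at h
  have h1 := add_left_cancel h
  field_simp at h1
  exact_mod_cast h1

/-- Orthogonality comes from integration by parts: with `μ = 0` the boundary terms in
`tankCoefInt_freeEigenfunction` cancel, and distinct frequencies leave only a zero coefficient. -/
lemma orthonormal_freeE {L : ℝ} (hL : 0 < L) : Orthonormal ℂ (freeE L) := by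
  rw [orthonormal_iff_ite]
  intro m n
  rw [inner_freeE hL, tankCoefInt_congr hL 0 m (coeFn_freeE L n)]
  split_ifs with h
  · subst h
    have hL' : (L : ℂ) ≠ 0 := by exact_mod_cast hL.ne'
    have e : ∀ x : ℝ, exp ((0 : ℝ) * L) * exp (-(tankFreq L 0 m * x)) * freeEigenfunction L m x 0 -
        exp (-((0 : ℝ) * L)) * exp (tankFreq L 0 m * x) * freeEigenfunction L m x 1 = 2 := by
      intro x
      have e1 : I * Real.pi * m * x / L = tankFreq L 0 m * x := by
        simp only [tankFreq, ofReal_zero]; ring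
      simp only [freeEigenfunction, e1]
      simp only [Matrix.cons_val_zero, Matrix.cons_val_one, ofReal_zero, zero_mul, neg_zero, exp_zero,
        one_mul, mul_neg, sub_neg_eq_add, ← exp_add]
      norm_num
    simp only [tankCoefInt, e]
    rw [intervalIntegral.integral_const, sub_zero, real_smul]
    field_simp
  · have h1 := tankCoefInt_freeEigenfunction hL 0 m n
    simp only [ofReal_zero, zero_mul, neg_zero, sub_self, mul_zero] at h1
    exact (mul_eq_zero.1 h1).resolve_left (sub_ne_zero.2 fun h2 => h (tankFreq_injective hL 0 h2))

/-- Unfolding: `f₁(x)` on `(0, L)` and `-f₂(-x)` on `(-L, 0)` form one scalar function whose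
ordinary Fourier coefficients are those of `f`. Parseval makes it vanish almost everywhere. -/
lemma eq_zero_of_tankCoefInt_eq_zero {L : ℝ} (hL : 0 < L) (f : TankL2 L)
    (hf : ∀ n, tankCoefInt L 0 n f = 0) : f = 0 := by
  set φ : Fin 2 → ℝ → ℂ := fun i => (Set.Ioo 0 L).indicator fun x => f x i with hφ
  have hφm : ∀ i, MemLp (φ i) 2 volume := fun i => by
    rw [hφ]
    refine (memLp_indicator_iff_restrict measurableSet_Ioo).2 ?_
    exact (EuclideanSpace.proj i : C2 →L[ℂ] ℂ).comp_memLp' ((memLp_tank_iff hL).1 (Lp.memLp f))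
  set w : ℝ → ℂ := fun x => φ 0 x - φ 1 (-x) with hw
  have hneg := Measure.measurePreserving_neg (volume : Measure ℝ)
  have hφn : MemLp (fun x => φ 1 (-x)) 2 volume := (hφm 1).comp_measurePreserving hneg
  have hwm : MemLp w 2 volume := (hφm 0).sub hφn
  have hLL : -L < L := by linarith
  have hval : ∀ i, ∀ x ∉ Set.Ioo 0 L, φ i x = 0 := fun i x hx => Set.indicator_of_notMem hx _
  have hin : ∀ i, ∀ x ∈ Set.Ioo 0 L, φ i x = f x i := fun i x hx => Set.indicator_of_mem hx _
  have hcoef : ∀ n, fourierCoeffOn hLL w n = tankCoefInt L 0 n f := by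
    intro n
    set e : ℝ → ℂ := fun x => exp (-(tankFreq L 0 n * x)) with he
    have hec : Continuous e := by fun_prop
    have hfou : ∀ x : ℝ, fourier (-n) (x : AddCircle (L - -L)) = e x := by
      intro x
      have hL' : (L : ℂ) ≠ 0 := by exact_mod_cast hL.ne'
      rw [fourier_coe_apply, he]
      congr 1
      simp only [tankFreq, ofReal_zero]
      push_cast
      field_simp
      ring
    rw [fourierCoeffOn_eq_integral]
    simp only [hfou, smul_eq_mul, hw, mul_sub]
    have hwhole : ∀ (g : ℝ → ℂ) (i : Fin 2), Continuous g →
        IntervalIntegrable (fun x => g x * φ i x) volume (-L) L ∧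
        ∫ x in (-L)..L, g x * φ i x = ∫ x in (0 : ℝ)..L, g x * f x i := by
      intro g i hg
      refine ⟨?_, ?_⟩
      · refine IntervalIntegrable.continuousOn_mul ?_ hg.continuousOn
        rw [intervalIntegrable_iff_integrableOn_Ioc_of_le hLL.le]
        exact ((hφm i).mono_measure Measure.restrict_le_self).integrable (by norm_num)
      · rw [intervalIntegral.integral_of_le hLL.le, intervalIntegral.integral_of_le hL.le,
          integral_Ioc_eq_integral_Ioo (x := 0),
          setIntegral_eq_integral_of_forall_compl_eq_zero (fun x hx => ?_),
          ← setIntegral_eq_integral_of_forall_compl_eq_zero (s := Set.Ioo 0 L) (fun x hx => ?_)]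
        · refine setIntegral_congr_fun measurableSet_Ioo fun x hx => ?_
          simp only [hin i x hx]
        · rw [hval i x hx, mul_zero]
        · rw [hval i x fun h => hx ⟨by linarith [h.1], h.2.le⟩, mul_zero]
    have hen : Continuous fun x => e (-x) := hec.comp continuous_neg
    obtain ⟨a1, a2⟩ := hwhole e 0 hec
    obtain ⟨b1, b2⟩ := hwhole (fun x => e (-x)) 1 hen
    have b3 : ∫ x in (-L)..L, e x * φ 1 (-x) = ∫ x in (-L)..L, e (-x) * φ 1 x := by
      have := intervalIntegral.integral_comp_neg (a := -L) (b := L) fun x => e (-x) * φ 1 x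
      simpa using this
    have b4 : IntervalIntegrable (fun x => e x * φ 1 (-x)) volume (-L) L := by
      refine IntervalIntegrable.continuousOn_mul ?_ hec.continuousOn
      rw [intervalIntegrable_iff_integrableOn_Ioc_of_le hLL.le]
      exact (hφn.mono_measure Measure.restrict_le_self).integrable (by norm_num)
    have c1 : IntervalIntegrable (fun x => e x * f x 0) volume 0 L :=
      (intervalIntegrable_coord (intervalIntegrable_of_memLp_tank (Lp.memLp f)
        (Set.right_mem_Icc.2 hL.le)) 0).continuousOn_mul hec.continuousOn
    have c2 : IntervalIntegrable (fun x => e (-x) * f x 1) volume 0 L :=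
      (intervalIntegrable_coord (intervalIntegrable_of_memLp_tank (Lp.memLp f)
        (Set.right_mem_Icc.2 hL.le)) 1).continuousOn_mul hen.continuousOn
    rw [intervalIntegral.integral_sub a1 b4, b3, a2, b2, ← intervalIntegral.integral_sub c1 c2,
      tankCoefInt, real_smul]
    congr 1
    · push_cast; ring
    · refine intervalIntegral.integral_congr fun x _ => ?_
      simp [he]
  have hpars := hasSum_sq_fourierCoeffOn hLL (hwm.mono_measure Measure.restrict_le_self)
  simp only [hcoef, hf, norm_zero, ne_eq, OfNat.ofNat_ne_zero, not_false_eq_true, zero_pow] at hpars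
  have hint : ∫ x in (-L)..L, ‖w x‖ ^ 2 = 0 := by
    have h1 := hpars.unique hasSum_zero
    rw [smul_eq_mul, mul_eq_zero] at h1
    exact h1.resolve_left (by rw [inv_eq_zero]; linarith)
  have hw0 : ∀ᵐ x, x ∈ Set.Ioc (-L) L → w x = 0 := by
    rw [intervalIntegral.integral_of_le hLL.le, integral_eq_zero_iff_of_nonneg_ae
      (Filter.Eventually.of_forall fun x => sq_nonneg _)] at hint
    · rw [← ae_restrict_iff' measurableSet_Ioc]
      filter_upwards [hint] with x hx
      simpa using hx
    · exact (hwm.mono_measure Measure.restrict_le_self).integrable_norm_pow (by norm_num)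
  have hw0' := hneg.quasiMeasurePreserving.ae hw0
  apply Lp.ext
  filter_upwards [(ae_tank_iff hL).2 (ae_restrict_of_ae hw0),
    (ae_tank_iff hL).2 (ae_restrict_of_ae hw0'), ae_tank_mem hL,
    Lp.coeFn_zero C2 2 (tankMeasure L)] with x h1 h2 hx h3
  have h4 := h1 ⟨by linarith [hx.1], hx.2.le⟩
  have h5 := h2 ⟨by linarith [hx.2], by linarith [hx.1, hx.2]⟩
  have h6 : -x ∉ Set.Ioo 0 L := fun h => by linarith [h.1, hx.1]
  rw [hw] at h4 h5
  simp only [neg_neg] at h4 h5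
  rw [hval 1 _ h6, hin 0 x hx, sub_zero] at h4
  rw [hval 0 _ h6, hin 1 x hx, zero_sub, neg_eq_zero] at h5
  rw [h3]
  ext i
  fin_cases i
  · exact h4
  · exact h5

/-- The functions `E_n` form an orthonormal basis of `(L²)²`. -/
def freeBasis {L : ℝ} (hL : 0 < L) : HilbertBasis ℤ ℂ (TankL2 L) :=
  HilbertBasis.mkOfOrthogonalEqBot (orthonormal_freeE hL) (by
    rw [Submodule.eq_bot_iff]
    intro f hf
    refine eq_zero_of_tankCoefInt_eq_zero hL f fun n => ?_
    rw [← inner_freeE hL]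
    exact (Submodule.mem_orthogonal _ _).1 hf _ (Submodule.subset_span (Set.mem_range_self n)))

lemma freeBasis_repr {L : ℝ} (hL : 0 < L) (f : TankL2 L) (n : ℤ) :
    (freeBasis hL).repr f n = inner ℂ (freeE L n) f := by
  rw [HilbertBasis.repr_apply_apply, freeBasis, HilbertBasis.coe_mkOfOrthogonalEqBot]

/-- The coefficients with respect to the weighted basis define an isomorphism onto `ℓ²`. -/
theorem exists_tankCoef {L : ℝ} (hL : 0 < L) (mu : ℝ) :
    ∃ C : TankL2 L ≃L[ℂ] L2Z, ∀ f n, C f n = tankCoefInt L mu n f := by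
  obtain ⟨T, hT⟩ := exists_weightEquiv hL mu
  refine ⟨T.trans (freeBasis hL).repr.toContinuousLinearEquiv, fun f n => ?_⟩
  rw [← inner_freeE_weight hL mu n f (T f) (hT f), ← freeBasis_repr hL]
  rfl

/-! ### The coupling term -/

lemma tankLen_mul {L γ : ℝ} (hγ : 0 < γ) :
    γ * tankLen L γ = 2 * (Real.sqrt (1 + γ * L / 2) - Real.sqrt (1 - γ * L / 2)) := by
  unfold tankLen
  field_simp

lemma tank_sqrt_bounds {L γ : ℝ} (hL : 0 < L) (hγ : 0 < γ) (h : γ * L ≤ 1) :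
    1 / 2 ≤ Real.sqrt (1 - γ * L / 2) ∧
      0 ≤ Real.sqrt (1 + γ * L / 2) - Real.sqrt (1 - γ * L / 2) ∧
      Real.sqrt (1 + γ * L / 2) - Real.sqrt (1 - γ * L / 2) ≤ γ * L := by
  have hp := mul_pos hγ hL
  have h1 : 1 / 2 ≤ Real.sqrt (1 - γ * L / 2) := Real.le_sqrt_of_sq_le (by linarith)
  have h2 : 1 ≤ Real.sqrt (1 + γ * L / 2) := Real.le_sqrt_of_sq_le (by linarith)
  have h3 : Real.sqrt (1 - γ * L / 2) ≤ Real.sqrt (1 + γ * L / 2) :=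
    Real.sqrt_le_sqrt (by linarith)
  refine ⟨h1, by linarith, ?_⟩
  have e1 := Real.sq_sqrt (show 0 ≤ 1 + γ * L / 2 by linarith)
  have e2 := Real.sq_sqrt (show 0 ≤ 1 - γ * L / 2 by linarith)
  nlinarith

lemma tankDelta_den {L γ : ℝ} (hL : 0 < L) (hγ : 0 < γ) (h : γ * L ≤ 1) {x : ℝ}
    (hx : x ∈ Set.Icc 0 L) :
    1 / 2 ≤ Real.sqrt (1 + γ * L / 2) - γ * tankLen L γ * x / (2 * L) := by
  obtain ⟨h1, h2, h3⟩ := tank_sqrt_bounds hL hγ h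
  have hx1 : x / L ≤ 1 := (div_le_one hL).2 hx.2
  have e : γ * tankLen L γ * x / (2 * L) =
      (Real.sqrt (1 + γ * L / 2) - Real.sqrt (1 - γ * L / 2)) * (x / L) := by
    rw [tankLen_mul hγ]
    field_simp
  rw [e]
  nlinarith

/-- The constant is `3/2 · 2γ`: the prefactor is controlled by `L_γ ≤ 2L`, and the denominator is at
least `1/2`. This is what makes the coupling a small perturbation. -/
lemma abs_tankDelta_le {L γ : ℝ} (hL : 0 < L) (hγ : 0 < γ) (h : γ * L ≤ 1) {x : ℝ}
    (hx : x ∈ Set.Icc 0 L) : |tankDelta L γ x| ≤ 3 * γ := by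
  obtain ⟨h1, h2, h3⟩ := tank_sqrt_bounds hL hγ h
  have hden := tankDelta_den hL hγ h hx
  have hlen0 : 0 ≤ tankLen L γ := by
    have := tankLen_mul (L := L) hγ
    by_contra hneg
    nlinarith
  have hlen : tankLen L γ ≤ 2 * L := by
    have := tankLen_mul (L := L) hγ
    by_contra hneg
    nlinarith
  have ha : 3 * tankLen L γ / (4 * L) ≤ 3 / 2 := by
    rw [div_le_iff₀ (by positivity)]
    linarith
  have hb : γ / (Real.sqrt (1 + γ * L / 2) - γ * tankLen L γ * x / (2 * L)) ≤ 2 * γ := by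
    rw [div_le_iff₀ (by linarith)]
    nlinarith
  have ha0 : 0 ≤ 3 * tankLen L γ / (4 * L) := by positivity
  have hb0 : 0 ≤ γ / (Real.sqrt (1 + γ * L / 2) - γ * tankLen L γ * x / (2 * L)) :=
    div_nonneg hγ.le (by linarith)
  rw [tankDelta, abs_mul, abs_neg, abs_of_nonneg ha0, abs_of_nonneg hb0]
  nlinarith

lemma measurable_tankDelta (L γ : ℝ) : Measurable (tankDelta L γ) := by
  unfold tankDelta
  fun_prop

/-- The bounded coupling operator `f ↦ δ J f`. -/
theorem exists_coupling {L γ : ℝ} (hL : 0 < L) (hγ : 0 < γ) (h : γ * L ≤ 1) :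
    ∃ B : TankL2 L →L[ℂ] TankL2 L, ‖B‖ ≤ 3 * γ * ‖matJL‖ ∧
      ∀ f : TankL2 L, B f =ᵐ[tankMeasure L] fun x => (tankDelta L γ x : ℂ) • matJ (f x) := by
  obtain ⟨B, hB, hB'⟩ := exists_mulOp (L := L) (fun x => (tankDelta L γ x : ℂ) • matJL)
    ((measurable_ofReal.comp (measurable_tankDelta L γ)).aestronglyMeasurable.smul_const _)
    (K := 3 * γ * ‖matJL‖) (by positivity) (by
      filter_upwards [ae_tank_mem hL] with x hx
      rw [norm_smul, norm_real]
      exact mul_le_mul_of_nonneg_right (abs_tankDelta_le hL hγ h (Set.Ioo_subset_Icc_self hx))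
        (norm_nonneg _))
  refine ⟨B, hB, fun f => ?_⟩
  filter_upwards [hB' f] with x hx
  rw [hx, smul_apply, matJL_apply]

/-- `J` is real antisymmetric and `δ` is real. -/
lemma coupling_skew {L γ : ℝ} {B : TankL2 L →L[ℂ] TankL2 L}
    (hB : ∀ f : TankL2 L, B f =ᵐ[tankMeasure L] fun x => (tankDelta L γ x : ℂ) • matJ (f x))
    (f g : TankL2 L) : inner ℂ (B f) g = -inner ℂ f (B g) := by
  rw [L2.inner_def, L2.inner_def, ← integral_neg]
  refine integral_congr_ae ?_
  filter_upwards [hB f, hB g] with x h1 h2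
  rw [h1, h2, PiLp.inner_apply, PiLp.inner_apply, Fin.sum_univ_two, Fin.sum_univ_two]
  simp only [RCLike.inner_apply]
  have h3 : (starRingEnd ℂ) 3 = 3 := map_ofNat _ 3
  simp [matJ, h3]
  ring

/-! ### The graph of the operators -/

lemma tankDelta_zero (L x : ℝ) : tankDelta L 0 x = 0 := by simp [tankDelta]

/-- A bounded term does not change the domain. The uncoupled operator is encoded as `γ = 0`, where
`tankDelta` vanishes identically. -/
lemma inTankGraph_iff_uncoupled {L γ κ : ℝ} {B : TankL2 L →L[ℂ] TankL2 L}
    (hB : ∀ f : TankL2 L, B f =ᵐ[tankMeasure L] fun x => (tankDelta L γ x : ℂ) • matJ (f x))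
    (f h : TankL2 L) : InTankGraph L γ κ f h ↔ InTankGraph L 0 κ f (h - B f) := by
  constructor
  · rintro ⟨u, v, h1, h2, h3, h4, h5⟩
    refine ⟨u, v, h1, h2, ?_, h4, h5⟩
    filter_upwards [Lp.coeFn_sub h (B f), h2, h3, hB f] with x a b c d
    rw [a, Pi.sub_apply, c, d, b, tankDelta_zero]
    simp
  · rintro ⟨u, v, h1, h2, h3, h4, h5⟩
    refine ⟨u, v, h1, h2, ?_, h4, h5⟩
    filter_upwards [Lp.coeFn_sub h (B f), h2, h3, hB f] with x a b c d
    rw [a, Pi.sub_apply, d, b, tankDelta_zero, sub_eq_iff_eq_add] at c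
    simpa using c

lemma coeFn_matLambda_of_uncoupled {L : ℝ} {h : TankL2 L} {u v : ℝ → C2}
    (hh : h =ᵐ[tankMeasure L] fun x => matLambda (v x) + (tankDelta L 0 x : ℂ) • matJ (u x)) :
    h =ᵐ[tankMeasure L] fun x => matLambda (v x) := by
  filter_upwards [hh] with x hx
  rw [hx, tankDelta_zero]
  simp

lemma exp_neg_two_mul (L mu : ℝ) :
    (exp (mu * L) : ℂ) * ((Real.exp (-2 * mu * L) : ℝ) : ℂ) = exp (-(mu * L)) := by
  rw [ofReal_exp, ← exp_add]
  congr 1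
  push_cast
  ring

/-- The weights of the coefficients are tuned to `κ = e^{-2μL}`: both boundary terms of the
integration by parts vanish. -/
lemma InTankGraph.coef {L mu : ℝ} (hL : 0 < L) {f h : TankL2 L}
    (H : InTankGraph L 0 (Real.exp (-2 * mu * L)) f h) (n : ℤ) :
    tankCoefInt L mu n h = tankFreq L mu n * tankCoefInt L mu n f := by
  obtain ⟨u, v, h1, h2, h3, h4, h5⟩ := H
  rw [tankCoefInt_congr hL mu n h2, tankCoefInt_congr hL mu n (coeFn_matLambda_of_uncoupled h3),
    tankCoefInt_ibp hL mu n h1, h5]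
  have e : exp (mu * L) * u 0 0 + exp (-(mu * L)) * u 0 1 = 0 := by
    rw [← exp_neg_two_mul]
    linear_combination exp (mu * L) * h4
  rw [e]
  ring

/-- Every `h` has a primitive with prescribed value at `0`. -/
lemma exists_primitive {L : ℝ} (hL : 0 < L) {κ : ℝ} (h : TankL2 L) (c : C2)
    (hc : c 0 + κ * c 1 = 0)
    (hc' : c 0 + c 1 + ((∫ t in (0 : ℝ)..L, h t 0) - ∫ t in (0 : ℝ)..L, h t 1) = 0) :
    ∃ f : TankL2 L, InTankGraph L 0 κ f h := by
  set v : ℝ → C2 := fun x => matLambda (h x) with hv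
  have hvm : MemLp v 2 (tankMeasure L) := by
    refine (Lp.memLp h).of_le_mul (c := 1) ?_ (Filter.Eventually.of_forall fun x => ?_)
    · exact continuous_matLambda.comp_aestronglyMeasurable (Lp.aestronglyMeasurable h)
    · rw [one_mul, hv, EuclideanSpace.norm_eq, EuclideanSpace.norm_eq]
      simp [matLambda]
  set u : ℝ → C2 := fun x => c + ∫ t in (0 : ℝ)..x, v t with hu
  have hrep : IsH1Rep L u v := ⟨hvm, fun x _ => by simp [hu]⟩
  have hum := continuousOn_memLp_tank hL (hrep.continuousOn hL)
  refine ⟨tankClass L u, u, v, hrep, coeFn_tankClass hum, ?_, ?_, ?_⟩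
  · refine Filter.Eventually.of_forall fun x => ?_
    simp [tankDelta_zero, hv]
  · simpa [hu] using hc
  · have e0 := hrep.coord 0 L (Set.right_mem_Icc.2 hL.le)
    have e1 := hrep.coord 1 L (Set.right_mem_Icc.2 hL.le)
    have u0 : u 0 = c := by simp [hu]
    have v0 : ∫ t in (0 : ℝ)..L, v t 0 = ∫ t in (0 : ℝ)..L, h t 0 := by simp [hv, matLambda]
    have v1 : ∫ t in (0 : ℝ)..L, v t 1 = -∫ t in (0 : ℝ)..L, h t 1 := by simp [hv, matLambda]
    rw [e0, e1, u0, v0, v1]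
    linear_combination hc'

lemma freeE_mem_graph {L : ℝ} (hL : 0 < L) (n : ℤ) :
    InTankGraph L 0 1 (freeE L n) (tankFreq L 0 n • freeE L n) := by
  refine ⟨_, _, freeEigenfunction_isH1Rep hL n, coeFn_freeE L n, ?_, ?_, freeEigenfunction_end hL n⟩
  · filter_upwards [Lp.coeFn_smul (tankFreq L 0 n) (freeE L n), coeFn_freeE L n] with x h1 h2
    rw [h1, Pi.smul_apply, h2, matLambda_smul, matLambda_matLambda, tankDelta_zero]
    simp
  · rw [(freeEigenfunction_zero L n).1, (freeEigenfunction_zero L n).2]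
    simp

lemma tankFreq_zero_zero (L : ℝ) : tankFreq L 0 0 = 0 := by simp [tankFreq]

lemma tankFreq_re (L mu : ℝ) (n : ℤ) : (tankFreq L mu n).re = mu := by
  have e : tankFreq L mu n = (mu : ℂ) + ((Real.pi * n / L : ℝ) : ℂ) * I := by
    unfold tankFreq; push_cast; ring
  rw [e]
  simp

/-- The uncoupled operators are diagonal in the coefficients. -/
theorem inTankGraph_zero_iff {L mu : ℝ} (hL : 0 < L) (f h : TankL2 L) :
    InTankGraph L 0 (Real.exp (-2 * mu * L)) f h ↔
      ∀ n, tankCoefInt L mu n h = tankFreq L mu n * tankCoefInt L mu n f := by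
  refine ⟨fun H n => H.coef hL n, fun H => ?_⟩
  obtain ⟨C, hC⟩ := exists_tankCoef hL mu
  have hinj : ∀ g g' : TankL2 L, (∀ n, tankCoefInt L mu n g = tankCoefInt L mu n g') → g = g' := by
    intro g g' hg
    refine C.injective ?_
    ext n
    rw [hC, hC, hg]
  set A : ℂ := (∫ t in (0 : ℝ)..L, h t 0) - ∫ t in (0 : ℝ)..L, h t 1 with hA
  -- For the primitive `c + ∫ Λ h` the boundary conditions form a linear system in `c` with
  -- determinant `1 - κ`. When `μ = 0` it is singular, but the hypothesis at `n = 0` gives `A = 0`,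
  -- so `c = 0` works; `f` is then recovered up to a multiple of the kernel element `E_0`.
  by_cases hmu : mu = 0
  · subst hmu
    have hA0 : A = 0 := by
      have h0 := H 0
      rw [tankFreq_zero_zero, zero_mul, tankCoefInt] at h0
      have hL' : (1 / (2 * L) : ℂ) ≠ 0 := by simpa using hL.ne'
      have h1 := (mul_eq_zero.1 h0).resolve_left hL'
      have hi := fun i => intervalIntegrable_coord (intervalIntegrable_of_memLp_tank (Lp.memLp h)
        (Set.right_mem_Icc.2 hL.le)) i
      simp only [tankFreq_zero_zero, ofReal_zero, zero_mul, neg_zero, exp_zero, one_mul] at h1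
      rwa [intervalIntegral.integral_sub (hi 0) (hi 1)] at h1
    obtain ⟨f', hf'⟩ := exists_primitive hL (κ := 1) h 0 (by simp) (by simp [← hA, hA0])
    rw [show Real.exp (-2 * 0 * L) = 1 by simp] at *
    have hcf : ∀ n, n ≠ 0 → tankCoefInt L 0 n f = tankCoefInt L 0 n f' := fun n hn => by
      have h1 := InTankGraph.coef (mu := 0) hL (by simpa using hf') n
      rw [H n] at h1
      refine mul_left_cancel₀ ?_ h1
      rw [← tankFreq_zero_zero L]
      exact fun h2 => hn (tankFreq_injective hL 0 h2)
    set a := tankCoefInt L 0 0 f - tankCoefInt L 0 0 f' with ha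
    have hfa : f = f' + a • freeE L 0 := by
      refine hinj _ _ fun n => ?_
      have e1 : C (f' + a • freeE L 0) n = C f' n + a * C (freeE L 0) n := by
        rw [map_add, map_smul]; rfl
      rw [hC, hC, hC] at e1
      rw [e1, ← inner_freeE hL n (freeE L 0), orthonormal_iff_ite.1 (orthonormal_freeE hL)]
      split_ifs with hn
      · rw [hn, ha]; ring
      · rw [hcf n hn]; ring
    rw [hfa]
    have h2 := hf'.add ((freeE_mem_graph hL 0).smul a)
    rwa [tankFreq_zero_zero, zero_smul, smul_zero, add_zero] at h2
  · set κ := Real.exp (-2 * mu * L) with hκ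
    have hκ1 : (1 - κ : ℂ) ≠ 0 := by
      rw [sub_ne_zero, ne_comm]
      have : κ ≠ 1 := by
        rw [hκ, Ne, Real.exp_eq_one_iff]
        simp [hmu, hL.ne']
      exact_mod_cast this
    -- The vector solves `c₁ + κ c₂ = 0` and `c₁ + c₂ = -A`.
    obtain ⟨f', hf'⟩ := exists_primitive hL (κ := κ) h !₂[κ * A / (1 - κ), -A / (1 - κ)]
      (by simp; field_simp; ring) (by simp [← hA]; field_simp; ring)
    have : f = f' := hinj _ _ fun n => by
      have h1 := hf'.coef hL n
      rw [H n] at h1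
      refine mul_left_cancel₀ (fun h2 => hmu ?_) h1
      rw [← tankFreq_re L mu n, h2, zero_re]
    rwa [this]

/-- The coefficient isomorphism. -/
def tankCoef {L : ℝ} (hL : 0 < L) (mu : ℝ) : TankL2 L ≃L[ℂ] L2Z :=
  (exists_tankCoef hL mu).choose

lemma tankCoef_apply {L : ℝ} (hL : 0 < L) (mu : ℝ) (f : TankL2 L) (n : ℤ) :
    tankCoef hL mu f n = tankCoefInt L mu n f :=
  (exists_tankCoef hL mu).choose_spec f n

/-- Diagonalization of the coupled operators in coordinates close to the coefficients. -/
theorem exists_tank_diagonalization {L : ℝ} (hL : 0 < L) (mu : ℝ) :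
    ∃ K ε : ℝ, 0 < K ∧ 0 < ε ∧ ∀ γ : ℝ, 0 < γ → γ ≤ ε →
      ∃ (V : TankL2 L ≃L[ℂ] L2Z) (σ : ℤ → ℂ),
        (∀ f h, InTankGraph L γ (Real.exp (-2 * mu * L)) f h ↔ ∀ n, V h n = σ n * V f n) ∧
        (∀ n, ‖σ n - tankFreq L mu n‖ ≤ K * γ) ∧
        (∀ x, ‖tankCoef hL mu (V.symm x) - x‖ ≤ K * γ * ‖x‖) ∧
        (∀ n, tankCoef hL mu (V.symm (l2e n)) n = 1) ∧
        ∀ (f : TankL2 L) (R : ℝ), ‖tankCoef hL mu f‖ ≤ R →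
          (∀ n, ‖tankFreq L mu n * tankCoef hL mu f n‖ ≤ R) →
          ∀ n, ‖tankFreq L mu n * V f n - tankFreq L mu n * tankCoef hL mu f n‖ ≤ K * γ * R := by
  set C := tankCoef hL mu with hC
  have hL' : (L : ℂ) ≠ 0 := by exact_mod_cast hL.ne'
  have hpi : (Real.pi : ℂ) ≠ 0 := by exact_mod_cast Real.pi_ne_zero
  -- All frequencies have real part `μ`, so `t = μ + 1` is at distance at least `1` from them.
  obtain ⟨K, ε, hK, hε, hdiag⟩ := exists_diagonalization (d := tankFreq L mu)
    (c := I * Real.pi / L) (div_ne_zero (mul_ne_zero I_ne_zero hpi) hL')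
    (fun j k => by unfold tankFreq; ring) (t := mu + 1) (fun j => by
      refine le_trans ?_ (Complex.abs_re_le_norm _)
      simp [tankFreq_re])
  set K1 : ℝ := ‖(C : TankL2 L →L[ℂ] L2Z)‖ * (3 * ‖matJL‖) *
    ‖(C.symm : L2Z →L[ℂ] TankL2 L)‖ with hK1
  have hK10 : 0 ≤ K1 := by positivity
  refine ⟨K * (K1 + 1), min (1 / L) (ε / (K1 + 1)), by positivity, by positivity,
    fun γ hγ hγε => ?_⟩
  have hγL : γ * L ≤ 1 := (le_div_iff₀ hL).1 (hγε.trans (min_le_left _ _))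
  have hγ1 : K1 * γ ≤ ε := by
    have := (le_div_iff₀ (by positivity)).1 (hγε.trans (min_le_right _ _))
    nlinarith
  obtain ⟨B, hBn, hB⟩ := exists_coupling hL hγ hγL
  set B' : L2Z →L[ℂ] L2Z := (C : TankL2 L →L[ℂ] L2Z) ∘L B ∘L (C.symm : L2Z →L[ℂ] TankL2 L)
    with hB'
  have hB'n : ‖B'‖ ≤ K1 * γ := by
    refine (ContinuousLinearMap.opNorm_comp_le _ _).trans ?_
    refine (mul_le_mul_of_nonneg_left (ContinuousLinearMap.opNorm_comp_le _ _)
      (norm_nonneg _)).trans ?_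
    refine (mul_le_mul_of_nonneg_left (mul_le_mul_of_nonneg_right hBn (norm_nonneg _))
      (norm_nonneg _)).trans_eq ?_
    rw [hK1]; ring
  have hKB : K * ‖B'‖ ≤ K * (K1 + 1) * γ := by
    rw [mul_assoc]
    refine mul_le_mul_of_nonneg_left (hB'n.trans ?_) hK.le
    nlinarith
  obtain ⟨W, σ, hW1, hW2, hσ, hgraph, hdecay⟩ := hdiag B' (hB'n.trans hγ1)
  refine ⟨C.trans W.symm, σ, fun f h => ?_, fun n => (hσ n).trans hKB, fun x => ?_, fun n => ?_,
    fun f R h1 h2 n => ?_⟩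
  · rw [inTankGraph_iff_uncoupled hB, inTankGraph_zero_iff hL]
    refine Iff.trans ?_ (hgraph (C f) (C h))
    refine forall_congr' fun n => ?_
    have e : B' (C f) = C (B f) := by simp [hB']
    rw [e, ← map_sub, hC, tankCoef_apply, tankCoef_apply]
  · have e : C ((C.trans W.symm).symm x) = W x := C.apply_symm_apply _
    rw [e]
    exact (hW1 x).trans (mul_le_mul_of_nonneg_right hKB (norm_nonneg _))
  · have e : C ((C.trans W.symm).symm (l2e n)) = W (l2e n) := C.apply_symm_apply _
    rw [e, hW2]
  · have hR : 0 ≤ R := (norm_nonneg _).trans h1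
    exact (hdecay (C f) R h1 h2 n).trans (mul_le_mul_of_nonneg_right hKB hR)

/-! ### Diagonalized operators, their domains and their eigenvectors -/

/-- The point of the domain given by an element of the graph. -/
def tankDomain.mk {L γ κ : ℝ} (f h : TankL2 L) (H : InTankGraph L γ κ f h) : tankDomain L γ κ :=
  ⟨WithLp.toLp 2 (f, h), H⟩

lemma tankDomain_mem_graph {L γ κ : ℝ} (α : tankDomain L γ κ) :
    InTankGraph L γ κ (tankFun α) (tankOp α) := α.2

lemma tankFun_smul {L γ κ : ℝ} (c : ℂ) (α : tankDomain L γ κ) :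
    tankFun (c • α) = c • tankFun α := rfl

/-- `tankFun` as a continuous linear map. -/
def tankFunL (L γ κ : ℝ) : tankDomain L γ κ →L[ℂ] TankL2 L :=
  (ContinuousLinearMap.fst ℂ (TankL2 L) (TankL2 L)) ∘L
    (WithLp.prodContinuousLinearEquiv 2 ℂ (TankL2 L) (TankL2 L) :
      WithLp 2 (TankL2 L × TankL2 L) →L[ℂ] TankL2 L × TankL2 L) ∘L (tankDomain L γ κ).subtypeL

/-- `tankOp` as a continuous linear map. -/
def tankOpL (L γ κ : ℝ) : tankDomain L γ κ →L[ℂ] TankL2 L :=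
  (ContinuousLinearMap.snd ℂ (TankL2 L) (TankL2 L)) ∘L
    (WithLp.prodContinuousLinearEquiv 2 ℂ (TankL2 L) (TankL2 L) :
      WithLp 2 (TankL2 L × TankL2 L) →L[ℂ] TankL2 L × TankL2 L) ∘L (tankDomain L γ κ).subtypeL

lemma tankFunL_apply {L γ κ : ℝ} (α : tankDomain L γ κ) : tankFunL L γ κ α = tankFun α := rfl

/-- The isomorphism `V` diagonalizes the operator `Λ ∂ₓ + δ J`, with eigenvalues `σ`. -/
def Diagonalizes {L : ℝ} (γ κ : ℝ) (V : TankL2 L ≃L[ℂ] L2Z) (σ : ℤ → ℂ) : Prop :=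
  ∀ f h, InTankGraph L γ κ f h ↔ ∀ n, V h n = σ n * V f n

/-- The domain of a diagonalized operator is isomorphic to `ℓ²`. -/
theorem Diagonalizes.exists_domain_equiv {L γ κ : ℝ} {V : TankL2 L ≃L[ℂ] L2Z} {σ : ℤ → ℂ}
    (hV : Diagonalizes γ κ V σ) (t : ℂ) {c : ℝ} (hc : 0 < c) (hσ : ∀ n, c ≤ ‖σ n + t‖) :
    ∃ Θ : tankDomain L γ κ ≃L[ℂ] L2Z, ∀ α, Θ α = V (tankOp α + t • tankFun α) := by
  have h0 : ∀ n, σ n + t ≠ 0 := fun n => norm_pos_iff.1 (hc.trans_le (hσ n))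
  -- The inverse sends `y` to the graph point with coordinates `(σ + t)⁻¹ y` and `y - t (σ + t)⁻¹
  -- y`; written in this way, only bounded operators occur.
  obtain ⟨D, -, hD⟩ := exists_diag_op (fun n => (σ n + t)⁻¹) (R := c⁻¹) (by positivity)
    fun n => by rw [norm_inv]; exact inv_anti₀ hc (hσ n)
  set Vi : L2Z →L[ℂ] TankL2 L := (V.symm : L2Z →L[ℂ] TankL2 L) with hVi
  set inv0 : L2Z →L[ℂ] WithLp 2 (TankL2 L × TankL2 L) :=
    ((WithLp.prodContinuousLinearEquiv 2 ℂ (TankL2 L) (TankL2 L)).symm :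
      TankL2 L × TankL2 L →L[ℂ] WithLp 2 (TankL2 L × TankL2 L)) ∘L
      ((Vi ∘L D).prod (Vi ∘L (ContinuousLinearMap.id ℂ L2Z - t • D))) with hinv0
  have hmem : ∀ y, inv0 y ∈ tankDomain L γ κ := fun y => by
    change InTankGraph L γ κ (V.symm (D y)) (V.symm (y - t • D y))
    refine (hV _ _).2 fun n => ?_
    rw [ContinuousLinearEquiv.apply_symm_apply, ContinuousLinearEquiv.apply_symm_apply]
    have e : (y - t • D y) n = y n - t * D y n := rfl
    rw [e, hD]
    have := h0 n
    field_simp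
    ring
  have hfun : ∀ y, tankFun (⟨inv0 y, hmem y⟩ : tankDomain L γ κ) = V.symm (D y) := fun y => rfl
  have hop : ∀ y, tankOp (⟨inv0 y, hmem y⟩ : tankDomain L γ κ) = V.symm (y - t • D y) :=
    fun y => rfl
  refine ⟨ContinuousLinearEquiv.equivOfInverse
    ((V : TankL2 L →L[ℂ] L2Z) ∘L (tankOpL L γ κ + t • tankFunL L γ κ))
    (inv0.codRestrict _ hmem) (fun α => ?_) (fun y => ?_), fun α => rfl⟩
  · refine tankFun_injective ?_
    have e1 : tankFun ((inv0.codRestrict _ hmem) (V (tankOp α + t • tankFun α))) =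
      V.symm (D (V (tankOp α + t • tankFun α))) := rfl
    refine e1.trans (V.injective ?_)
    rw [ContinuousLinearEquiv.apply_symm_apply]
    ext n
    have e2 : V (tankOp α + t • tankFun α) n = V (tankOp α) n + t * V (tankFun α) n := by
      rw [map_add, map_smul]; rfl
    rw [hD, e2, (hV _ _).1 (tankDomain_mem_graph α) n]
    have := h0 n
    field_simp
  · change V (V.symm (y - t • D y) + t • V.symm (D y)) = y
    rw [map_add, map_smul, ContinuousLinearEquiv.apply_symm_apply,
      ContinuousLinearEquiv.apply_symm_apply, sub_add_cancel]

lemma Diagonalizes.eigenvector_mem {L γ κ : ℝ} {V : TankL2 L ≃L[ℂ] L2Z} {σ : ℤ → ℂ}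
    (hV : Diagonalizes γ κ V σ) (n : ℤ) :
    InTankGraph L γ κ (V.symm (l2e n)) (σ n • V.symm (l2e n)) := by
  refine (hV _ _).2 fun p => ?_
  rw [map_smul, ContinuousLinearEquiv.apply_symm_apply, lp.coeFn_smul, Pi.smul_apply, smul_eq_mul,
    l2e_apply]
  split_ifs with h
  · rw [h]
  · simp

/-- The spacing is at least `π/L`; the rounded value `3/L` exceeds the sum of the localization radii
`1/(4L)` and `1/(8L)`. -/
lemma norm_tankFreq_sub {L : ℝ} (hL : 0 < L) (mu : ℝ) {n p : ℤ} (h : n ≠ p) :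
    3 / L ≤ ‖tankFreq L mu n - tankFreq L mu p‖ := by
  have e : tankFreq L mu n - tankFreq L mu p = ((Real.pi * (n - p : ℤ) / L : ℝ) : ℂ) * I := by
    unfold tankFreq; push_cast; ring
  rw [e, norm_mul, norm_I, mul_one, norm_real, Real.norm_eq_abs, abs_div, abs_mul,
    abs_of_pos Real.pi_pos, abs_of_pos hL]
  have h1 : (1 : ℝ) ≤ |((n - p : ℤ) : ℝ)| := by
    rw [← Int.cast_abs]
    exact_mod_cast Int.one_le_abs (sub_ne_zero.2 h)
  have := Real.pi_gt_three
  refine div_le_div_of_nonneg_right ?_ hL.le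
  nlinarith

/-- An eigenvector whose eigenvalue is close to the `n`-th free eigenvalue is proportional to the
`n`-th eigenvector. -/
theorem Diagonalizes.eigen_unique {L γ κ mu : ℝ} (hL : 0 < L) {V : TankL2 L ≃L[ℂ] L2Z}
    {σ : ℤ → ℂ} (hV : Diagonalizes γ κ V σ)
    (hσ : ∀ n, ‖σ n - tankFreq L mu n‖ ≤ 1 / (8 * L)) {f : TankL2 L} (hf : f ≠ 0) {l : ℂ} {n : ℤ}
    (H : InTankGraph L γ κ f (l • f)) (hl : ‖l - tankFreq L mu n‖ < 1 / (4 * L)) :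
    l = σ n ∧ ∃ c : ℂ, c ≠ 0 ∧ f = c • V.symm (l2e n) := by
  have h1 : ∀ p, (l - σ p) * V f p = 0 := fun p => by
    have h2 := (hV _ _).1 H p
    rw [map_smul, lp.coeFn_smul, Pi.smul_apply, smul_eq_mul] at h2
    linear_combination h2
  have h2 : ∀ p, p ≠ n → V f p = 0 := fun p hp => by
    refine (mul_eq_zero.1 (h1 p)).resolve_left fun h3 => ?_
    have h4 := norm_tankFreq_sub hL mu hp
    have h5 : tankFreq L mu p - tankFreq L mu n =
        (l - tankFreq L mu n) - (σ p - tankFreq L mu p) - (l - σ p) := by ring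
    rw [h5, h3, sub_zero] at h4
    have h6 := norm_sub_le (l - tankFreq L mu n) (σ p - tankFreq L mu p)
    have h7 := hσ p
    have e1 : 1 / (4 * L) = 1 / 4 * (1 / L) := by field_simp
    have e2 : 1 / (8 * L) = 1 / 8 * (1 / L) := by field_simp
    have e3 : 3 / L = 3 * (1 / L) := by field_simp
    have e4 : 0 < 1 / L := by positivity
    rw [e1] at hl
    rw [e2] at h7
    rw [e3] at h4
    linarith
  have h3 : V f = V f n • l2e n := by
    ext p
    rw [lp.coeFn_smul, Pi.smul_apply, smul_eq_mul, l2e_apply]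
    split_ifs with hp
    · rw [hp, mul_one]
    · rw [h2 p hp, mul_zero]
  have h4 : V f n ≠ 0 := fun h => hf (by
    rw [h, zero_smul] at h3
    exact V.map_eq_zero_iff.1 h3)
  refine ⟨sub_eq_zero.1 ((mul_eq_zero.1 (h1 n)).resolve_right h4), V f n, h4, ?_⟩
  rw [← map_smul, ← h3, ContinuousLinearEquiv.symm_apply_apply]

lemma tankCoef_zero_apply {L : ℝ} (hL : 0 < L) (f : TankL2 L) (n : ℤ) :
    tankCoef hL 0 f n = inner ℂ (freeE L n) f := by
  rw [tankCoef_apply, inner_freeE hL]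

lemma tankCoef_zero_eq {L : ℝ} (hL : 0 < L) (f : TankL2 L) :
    tankCoef hL 0 f = (freeBasis hL).repr f := by
  ext n
  rw [tankCoef_zero_apply, freeBasis_repr]

lemma norm_tankCoef_zero {L : ℝ} (hL : 0 < L) (f : TankL2 L) : ‖tankCoef hL 0 f‖ = ‖f‖ := by
  rw [tankCoef_zero_eq, LinearIsometryEquiv.norm_map]

lemma tankCoef_zero_freeE {L : ℝ} (hL : 0 < L) (n : ℤ) : tankCoef hL 0 (freeE L n) = l2e n := by
  ext p
  rw [tankCoef_zero_apply, orthonormal_iff_ite.1 (orthonormal_freeE hL), l2e_apply]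

/-- The operator `𝒜` is skew-symmetric. -/
lemma InTankGraph.skew {L γ : ℝ} (hL : 0 < L) (hγ : 0 < γ) (hγL : γ * L ≤ 1) {f h f' h' : TankL2 L}
    (H : InTankGraph L γ 1 f h) (H' : InTankGraph L γ 1 f' h') :
    inner ℂ h f' = -inner ℂ f h' := by
  obtain ⟨B, -, hB⟩ := exists_coupling hL hγ hγL
  have key : ∀ {f h}, InTankGraph L γ 1 f h →
      ∀ n, tankCoef hL 0 (h - B f) n = tankFreq L 0 n * tankCoef hL 0 f n := by
    intro f h H n
    rw [inTankGraph_iff_uncoupled hB, show (1 : ℝ) = Real.exp (-2 * 0 * L) by simp,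
      inTankGraph_zero_iff hL] at H
    rw [tankCoef_apply, tankCoef_apply, H]
  have hre : ∀ n, (starRingEnd ℂ) (tankFreq L 0 n) = -tankFreq L 0 n := fun n => by
    simp [tankFreq]
    ring
  -- Parseval reduces the uncoupled part to the fact that its diagonal entries are imaginary.
  have e1 : ∀ f g : TankL2 L, inner ℂ f g =
      ∑' n, tankCoef hL 0 g n * (starRingEnd ℂ) (tankCoef hL 0 f n) := fun f g => by
    rw [← (freeBasis hL).repr.inner_map_map, lp.inner_eq_tsum, tankCoef_zero_eq, tankCoef_zero_eq]
    rfl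
  have e2 : inner ℂ (h - B f) f' = -inner ℂ f (h' - B f') := by
    rw [e1, e1, ← tsum_neg]
    refine tsum_congr fun n => ?_
    rw [key H, key H', map_mul, hre]
    ring
  rw [inner_sub_left, inner_sub_right, coupling_skew hB] at e2
  linear_combination e2

/-- Existence of the orthonormal basis of eigenfunctions of `𝒜`. -/
theorem exists_isEigenbasisA {L γ : ℝ} (hL : 0 < L) (hγ : 0 < γ) (hγL : γ * L ≤ 1)
    {V : TankL2 L ≃L[ℂ] L2Z} {σ : ℤ → ℂ} (hV : Diagonalizes γ 1 V σ)
    (hσ : ∀ n, ‖σ n - tankFreq L 0 n‖ ≤ 1 / (8 * L))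
    (hnorm : ∀ n, tankCoef hL 0 (V.symm (l2e n)) n = 1) :
    ∃ (f : ℤ → TankL2 L) (lam : ℤ → ℂ), IsEigenbasisA L γ f lam := by
  have h0 : ∀ n, V.symm (l2e n) ≠ 0 := fun n h => by
    have := hnorm n
    rw [h, map_zero] at this
    simp at this
  set e : ℤ → TankL2 L := fun n => ((‖V.symm (l2e n)‖⁻¹ : ℝ) : ℂ) • V.symm (l2e n) with he
  have hmem : ∀ n, InTankGraph L γ 1 (e n) (σ n • e n) := fun n => by
    rw [he]
    simp only
    rw [smul_comm]
    exact (hV.eigenvector_mem n).smul _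
  have hne : ∀ n, ‖e n‖ = 1 := fun n => by
    rw [he]
    simp only
    rw [norm_smul, norm_real, norm_inv, norm_norm, inv_mul_cancel₀ (norm_ne_zero_iff.2 (h0 n))]
  -- The case `m = n` shows that the eigenvalues are imaginary; then distinct eigenvalues give
  -- orthogonality.
  have hsk : ∀ m n, ((starRingEnd ℂ) (σ m) + σ n) * inner ℂ (e m) (e n) = 0 := fun m n => by
    have h1 := (hmem m).skew hL hγ hγL (hmem n)
    have h2 : inner ℂ (σ m • e m) (e n) = (starRingEnd ℂ) (σ m) * inner ℂ (e m) (e n) :=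
      inner_smul_left _ _ _
    have h3 : inner ℂ (e m) (σ n • e n) = σ n * inner ℂ (e m) (e n) := inner_smul_right _ _ _
    rw [h2, h3] at h1
    linear_combination h1
  have hconj : ∀ m, (starRingEnd ℂ) (σ m) = -σ m := fun m => by
    have h1 := hsk m m
    rw [inner_self_eq_norm_sq_to_K, hne] at h1
    simp only [RCLike.ofReal_one, one_pow, mul_one] at h1
    linear_combination h1
  have hσinj : ∀ m n, m ≠ n → σ m ≠ σ n := fun m n hmn h => by
    have h4 := norm_tankFreq_sub hL 0 hmn
    have h5 : tankFreq L 0 m - tankFreq L 0 n =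
        (σ n - tankFreq L 0 n) - (σ m - tankFreq L 0 m) := by rw [h]; ring
    rw [h5] at h4
    have h6 := norm_sub_le (σ n - tankFreq L 0 n) (σ m - tankFreq L 0 m)
    have e2 : 1 / (8 * L) = 1 / 8 * (1 / L) := by field_simp
    have e3 : 3 / L = 3 * (1 / L) := by field_simp
    have e4 : 0 < 1 / L := by positivity
    have h7 := hσ m
    have h8 := hσ n
    rw [e2] at h7 h8
    rw [e3] at h4
    linarith
  -- The phase is right without adjustment because the `n`-th coefficient of the constructed
  -- eigenvector is `1`.
  have hphase : ∀ n, tankInner (e n) (tankClass L (freeEigenfunction L n)) =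
      ((‖V.symm (l2e n)‖⁻¹ : ℝ) : ℂ) := fun n => by
    change inner ℂ (freeE L n) (e n) = _
    rw [← tankCoef_zero_apply hL, he]
    simp only
    rw [map_smul, lp.coeFn_smul, Pi.smul_apply, hnorm, smul_eq_mul, mul_one]
  refine ⟨e, σ, fun n => ⟨tankDomain.mk _ _ (hmem n), rfl, rfl⟩, ⟨hne, fun m n hmn => ?_⟩, ?_,
    fun n => ?_, fun n => ?_, fun n => ?_⟩
  · have h1 := hsk m n
    rw [hconj] at h1
    refine (mul_eq_zero.1 h1).resolve_left fun h2 => hσinj m n hmn ?_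
    linear_combination -h2
  · rw [eq_top_iff]
    intro x _
    have h1 := l2_op_hasSum (V.symm : L2Z →L[ℂ] TankL2 L) (V x)
    rw [ContinuousLinearEquiv.coe_coe, ContinuousLinearEquiv.symm_apply_apply] at h1
    refine mem_closure_of_tendsto h1 (Filter.Eventually.of_forall fun s => ?_)
    refine Submodule.sum_mem _ fun k _ => Submodule.smul_mem _ _ ?_
    have h2 : V.symm (l2e k) = ((‖V.symm (l2e k)‖ : ℝ) : ℂ) • e k := by
      rw [he]
      simp only
      rw [smul_smul, ← ofReal_mul, mul_inv_cancel₀ (norm_ne_zero_iff.2 (h0 k)), ofReal_one,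
        one_smul]
    change V.symm (l2e k) ∈ _
    rw [h2]
    exact Submodule.smul_mem _ _ (Submodule.subset_span (Set.mem_range_self k))
  · have h1 := hσ n
    have h2 : tankFreq L 0 n = I * Real.pi * n / L := by simp [tankFreq]
    rw [h2] at h1
    refine h1.trans_lt (one_div_lt_one_div_of_lt (by positivity) (by linarith))
  · rw [hphase, ofReal_re]
    exact inv_pos.2 (norm_pos_iff.2 (h0 n))
  · rw [hphase, ofReal_im]

/-- Existence of the Riesz basis of eigenfunctions of `𝒜̃`. -/
theorem exists_isEigenbasisAtilde {L γ mu : ℝ} (hL : 0 < L)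
    {V : TankL2 L ≃L[ℂ] L2Z} {σ : ℤ → ℂ} (hV : Diagonalizes γ (Real.exp (-2 * mu * L)) V σ)
    (hσ : ∀ n, ‖σ n - tankFreq L mu n‖ ≤ 1 / (8 * L)) :
    ∃ (ft φt : ℤ → TankL2 L) (lamt : ℤ → ℂ), IsEigenbasisAtilde L γ mu ft φt lamt := by
  -- The adjoint of `V` sends the canonical basis to the dual family of its image under `V⁻¹`.
  refine ⟨fun n => V.symm (l2e n),
    fun p => ContinuousLinearMap.adjoint (V : TankL2 L →L[ℂ] L2Z) (l2e p), σ,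
    fun n => ⟨tankDomain.mk _ _ (hV.eigenvector_mem n), rfl, rfl⟩, ⟨V.symm, fun n => rfl⟩,
    fun n p => ?_, fun n => (hσ n).trans_lt (one_div_lt_one_div_of_lt (by positivity)
      (by linarith))⟩
  rw [tankInner, ContinuousLinearMap.adjoint_inner_left, inner_l2e_left,
    ContinuousLinearEquiv.coe_coe, ContinuousLinearEquiv.apply_symm_apply, l2e_apply]
  simp only [eq_comm]

/-! ### Arbitrary eigenbases compared with the constructed ones -/

lemma IsEigenbasisA.mem_graph {L γ : ℝ} {f : ℤ → TankL2 L} {lam : ℤ → ℂ}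
    (H : IsEigenbasisA L γ f lam) (n : ℤ) : InTankGraph L γ 1 (f n) (lam n • f n) := by
  obtain ⟨a, h1, h2⟩ := H.eigen n
  rw [← h2, ← h1]
  exact tankDomain_mem_graph a

lemma IsEigenbasisAtilde.mem_graph {L γ mu : ℝ} {ft φt : ℤ → TankL2 L} {lamt : ℤ → ℂ}
    (H : IsEigenbasisAtilde L γ mu ft φt lamt) (n : ℤ) :
    InTankGraph L γ (Real.exp (-2 * mu * L)) (ft n) (lamt n • ft n) := by
  obtain ⟨a, h1, h2⟩ := H.eigen n
  rw [← h2, ← h1]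
  exact tankDomain_mem_graph a

/-- A given eigenbasis of `𝒜` consists of multiples of the constructed eigenvectors. -/
lemma IsEigenbasisA.identify {L γ : ℝ} (hL : 0 < L) {V : TankL2 L ≃L[ℂ] L2Z} {σ : ℤ → ℂ}
    (hV : Diagonalizes γ 1 V σ) (hσ : ∀ n, ‖σ n - tankFreq L 0 n‖ ≤ 1 / (8 * L))
    {f : ℤ → TankL2 L} {lam : ℤ → ℂ} (H : IsEigenbasisA L γ f lam) (n : ℤ) :
    lam n = σ n ∧ ∃ c : ℂ, c ≠ 0 ∧ f n = c • V.symm (l2e n) := by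
  refine hV.eigen_unique hL hσ (H.orthonormal.ne_zero n) (H.mem_graph n) ?_
  have h2 : tankFreq L 0 n = I * Real.pi * n / L := by simp [tankFreq]
  rw [h2]
  exact H.eigenvalue_near n

/-- A given eigenbasis of `𝒜̃` consists of multiples of the constructed eigenvectors. -/
lemma IsEigenbasisAtilde.identify {L γ mu : ℝ} (hL : 0 < L) {V : TankL2 L ≃L[ℂ] L2Z} {σ : ℤ → ℂ}
    (hV : Diagonalizes γ (Real.exp (-2 * mu * L)) V σ)
    (hσ : ∀ n, ‖σ n - tankFreq L mu n‖ ≤ 1 / (8 * L))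
    {ft φt : ℤ → TankL2 L} {lamt : ℤ → ℂ} (H : IsEigenbasisAtilde L γ mu ft φt lamt) (n : ℤ) :
    lamt n = σ n ∧ ∃ c : ℂ, c ≠ 0 ∧ ft n = c • V.symm (l2e n) := by
  refine hV.eigen_unique hL hσ (fun h => ?_) (H.mem_graph n) (H.eigenvalue_near n)
  have h1 := H.biorthonormal n n
  rw [h, if_pos rfl, tankInner, inner_zero_right] at h1
  exact zero_ne_one h1

/-- The expansion in a given eigenbasis of `𝒜` diagonalizes `𝒜`. -/
theorem IsEigenbasisA.exists_diagonalizing {L γ : ℝ} (hL : 0 < L) {V : TankL2 L ≃L[ℂ] L2Z}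
    {σ : ℤ → ℂ} (hV : Diagonalizes γ 1 V σ) (hσ : ∀ n, ‖σ n - tankFreq L 0 n‖ ≤ 1 / (8 * L))
    {f : ℤ → TankL2 L} {lam : ℤ → ℂ} (H : IsEigenbasisA L γ f lam) :
    ∃ U : TankL2 L ≃L[ℂ] L2Z, (∀ α n, U α n = tankInner α (f n)) ∧ Diagonalizes γ 1 U lam := by
  set b := HilbertBasis.mk H.orthonormal H.complete.ge with hb
  set U : TankL2 L ≃L[ℂ] L2Z := b.repr.toContinuousLinearEquiv with hU
  have hUa : ∀ α n, U α n = tankInner α (f n) := fun α n => by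
    change b.repr α n = _
    rw [HilbertBasis.repr_apply_apply, hb, HilbertBasis.coe_mk]
    rfl
  choose c hc0 hc using fun n => (H.identify hL hV hσ n).2
  have hUV : ∀ α n, U α n = (c n)⁻¹ * V α n := fun α n => by
    have h1 := l2_op_coord_hasSum ((U : TankL2 L →L[ℂ] L2Z) ∘L (V.symm : L2Z →L[ℂ] TankL2 L))
      (V α) n
    have h2 : ((U : TankL2 L →L[ℂ] L2Z) ∘L (V.symm : L2Z →L[ℂ] TankL2 L)) (V α) = U α := by
      simp
    rw [h2] at h1
    refine h1.unique ?_
    convert! hasSum_ite_eq n ((c n)⁻¹ * V α n) using 2 with k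
    have h3 : ((U : TankL2 L →L[ℂ] L2Z) ∘L (V.symm : L2Z →L[ℂ] TankL2 L)) (l2e k) =
        (c k)⁻¹ • U (f k) := by
      rw [hc, map_smul, smul_smul, inv_mul_cancel₀ (hc0 k), one_smul]
      rfl
    rw [h3, lp.coeFn_smul, Pi.smul_apply, smul_eq_mul, hUa, tankInner,
      orthonormal_iff_ite.1 H.orthonormal]
    by_cases hk : k = n
    · subst hk; simp [mul_comm]
    · simp [hk, Ne.symm hk]
  refine ⟨U, hUa, fun g h => (hV g h).trans (forall_congr' fun n => ?_)⟩
  rw [hUV, hUV, (H.identify hL hV hσ n).1, mul_left_comm]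
  exact ⟨fun h => by rw [h], fun h => mul_left_cancel₀ (inv_ne_zero (hc0 n)) h⟩

/-- The eigenfunction `f_0` is close to `E_0`. -/
lemma IsEigenbasisA.norm_sub_freeE_le {L γ : ℝ} (hL : 0 < L) {V : TankL2 L ≃L[ℂ] L2Z} {σ : ℤ → ℂ}
    (hV : Diagonalizes γ 1 V σ) (hσ : ∀ n, ‖σ n - tankFreq L 0 n‖ ≤ 1 / (8 * L)) {η : ℝ}
    (hη : ∀ x, ‖tankCoef hL 0 (V.symm x) - x‖ ≤ η * ‖x‖)
    (hnorm : ∀ n, tankCoef hL 0 (V.symm (l2e n)) n = 1)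
    {f : ℤ → TankL2 L} {lam : ℤ → ℂ} (H : IsEigenbasisA L γ f lam) (n : ℤ) :
    ‖f n - freeE L n‖ ≤ 2 * η := by
  obtain ⟨-, c, hc0, hc⟩ := H.identify hL hV hσ n
  set w := tankCoef hL 0 (V.symm (l2e n)) with hw
  have h1 : tankCoef hL 0 (f n) = c • w := by rw [hc, map_smul]
  have h2 : tankInner (f n) (tankClass L (freeEigenfunction L n)) = c := by
    change inner ℂ (freeE L n) (f n) = _
    rw [← tankCoef_zero_apply hL, h1, lp.coeFn_smul, Pi.smul_apply, hw, hnorm, smul_eq_mul, mul_one]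
  have h3 := H.phase_re n
  have h4 := H.phase_im n
  rw [h2] at h3 h4
  -- The phase condition makes `c` a positive real and the unit norm gives `c = 1/‖w‖`. One `η`
  -- comes from `‖c w - w‖ = |1 - ‖w‖|`, the other from `‖w - e_n‖`.
  have hcr : c = (c.re : ℂ) := by
    apply Complex.ext <;> simp [h4]
  have h5 : ‖c‖ * ‖w‖ = 1 := by
    rw [← norm_smul, ← h1, norm_tankCoef_zero, H.orthonormal.1]
  have h6 : ‖c‖ = c.re := by rw [hcr, norm_real, Real.norm_eq_abs, ofReal_re, abs_of_pos h3]
  have h7 : ‖w - l2e n‖ ≤ η := (hη _).trans_eq (by rw [norm_l2e, mul_one])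
  have h8 : |1 - ‖w‖| ≤ η := by
    have := abs_norm_sub_norm_le w (l2e n)
    rw [norm_l2e] at this
    rw [abs_sub_comm]
    exact this.trans h7
  have h9 : ‖c • w - w‖ ≤ η := by
    have e : c • w - w = ((c.re - 1 : ℝ) : ℂ) • w := by
      push_cast
      rw [← hcr, sub_smul, one_smul]
    rw [e, norm_smul, norm_real, Real.norm_eq_abs]
    have e2 : |c.re - 1| * ‖w‖ = |1 - ‖w‖| := by
      rw [h6] at h5
      rw [← abs_of_nonneg (norm_nonneg w), ← abs_mul, abs_of_nonneg (norm_nonneg w)]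
      congr 1
      linarith
    rw [e2]
    exact h8
  rw [← norm_tankCoef_zero hL, map_sub, h1, tankCoef_zero_freeE]
  have : c • w - l2e n = (c • w - w) + (w - l2e n) := by abel
  rw [this]
  exact (norm_add_le _ _).trans (by linarith)

/-! ### The coefficients of the control profile -/

lemma tankCoef_ibp {L : ℝ} (hL : 0 < L) (mu : ℝ) {u v : ℝ → C2} (h : IsH1Rep L u v)
    {f g : TankL2 L} (hf : f =ᵐ[tankMeasure L] u)
    (hg : g =ᵐ[tankMeasure L] fun x => matLambda (v x)) (n : ℤ) :
    tankFreq L mu n * tankCoef hL mu f n =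
      1 / (2 * L) * (exp (mu * L) * u 0 0 + exp (-(mu * L)) * u 0 1 -
        (-1) ^ n * (u L 0 + u L 1)) + tankCoef hL mu g n := by
  rw [tankCoef_apply, tankCoef_apply, tankCoefInt_congr hL mu n hf, tankCoefInt_congr hL mu n hg,
    tankCoefInt_ibp hL mu n h]

lemma continuousOn_tankDelta {L γ : ℝ} (hL : 0 < L) (hγ : 0 < γ) (h : γ * L ≤ 1) :
    ContinuousOn (tankDelta L γ) (Set.Icc 0 L) := by
  unfold tankDelta
  refine continuousOn_const.mul (continuousOn_const.div ?_ fun x hx =>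
    (lt_of_lt_of_le (by norm_num) (tankDelta_den hL hγ h hx)).ne')
  fun_prop

lemma abs_integral_tankDelta_le {L γ : ℝ} (hL : 0 < L) (hγ : 0 < γ) (h : γ * L ≤ 1) {x : ℝ}
    (hx : x ∈ Set.Icc 0 L) : |∫ y in (0 : ℝ)..x, tankDelta L γ y| ≤ 3 * (γ * L) := by
  have h1 := intervalIntegral.norm_integral_le_of_norm_le_const (a := 0) (b := x)
    (f := tankDelta L γ) (C := 3 * γ) fun y hy => by
      rw [Set.uIoc_of_le hx.1] at hy
      exact abs_tankDelta_le hL hγ h ⟨hy.1.le, hy.2.trans hx.2⟩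
  rw [Real.norm_eq_abs, sub_zero, abs_of_nonneg hx.1] at h1
  nlinarith [hx.2]

lemma continuousOn_tankProfile {L γ : ℝ} (hL : 0 < L) (hγ : 0 < γ) (h : γ * L ≤ 1) :
    ContinuousOn (tankProfile L γ) (Set.Icc 0 L) := by
  have hp : ContinuousOn (fun x => Real.exp (∫ y in (0 : ℝ)..x, tankDelta L γ y))
      (Set.Icc 0 L) := by
    have := intervalIntegral.continuousOn_primitive_interval'
      ((continuousOn_tankDelta hL hγ h).intervalIntegrable_of_Icc (μ := volume) hL.le)
      Set.left_mem_uIcc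
    rw [Set.uIcc_of_le hL.le] at this
    exact Real.continuous_exp.comp_continuousOn this
  unfold tankProfile
  refine (PiLp.continuous_toLp 2 _).comp_continuousOn (continuousOn_pi.2 fun i => ?_)
  fin_cases i
  · exact Complex.continuous_ofReal.comp_continuousOn hp
  · exact Complex.continuous_ofReal.comp_continuousOn hp

lemma tankProfile_isH1Rep {L γ : ℝ} (hL : 0 < L) (hγ : 0 < γ) (h : γ * L ≤ 1) :
    IsH1Rep L (tankProfile L γ) (fun x => (tankDelta L γ x : ℂ) • tankProfile L γ x) := by
  have hδ := continuousOn_tankDelta hL hγ h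
  have hP := continuousOn_tankProfile hL hγ h
  refine isH1Rep_of_hasDerivAt hL hP
    ((continuous_ofReal.comp_continuousOn hδ).smul hP) fun x hx i => ?_
  have hx' := Set.Ioo_subset_Icc_self hx
  have h1 : HasDerivAt (fun x => ∫ y in (0 : ℝ)..x, tankDelta L γ y) (tankDelta L γ x) x :=
    intervalIntegral.integral_hasDerivAt_right
      ((hδ.mono (Set.Icc_subset_Icc_right hx'.2)).intervalIntegrable_of_Icc hx'.1)
      (measurable_tankDelta L γ).stronglyMeasurable.stronglyMeasurableAtFilter
      (hδ.continuousAt (Icc_mem_nhds hx.1 hx.2))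
  have h2 := h1.exp.ofReal_comp
  have key : HasDerivAt (fun x => ((Real.exp (∫ y in (0 : ℝ)..x, tankDelta L γ y) : ℝ) : ℂ))
      ((tankDelta L γ x : ℂ) * (Real.exp (∫ y in (0 : ℝ)..x, tankDelta L γ y) : ℝ)) x := by
    convert! h2 using 1
    push_cast
    ring
  fin_cases i
  · exact key
  · exact key

lemma norm_tankProfile_le {L γ : ℝ} (hL : 0 < L) (hγ : 0 < γ) (h : 3 * (γ * L) ≤ 1) {x : ℝ}
    (hx : x ∈ Set.Icc 0 L) : ‖tankProfile L γ x‖ ≤ 6 := by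
  have h1 := abs_integral_tankDelta_le hL hγ (by linarith) hx
  have h2 : Real.exp (∫ y in (0 : ℝ)..x, tankDelta L γ y) ≤ 3 :=
    (Real.exp_le_exp.2 ((le_abs_self _).trans (h1.trans h))).trans Real.exp_one_lt_three.le
  have h3 := Real.exp_pos (∫ y in (0 : ℝ)..x, tankDelta L γ y)
  rw [EuclideanSpace.norm_eq, Real.sqrt_le_left (by norm_num), Fin.sum_univ_two]
  simp only [tankProfile, Matrix.cons_val_zero, Matrix.cons_val_one, norm_real,
    Real.norm_eq_abs, abs_of_pos h3]
  nlinarith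

lemma norm_matLambda (v : C2) : ‖matLambda v‖ = ‖v‖ := by
  rw [EuclideanSpace.norm_eq, EuclideanSpace.norm_eq]
  simp [matLambda]

lemma exists_norm_le_of_bound {L : ℝ} (hL : 0 < L) : ∃ K : ℝ, 0 ≤ K ∧ ∀ (u : ℝ → C2) (M : ℝ),
    0 ≤ M → ContinuousOn u (Set.Icc 0 L) → (∀ x ∈ Set.Icc 0 L, ‖u x‖ ≤ M) →
      ‖tankClass L u‖ ≤ K * M := by
  refine ⟨(measureUnivNNReal (tankMeasure L) : ℝ) ^ ((2 : ℝ≥0∞).toReal)⁻¹, by positivity,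
    fun u M hM hu hb => Lp.norm_le_of_ae_bound hM ?_⟩
  filter_upwards [coeFn_tankClass (continuousOn_memLp_tank hL hu), ae_tank_mem hL] with x h1 h2
  rw [h1]
  exact hb x (Set.Ioo_subset_Icc_self h2)

/-- The coefficients of the control profile `𝓘`. -/
theorem exists_profile_coef {L : ℝ} (hL : 0 < L) (mu : ℝ) :
    ∃ K : ℝ, 0 ≤ K ∧ ∀ γ : ℝ, 0 < γ → 3 * (γ * L) ≤ 1 →
      ‖tankClass L (tankProfile L γ)‖ ≤ K ∧
      ∀ p, ‖tankFreq L mu p * tankCoef hL mu (tankClass L (tankProfile L γ)) p -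
        1 / (2 * L) * (exp (mu * L) + exp (-(mu * L)) - 2 * (-1) ^ p)‖ ≤ K * γ := by
  obtain ⟨K, hK, hKb⟩ := exists_norm_le_of_bound hL
  set A : TankL2 L →L[ℂ] L2Z := (tankCoef hL mu : TankL2 L →L[ℂ] L2Z) with hA
  refine ⟨K * 6 + 6 + ‖A‖ * (K * 18), by positivity, fun γ hγ hγL => ?_⟩
  have hγL' : γ * L ≤ 1 := by nlinarith [mul_pos hγ hL]
  have hc := continuousOn_tankProfile hL hγ hγL'
  have hrep := tankProfile_isH1Rep hL hγ hγL'
  have hnA : 0 ≤ ‖A‖ * (K * 18) := by positivity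
  refine ⟨(hKb _ 6 (by norm_num) hc fun x hx => norm_tankProfile_le hL hγ hγL hx).trans
    (by linarith), fun p => ?_⟩
  set v : ℝ → C2 := fun x => (tankDelta L γ x : ℂ) • tankProfile L γ x with hv
  have hvc : ContinuousOn (fun x => matLambda (v x)) (Set.Icc 0 L) :=
    continuous_matLambda.comp_continuousOn ((continuous_ofReal.comp_continuousOn
      (continuousOn_tankDelta hL hγ hγL')).smul hc)
  set g := tankClass L fun x => matLambda (v x) with hg
  have hgn : ‖g‖ ≤ K * (18 * γ) := by
    refine hKb _ _ (by positivity) hvc fun x hx => ?_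
    rw [norm_matLambda, hv]
    simp only
    rw [norm_smul, norm_real, Real.norm_eq_abs]
    have := mul_le_mul (abs_tankDelta_le hL hγ hγL' hx) (norm_tankProfile_le hL hγ hγL hx)
      (norm_nonneg _) (by positivity)
    linarith
  have hibp := tankCoef_ibp hL mu hrep (coeFn_tankClass (continuousOn_memLp_tank hL hc))
    (coeFn_tankClass (continuousOn_memLp_tank hL hvc)) p
  -- The profile is `(1, 1)` at `0` and `(e^θ, e^θ)` at `L` with `θ = O(γ)`. It violates the
  -- boundary conditions, and the surviving boundary terms are the leading part; the interior term
  -- involves `δ 𝓘` and is `O(γ)`.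
  set θ := ∫ y in (0 : ℝ)..L, tankDelta L γ y with hθ
  have hθ1 : |θ| ≤ 3 * (γ * L) := abs_integral_tankDelta_le hL hγ hγL' (Set.right_mem_Icc.2 hL.le)
  have hθ2 : |Real.exp θ - 1| ≤ 2 * |θ| := Real.abs_exp_sub_one_le (hθ1.trans hγL)
  have e0 : tankProfile L γ 0 0 = 1 ∧ tankProfile L γ 0 1 = 1 := by simp [tankProfile]
  have e1 : tankProfile L γ L 0 = (Real.exp θ : ℝ) ∧ tankProfile L γ L 1 = (Real.exp θ : ℝ) := by
    simp only [tankProfile, ← hθ]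
    simp
  rw [e0.1, e0.2, e1.1, e1.2] at hibp
  rw [hibp]
  have e2 : 1 / (2 * L) * (exp (mu * L) * 1 + exp (-(mu * L)) * 1 -
      (-1) ^ p * ((Real.exp θ : ℝ) + (Real.exp θ : ℝ))) + tankCoef hL mu g p -
      1 / (2 * L) * (exp (mu * L) + exp (-(mu * L)) - 2 * (-1) ^ p) =
      -(((1 / L * (Real.exp θ - 1) : ℝ) : ℂ) * (-1) ^ p) + A g p := by
    rw [hA]
    simp only [ContinuousLinearEquiv.coe_coe]
    push_cast
    ring
  rw [e2]
  have b1 : ‖-(((1 / L * (Real.exp θ - 1) : ℝ) : ℂ) * (-1) ^ p)‖ ≤ 6 * γ := by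
    rw [norm_neg, norm_mul, norm_zpow, norm_neg, norm_one, one_zpow, mul_one, norm_real,
      Real.norm_eq_abs, abs_mul, abs_of_pos (by positivity : 0 < 1 / L)]
    calc 1 / L * |Real.exp θ - 1| ≤ 1 / L * (6 * (γ * L)) :=
          mul_le_mul_of_nonneg_left (by linarith) (by positivity)
      _ = 6 * γ := by field_simp
  have b2 : ‖A g p‖ ≤ ‖A‖ * (K * (18 * γ)) :=
    (l2_coord_norm_le _ p).trans ((A.le_opNorm g).trans
      (mul_le_mul_of_nonneg_left hgn (norm_nonneg _)))
  refine (norm_add_le _ _).trans ?_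
  nlinarith [mul_nonneg hK hγ.le]

/-- The coefficients of the first eigenfunction `f_0`. -/
theorem eigenfunction_coef_bound {L γ : ℝ} (hL : 0 < L) (mu : ℝ) (hγ : 0 < γ) (hγL : γ * L ≤ 1)
    {f : TankL2 L} {l : ℂ} (H : InTankGraph L γ 1 f (l • f)) (hf : ‖f‖ = 1) {η : ℝ}
    (hl : ‖l‖ ≤ η) (hη : ‖f - freeE L 0‖ ≤ 2 * η) (p : ℤ) :
    ‖tankFreq L mu p * tankCoef hL mu f p - 1 / (2 * L) * (exp (mu * L) - exp (-(mu * L)))‖ ≤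
      ‖(tankCoef hL mu : TankL2 L →L[ℂ] L2Z)‖ * (2 * |mu| * η + 2 * (η + 3 * γ * ‖matJL‖)) := by
  set A : TankL2 L →L[ℂ] L2Z := (tankCoef hL mu : TankL2 L →L[ℂ] L2Z) with hA
  obtain ⟨B, hBn, hB⟩ := exists_coupling hL hγ hγL
  set g := l • f - B f with hg
  have hgn : ‖g‖ ≤ η + 3 * γ * ‖matJL‖ := by
    refine (norm_sub_le _ _).trans (add_le_add ?_ ?_)
    · rw [norm_smul, hf, mul_one]; exact hl
    · refine (B.le_opNorm f).trans ?_
      rw [hf, mul_one]; exact hBn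
  obtain ⟨u, v, h1, h2, h3, h4, h5⟩ := (inTankGraph_iff_uncoupled hB f (l • f)).1 H
  have hibp := fun n => tankCoef_ibp hL mu h1 h2 (coeFn_matLambda_of_uncoupled h3) n
  -- Closeness to `E_0` in `L²` does not control the boundary value `u 0 0`. It is eliminated by the
  -- identity at index `0`, namely `μ (A f)_0 = S u₁(0) + (A g)_0`, compared with `μ (A E_0)_0 = S`.
  have h4' : u 0 1 = -u 0 0 := by
    simp only [ofReal_one, one_mul] at h4
    linear_combination h4
  set S : ℂ := 1 / (2 * L) * (exp (mu * L) - exp (-(mu * L))) with hS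
  have hp : ∀ n, tankFreq L mu n * tankCoef hL mu f n = S * u 0 0 + A g n := fun n => by
    rw [hibp n, h4', h5, hS, hA]
    simp only [ContinuousLinearEquiv.coe_coe, ← hg]
    ring
  have h0 : (mu : ℂ) * A (freeE L 0) 0 = S := by
    have := tankCoefInt_freeEigenfunction hL mu 0 0
    rw [tankFreq_zero_zero, sub_zero, ← tankCoefInt_congr hL mu 0 (coeFn_freeE L 0),
      ← tankCoef_apply hL, ← hS] at this
    rw [← this, hA]
    simp [tankFreq]
  have hf0 : (mu : ℂ) * A f 0 = S * u 0 0 + A g 0 := by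
    rw [← hp 0, hA]
    simp [tankFreq]
  have hd : A (f - freeE L 0) 0 = A f 0 - A (freeE L 0) 0 := by rw [map_sub]; rfl
  have e : tankFreq L mu p * tankCoef hL mu f p - S =
      mu * A (f - freeE L 0) 0 + (A g p - A g 0) := by
    rw [hp, hd]
    linear_combination h0 - hf0
  have hAg : ∀ n, ‖A g n‖ ≤ ‖A‖ * (η + 3 * γ * ‖matJL‖) := fun n =>
    (l2_coord_norm_le _ n).trans ((A.le_opNorm g).trans
      (mul_le_mul_of_nonneg_left hgn (norm_nonneg _)))
  have hAd : ‖A (f - freeE L 0) 0‖ ≤ ‖A‖ * (2 * η) :=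
    (l2_coord_norm_le _ 0).trans ((A.le_opNorm _).trans
      (mul_le_mul_of_nonneg_left hη (norm_nonneg _)))
  rw [e]
  calc _ ≤ ‖(mu : ℂ) * A (f - freeE L 0) 0‖ + (‖A g p‖ + ‖A g 0‖) :=
        (norm_add_le _ _).trans (by gcongr; exact norm_sub_le _ _)
    _ ≤ |mu| * (‖A‖ * (2 * η)) + (‖A‖ * (η + 3 * γ * ‖matJL‖) + ‖A‖ * (η + 3 * γ * ‖matJL‖)) := by
        refine add_le_add ?_ (add_le_add (hAg p) (hAg 0))
        rw [norm_mul, norm_real, Real.norm_eq_abs]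
        exact mul_le_mul_of_nonneg_left hAd (abs_nonneg _)
    _ = _ := by ring

/-- With `t = μL`, strictness keeps the coefficients of even index of the profile away from zero,
where `cosh(μL) - (-1)^p` is smallest. -/
lemma two_lt_exp_add_exp_neg {t : ℝ} (ht : 0 < t) : 2 < Real.exp t + Real.exp (-t) := by
  have h1 : 1 < Real.exp t := Real.one_lt_exp_iff.2 ht
  have h2 : Real.exp t * Real.exp (-t) = 1 := by rw [← Real.exp_add]; simp
  nlinarith [Real.exp_pos (-t)]

/-- The coefficients of the control `𝓘_ν` are exactly of order `1/(1+|p|)`. -/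
theorem exists_control_bounds {L mu : ℝ} (hL : 0 < L) (hmu : 0 < mu) {K0 : ℝ} (hK0 : 0 < K0) :
    ∃ m M ε : ℝ, 0 < m ∧ 0 < M ∧ 0 < ε ∧ ∀ γ : ℝ, 0 < γ → γ ≤ ε → ∀ (f : TankL2 L) (l : ℂ),
      InTankGraph L γ 1 f (l • f) → ‖f‖ = 1 → ‖l‖ ≤ K0 * γ → ‖f - freeE L 0‖ ≤ 2 * (K0 * γ) →
      ∀ ν : ℝ, 0 < ν →
        ‖tankCoef hL mu (tankClass L (tankProfile L γ) + (ν : ℂ) • f)‖ ≤ M * (1 + ν) ∧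
        ∀ p, m * (1 + ν) ≤ ‖tankFreq L mu p *
            tankCoef hL mu (tankClass L (tankProfile L γ) + (ν : ℂ) • f) p‖ ∧
          ‖tankFreq L mu p *
            tankCoef hL mu (tankClass L (tankProfile L γ) + (ν : ℂ) • f) p‖ ≤ M * (1 + ν) := by
  obtain ⟨K1, hK1, hprof⟩ := exists_profile_coef hL mu
  set A : TankL2 L →L[ℂ] L2Z := (tankCoef hL mu : TankL2 L →L[ℂ] L2Z) with hA
  set K2 : ℝ := ‖A‖ * (2 * |mu| * K0 + 2 * (K0 + 3 * ‖matJL‖)) with hK2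
  have hK20 : 0 ≤ K2 := by positivity
  set Eh := Real.exp (mu * L) with hEh
  set El := Real.exp (-(mu * L)) with hEl
  have hE2 : 2 < Eh + El := two_lt_exp_add_exp_neg (mul_pos hmu hL)
  have hEd : El < Eh := Real.exp_lt_exp.2 (by nlinarith [mul_pos hmu hL])
  -- Limits of the weighted coefficients as `γ → 0`: `a` and `b` for the profile at even and odd
  -- index, `S` for `f_0`. All are positive, so adding a positive multiple of `f_0` cannot cancel
  -- the profile.
  set a : ℝ := 1 / (2 * L) * (Eh + El - 2) with ha
  set b : ℝ := 1 / (2 * L) * (Eh + El + 2) with hb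
  set S : ℝ := 1 / (2 * L) * (Eh - El) with hS
  have hLp : 0 < 1 / (2 * L) := by positivity
  have ha0 : 0 < a := mul_pos hLp (by linarith)
  have hab : a ≤ b := mul_le_mul_of_nonneg_left (by linarith) hLp.le
  have hS0 : 0 < S := mul_pos hLp (by linarith)
  set q := min a S with hq
  have hq0 : 0 < q := lt_min ha0 hS0
  -- The main term is at least `q (1 + ν)` and the error at most `(K1 + K2) γ (1 + ν)`. Both scale
  -- with `1 + ν`, so the threshold on `γ` is independent of `ν`; it lets the error take half of
  -- `q`.
  refine ⟨q / 2, b + S + q + ‖A‖ * (K1 + 1), min (1 / (3 * L)) (q / (2 * (K1 + K2 + 1))),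
    by positivity, by positivity, by positivity, fun γ hγ hγε f l H hf hl hη ν hν => ?_⟩
  have hγL : 3 * (γ * L) ≤ 1 := by
    have := (le_div_iff₀ (by positivity)).1 (hγε.trans (min_le_left _ _))
    linarith
  have hγL' : γ * L ≤ 1 := by nlinarith [mul_pos hγ hL]
  have hγq : (K1 + K2) * γ ≤ q / 2 := by
    have := (le_div_iff₀ (by positivity)).1 (hγε.trans (min_le_right _ _))
    nlinarith
  obtain ⟨hPn, hPc⟩ := hprof γ hγ hγL
  have hfc := eigenfunction_coef_bound hL mu hγ hγL' H hf hl hη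
  have hK2γ : ‖A‖ * (2 * |mu| * (K0 * γ) + 2 * (K0 * γ + 3 * γ * ‖matJL‖)) = K2 * γ := by
    rw [hK2]; ring
  set P := tankClass L (tankProfile L γ) with hP
  have hnorm : ‖P + (ν : ℂ) • f‖ ≤ K1 + ν := by
    refine (norm_add_le _ _).trans (add_le_add hPn ?_)
    rw [norm_smul, hf, mul_one, norm_real, Real.norm_eq_abs, abs_of_pos hν]
  have hA0 := norm_nonneg A
  refine ⟨?_, fun p => ?_⟩
  · refine (A.le_opNorm _).trans ((mul_le_mul_of_nonneg_left hnorm hA0).trans ?_)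
    have a1 := mul_nonneg (mul_nonneg hA0 hK1) hν.le
    have a2 : 0 ≤ (b + S + q) * (1 + ν) :=
      mul_nonneg (by linarith) (by linarith)
    linarith
  · obtain ⟨t, ht1, ht2, ht⟩ : ∃ t : ℝ, a ≤ t ∧ t ≤ b ∧
        (1 / (2 * L) * (exp (mu * L) + exp (-(mu * L)) - 2 * (-1) ^ p) : ℂ) = t := by
      rcases Int.even_or_odd p with h | h
      · refine ⟨a, le_rfl, hab, ?_⟩
        rw [h.neg_one_zpow, ha, hEh, hEl]
        push_cast
        ring
      · refine ⟨b, hab, le_rfl, ?_⟩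
        rw [h.neg_one_zpow, hb, hEh, hEl]
        push_cast
        ring
    have hSc : (1 / (2 * L) * (exp (mu * L) - exp (-(mu * L))) : ℂ) = S := by
      rw [hS, hEh, hEl]
      push_cast
      ring
    have h1 := hPc p
    have h2 := hfc p
    rw [ht] at h1
    rw [hSc, hK2γ] at h2
    have e1 : tankCoef hL mu (P + (ν : ℂ) • f) p =
        tankCoef hL mu P p + ν * tankCoef hL mu f p := by
      rw [map_add, map_smul]; rfl
    set z := tankFreq L mu p * tankCoef hL mu (P + (ν : ℂ) • f) p with hz
    have hν1 : 0 ≤ 1 + ν := by linarith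
    have h3 : ‖z - ((t + ν * S : ℝ) : ℂ)‖ ≤ q / 2 * (1 + ν) := by
      have e2 : z - ((t + ν * S : ℝ) : ℂ) = (tankFreq L mu p * tankCoef hL mu P p - t) +
          ν * (tankFreq L mu p * tankCoef hL mu f p - S) := by
        rw [hz, e1]; push_cast; ring
      rw [e2]
      calc _ ≤ K1 * γ + ν * (K2 * γ) := by
            refine (norm_add_le _ _).trans (add_le_add h1 ?_)
            rw [norm_mul, norm_real, Real.norm_eq_abs, abs_of_pos hν]
            exact mul_le_mul_of_nonneg_left h2 hν.le
        _ ≤ (K1 + K2) * γ * (1 + ν) := by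
            have a1 := mul_nonneg hK20 hγ.le
            have a2 := mul_nonneg (mul_nonneg hK1 hγ.le) hν.le
            linarith
        _ ≤ q / 2 * (1 + ν) := mul_le_mul_of_nonneg_right hγq hν1
    have q1 : q ≤ a := min_le_left _ _
    have q2 : q ≤ S := min_le_right _ _
    clear_value z
    clear hz hfc hPc hprof hP hK2γ e1 h1 h2 ht hSc
    have h4 : ‖((t + ν * S : ℝ) : ℂ)‖ = t + ν * S := by
      rw [norm_real, Real.norm_eq_abs, abs_of_pos (add_pos (ha0.trans_le ht1) (mul_pos hν hS0))]
    have h5 : q * (1 + ν) ≤ t + ν * S := by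
      have := mul_le_mul_of_nonneg_left q2 hν.le
      linarith
    have h6 := norm_sub_norm_le ((t + ν * S : ℝ) : ℂ) z
    have h7 := norm_sub_norm_le z ((t + ν * S : ℝ) : ℂ)
    rw [norm_sub_rev] at h6
    rw [h4] at h6 h7
    refine ⟨by linarith, ?_⟩
    have h8 : t + ν * S ≤ (b + S) * (1 + ν) := by
      have := mul_nonneg (ha0.le.trans hab) hν.le
      linarith
    have h9 : 0 ≤ ‖A‖ * (K1 + 1) * (1 + ν) := by positivity
    have h10 : 0 ≤ q * (1 + ν) := by positivity
    linarith

/-! ### The Cauchy matrix of the two spectra -/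

/-- A small perturbation of an isomorphism of `ℓ²` is an isomorphism. -/
theorem exists_equiv_of_perturbation (N : L2Z ≃L[ℂ] L2Z) (D : L2Z →L[ℂ] L2Z)
    (h : ‖(N.symm : L2Z →L[ℂ] L2Z)‖ * ‖D‖ < 1) :
    ∃ M : L2Z ≃L[ℂ] L2Z, ∀ x, M x = N x + D x := by
  have hY : ‖-((N.symm : L2Z →L[ℂ] L2Z) ∘L D)‖ < 1 := by
    rw [norm_neg]
    exact (ContinuousLinearMap.opNorm_comp_le _ _).trans_lt h
  refine ⟨(ContinuousLinearEquiv.ofUnit (Units.oneSub _ hY)).trans N, fun x => ?_⟩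
  have e : ContinuousLinearEquiv.ofUnit (Units.oneSub _ hY) x = x + N.symm (D x) := by
    change (1 - -((N.symm : L2Z →L[ℂ] L2Z) ∘L D)) x = _
    rw [sub_neg_eq_add]
    rfl
  rw [ContinuousLinearEquiv.trans_apply, e, map_add, ContinuousLinearEquiv.apply_symm_apply]

lemma tankFreq_sub (L mu : ℝ) (p n : ℤ) :
    tankFreq L mu p - tankFreq L 0 n = tankFreq L mu (p - n) := by
  unfold tankFreq; push_cast; ring

lemma le_norm_tankFreq (L mu : ℝ) (n : ℤ) : mu ≤ ‖tankFreq L mu n‖ := by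
  have h := Complex.re_le_norm (tankFreq L mu n)
  rwa [tankFreq_re] at h

/-- This exhibits the free Cauchy matrix, up to a nonzero constant, as the transition matrix from
the orthonormal basis `E_n` to the `μ`-coefficients; its invertibility follows at once. -/
lemma tankCoef_freeE {L mu : ℝ} (hL : 0 < L) (hmu : 0 < mu) (p n : ℤ) :
    tankCoef hL mu (freeE L n) p = 1 / (2 * L) * (exp (mu * L) - exp (-(mu * L))) *
      (tankFreq L mu (p - n))⁻¹ := by
  have h0 : tankFreq L mu (p - n) ≠ 0 :=
    norm_pos_iff.1 (hmu.trans_le (le_norm_tankFreq L mu (p - n)))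
  rw [tankCoef_apply, tankCoefInt_congr hL mu p (coeFn_freeE L n),
    ← tankCoefInt_freeEigenfunction hL mu p n, tankFreq_sub, mul_comm, inv_mul_cancel_left₀ h0]

lemma sinh_const_ne_zero {L mu : ℝ} (hL : 0 < L) (hmu : 0 < mu) :
    1 / (2 * L) * (exp (mu * L) - exp (-(mu * L))) ≠ 0 := by
  have e : (1 / (2 * L) * (exp (mu * L) - exp (-(mu * L))) : ℂ) =
      ((1 / (2 * L) * (Real.exp (mu * L) - Real.exp (-(mu * L))) : ℝ) : ℂ) := by push_cast; ring
  rw [e, ofReal_ne_zero]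
  have h1 : -(mu * L) < mu * L := by nlinarith [mul_pos hmu hL]
  have h2 := Real.exp_lt_exp.2 h1
  have : 0 < Real.exp (mu * L) - Real.exp (-(mu * L)) := sub_pos.2 h2
  positivity

/-- Up to a constant these are the squared moduli of the coefficients of `E_0`, which form an
element of `ℓ²`. -/
lemma summable_inv_norm_tankFreq_sq {L mu : ℝ} (hL : 0 < L) (hmu : 0 < mu) :
    Summable fun k => (‖tankFreq L mu k‖ ^ 2)⁻¹ := by
  have h := (l2_hasSum_sq (tankCoef hL mu (freeE L 0))).summable
  have hS := norm_ne_zero_iff.2 (sinh_const_ne_zero hL hmu)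
  refine (h.mul_left ((‖1 / (2 * L) * (exp (mu * L) - exp (-(mu * L)))‖ ^ 2)⁻¹)).congr fun k => ?_
  rw [tankCoef_freeE hL hmu, norm_mul _ (tankFreq L mu (k - 0))⁻¹, mul_pow, norm_inv, inv_pow,
    sub_zero,
    inv_mul_cancel_left₀ (pow_ne_zero 2 hS)]

/-- The Cauchy matrix of two small perturbations of the free spectra is an isomorphism. -/
theorem exists_cauchy_equiv {L mu : ℝ} (hL : 0 < L) (hmu : 0 < mu) :
    ∃ η : ℝ, 0 < η ∧ ∀ σ lam : ℤ → ℂ, (∀ p, ‖σ p - tankFreq L mu p‖ ≤ η) →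
      (∀ n, ‖lam n - tankFreq L 0 n‖ ≤ η) →
      (∀ p n, mu / 2 ≤ ‖σ p - lam n‖) ∧
      ∃ N : L2Z ≃L[ℂ] L2Z, ∀ n p, N (l2e n) p = (σ p - lam n)⁻¹ := by
  set S : ℂ := 1 / (2 * L) * (exp (mu * L) - exp (-(mu * L))) with hS
  have hS0 : S ≠ 0 := sinh_const_ne_zero hL hmu
  have hSi : ‖S‖ ≠ 0 := norm_ne_zero_iff.2 hS0
  obtain ⟨D, hD⟩ := exists_diag_equiv (fun _ => S⁻¹) (c := ‖S⁻¹‖) (R := ‖S⁻¹‖)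
    (norm_pos_iff.2 (inv_ne_zero hS0)) (fun _ => le_rfl) (fun _ => le_rfl)
  set N0 : L2Z ≃L[ℂ] L2Z := ((tankCoef hL 0).symm.trans (tankCoef hL mu)).trans D with hN0
  have hN0e : ∀ n p, N0 (l2e n) p = (tankFreq L mu (p - n))⁻¹ := fun n p => by
    rw [hN0, ContinuousLinearEquiv.trans_apply, hD, ContinuousLinearEquiv.trans_apply,
      ← tankCoef_zero_freeE hL, ContinuousLinearEquiv.symm_apply_apply, tankCoef_freeE hL hmu,
      inv_mul_cancel_left₀ hS0]
  have hsum := summable_inv_norm_tankFreq_sq hL hmu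
  set Q := ∑' k, (‖tankFreq L mu k‖ ^ 2)⁻¹ with hQ
  have hQ0 : 0 ≤ Q := tsum_nonneg fun k => by positivity
  set A := ‖(N0.symm : L2Z →L[ℂ] L2Z)‖ with hA
  have hA0 : 0 ≤ A := norm_nonneg _
  -- The first bound keeps `2η` below half of every `|s_{p-n}|`, hence the denominators away from
  -- zero; the second makes the Schur bound `4 η Q` small against the inverse of the free matrix.
  refine ⟨min (mu / 4) (1 / (8 * (A * Q + 1))), lt_min (by positivity) (by positivity),
    fun σ lam hσ hlam => ?_⟩
  set η := min (mu / 4) (1 / (8 * (A * Q + 1))) with hη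
  have hη0 : 0 ≤ η := (norm_nonneg _).trans (hσ 0)
  have hη1 : η ≤ mu / 4 := min_le_left _ _
  have hη2 : η * (8 * (A * Q + 1)) ≤ 1 := (le_div_iff₀ (by positivity)).1 (min_le_right _ _)
  have hdiff : ∀ p n, ‖tankFreq L mu (p - n) - (σ p - lam n)‖ ≤ 2 * η := fun p n => by
    have e : tankFreq L mu (p - n) - (σ p - lam n) =
        (lam n - tankFreq L 0 n) - (σ p - tankFreq L mu p) := by
      rw [← tankFreq_sub]; ring
    rw [e]
    exact (norm_sub_le _ _).trans (by linarith [hσ p, hlam n])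
  have hlow : ∀ p n, ‖tankFreq L mu (p - n)‖ / 2 ≤ ‖σ p - lam n‖ := fun p n => by
    have h1 := norm_sub_norm_le (tankFreq L mu (p - n)) (σ p - lam n)
    linarith [hdiff p n, le_norm_tankFreq L mu (p - n)]
  have hgap : ∀ p n, mu / 2 ≤ ‖σ p - lam n‖ := fun p n => by
    linarith [hlow p n, le_norm_tankFreq L mu (p - n)]
  refine ⟨hgap, ?_⟩
  -- The difference of inverses gains a second power of `|s_{p-n}|`, which makes it summable along
  -- rows and columns; the factor `4` is the numerator `2η` times the loss `2` in the lower bound on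
  -- `|σ_p - λ_n|`.
  have hent : ∀ p n, ‖(σ p - lam n)⁻¹ - (tankFreq L mu (p - n))⁻¹‖ ≤
      4 * η * (‖tankFreq L mu (p - n)‖ ^ 2)⁻¹ := fun p n => by
    have a1 : 0 < ‖tankFreq L mu (p - n)‖ := hmu.trans_le (le_norm_tankFreq L mu (p - n))
    have a2 : 0 < ‖σ p - lam n‖ := (half_pos hmu).trans_le (hgap p n)
    rw [inv_sub_inv (norm_pos_iff.1 a2) (norm_pos_iff.1 a1), norm_div, norm_mul,
      div_le_iff₀ (mul_pos a2 a1)]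
    refine (hdiff p n).trans ?_
    have e : 4 * η * (‖tankFreq L mu (p - n)‖ ^ 2)⁻¹ *
        (‖σ p - lam n‖ * ‖tankFreq L mu (p - n)‖) =
        4 * η * (‖σ p - lam n‖ / ‖tankFreq L mu (p - n)‖) := by
      field_simp
    rw [e]
    have h2 : 1 / 2 ≤ ‖σ p - lam n‖ / ‖tankFreq L mu (p - n)‖ := by
      rw [le_div_iff₀ a1]
      linarith [hlow p n]
    nlinarith
  have hrow : ∀ p, HasSum (fun n => 4 * η * (‖tankFreq L mu (p - n)‖ ^ 2)⁻¹) (4 * η * Q) :=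
    fun p => ((Equiv.subLeft p).hasSum_iff.2 hsum.hasSum).mul_left (4 * η)
  have hcol : ∀ n, HasSum (fun p => 4 * η * (‖tankFreq L mu (p - n)‖ ^ 2)⁻¹) (4 * η * Q) :=
    fun n => ((Equiv.subRight n).hasSum_iff.2 hsum.hasSum).mul_left (4 * η)
  have sr : ∀ p, Summable fun n => ‖(σ p - lam n)⁻¹ - (tankFreq L mu (p - n))⁻¹‖ := fun p =>
    Summable.of_nonneg_of_le (fun n => norm_nonneg _) (hent p) (hrow p).summable
  have sc : ∀ n, Summable fun p => ‖(σ p - lam n)⁻¹ - (tankFreq L mu (p - n))⁻¹‖ := fun n =>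
    Summable.of_nonneg_of_le (fun p => norm_nonneg _) (fun p => hent p n) (hcol n).summable
  obtain ⟨T, hT, hTe⟩ := exists_op_of_schur
    (fun p n => (σ p - lam n)⁻¹ - (tankFreq L mu (p - n))⁻¹) (R := 4 * η * Q) (by positivity)
    sr (fun p => ((sr p).tsum_le_tsum (hent p) (hrow p).summable).trans_eq (hrow p).tsum_eq)
    sc (fun n => ((sc n).tsum_le_tsum (fun p => hent p n) (hcol n).summable).trans_eq
      (hcol n).tsum_eq)
  obtain ⟨N, hN⟩ := exists_equiv_of_perturbation N0 T (by
    calc A * ‖T‖ ≤ A * (4 * η * Q) := mul_le_mul_of_nonneg_left hT hA0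
      _ < 1 := by nlinarith)
  refine ⟨N, fun n p => ?_⟩
  rw [hN, lp.coeFn_add, Pi.add_apply, hN0e, hTe, add_sub_cancel]

/-! ### Complex conjugation and real-valued functions -/

/-- Complex conjugation on `ℂ²`. -/
def conjC2 : C2 →L[ℝ] C2 :=
  LinearMap.toContinuousLinearMap
    { toFun := fun v => !₂[(starRingEnd ℂ) (v 0), (starRingEnd ℂ) (v 1)]
      map_add' := fun v w => by
        ext i
        fin_cases i <;> simp
      map_smul' := fun c v => by
        ext i
        fin_cases i <;> simp }

@[simp] lemma conjC2_apply (v : C2) (i : Fin 2) : conjC2 v i = (starRingEnd ℂ) (v i) := by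
  fin_cases i <;> rfl

/-- Complex conjugation on `L²((0,L); ℂ²)`. -/
def tankConj (L : ℝ) : TankL2 L →L[ℝ] TankL2 L := conjC2.compLpL 2 (tankMeasure L)

lemma coeFn_tankConj {L : ℝ} (f : TankL2 L) :
    tankConj L f =ᵐ[tankMeasure L] fun x => conjC2 (f x) :=
  conjC2.coeFn_compLpL f

lemma tankConj_smul {L : ℝ} (c : ℂ) (f : TankL2 L) :
    tankConj L (c • f) = (starRingEnd ℂ) c • tankConj L f := by
  apply Lp.ext
  filter_upwards [coeFn_tankConj (c • f), Lp.coeFn_smul c f, coeFn_tankConj f,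
    Lp.coeFn_smul ((starRingEnd ℂ) c) (tankConj L f)] with x h1 h2 h3 h4
  rw [h1, h4, h2, Pi.smul_apply, Pi.smul_apply, h3]
  ext i
  simp

lemma isRealValued_iff_tankConj {L : ℝ} (f : TankL2 L) : IsRealValued f ↔ tankConj L f = f := by
  constructor
  · intro h
    apply Lp.ext
    filter_upwards [coeFn_tankConj f, h] with x h1 h2
    rw [h1]
    ext i
    rw [conjC2_apply, conj_eq_iff_im]
    exact h2 i
  · intro h
    have h1 := coeFn_tankConj f
    rw [h] at h1
    filter_upwards [h1] with x h2 i
    rw [← conj_eq_iff_im, ← conjC2_apply, ← h2]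

lemma inner_tankConj {L : ℝ} (f g : TankL2 L) :
    inner ℂ (tankConj L f) (tankConj L g) = (starRingEnd ℂ) (inner ℂ f g) := by
  rw [L2.inner_def, L2.inner_def, ← integral_conj]
  refine integral_congr_ae ?_
  filter_upwards [coeFn_tankConj f, coeFn_tankConj g] with x h1 h2
  rw [h1, h2, PiLp.inner_apply, PiLp.inner_apply, Fin.sum_univ_two, Fin.sum_univ_two]
  simp

lemma norm_tankConj {L : ℝ} (f : TankL2 L) : ‖tankConj L f‖ = ‖f‖ := by
  have h : ‖tankConj L f‖ ^ 2 = ‖f‖ ^ 2 := by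
    have h1 := congrArg re (inner_tankConj f f)
    rw [conj_re] at h1
    rw [← inner_self_eq_norm_sq (𝕜 := ℂ), ← inner_self_eq_norm_sq (𝕜 := ℂ)]
    exact h1
  exact (pow_left_inj₀ (norm_nonneg _) (norm_nonneg _) two_ne_zero).1 h

lemma tankConj_freeE (L : ℝ) (n : ℤ) : tankConj L (freeE L n) = freeE L (-n) := by
  apply Lp.ext
  filter_upwards [coeFn_tankConj (freeE L n), coeFn_freeE L n, coeFn_freeE L (-n)] with x h1 h2 h3
  rw [h1, h2, h3]
  ext i
  rw [conjC2_apply]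
  fin_cases i <;> simp [freeEigenfunction, ← exp_conj]

lemma isRealValued_tankProfile {L γ : ℝ} (hL : 0 < L) (hγ : 0 < γ) (h : γ * L < 2) :
    IsRealValued (tankClass L (tankProfile L γ)) := by
  filter_upwards [coeFn_tankClass (tankProfile_memLp hL hγ h)] with x hx i
  rw [hx]
  fin_cases i
  · exact ofReal_im _
  · exact ofReal_im _

lemma InTankGraph.conj {L γ κ : ℝ} {f h : TankL2 L} (H : InTankGraph L γ κ f h) :
    InTankGraph L γ κ (tankConj L f) (tankConj L h) := by
  obtain ⟨u, v, h1, h2, h3, h4, h5⟩ := H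
  refine ⟨fun x => conjC2 (u x), fun x => conjC2 (v x), ⟨conjC2.comp_memLp' h1.1, fun x hx => ?_⟩,
    ?_, ?_, ?_, ?_⟩
  · change conjC2 (u x) = conjC2 (u 0) + _
    rw [conjC2.intervalIntegral_comp_comm (intervalIntegrable_of_memLp_tank h1.1 hx), h1.2 x hx,
      map_add]
  · filter_upwards [coeFn_tankConj f, h2] with x a b
    rw [a, b]
  · filter_upwards [coeFn_tankConj h, h3] with x a b
    rw [a, b]
    ext i
    have e : (starRingEnd ℂ) 3 = 3 := map_ofNat _ 3
    fin_cases i <;> simp [matLambda, matJ, e]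
  · have := congrArg (starRingEnd ℂ) h4
    simpa using this
  · have := congrArg (starRingEnd ℂ) h5
    simpa using this

lemma conj_tankFreq (L mu : ℝ) (n : ℤ) :
    (starRingEnd ℂ) (tankFreq L mu n) = tankFreq L mu (-n) := by
  simp [tankFreq]

/-- Conjugation maps `f_n` to `f_{-n}` and `μ_n` to `μ_{-n}`. -/
theorem IsEigenbasisA.conj {L γ : ℝ} (hL : 0 < L) {V : TankL2 L ≃L[ℂ] L2Z} {σ : ℤ → ℂ}
    (hV : Diagonalizes γ 1 V σ) (hσ : ∀ n, ‖σ n - tankFreq L 0 n‖ ≤ 1 / (8 * L))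
    {f : ℤ → TankL2 L} {lam : ℤ → ℂ} (H : IsEigenbasisA L γ f lam) (n : ℤ) :
    tankConj L (f n) = f (-n) ∧ (starRingEnd ℂ) (lam n) = lam (-n) := by
  have h1 : InTankGraph L γ 1 (tankConj L (f n)) ((starRingEnd ℂ) (lam n) • tankConj L (f n)) := by
    rw [← tankConj_smul]
    exact (H.mem_graph n).conj
  have hn : ‖tankConj L (f n)‖ = 1 := by rw [norm_tankConj, H.orthonormal.1]
  have h0 : tankConj L (f n) ≠ 0 := norm_pos_iff.1 (by rw [hn]; exact one_pos)
  have h2 : ‖(starRingEnd ℂ) (lam n) - tankFreq L 0 (-n)‖ < 1 / (4 * L) := by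
    rw [← conj_tankFreq, ← map_sub, RCLike.norm_conj]
    have e : tankFreq L 0 n = I * Real.pi * n / L := by simp [tankFreq]
    rw [e]
    exact H.eigenvalue_near n
  -- The conjugate of `f_n` is a unit eigenvector near frequency `-n`, so it is `d f_{-n}` with `|d|
  -- = 1`. As conjugation maps `E_n` to `E_{-n}`, the two positivity conditions force `d = 1`.
  obtain ⟨e1, c, -, hc⟩ := hV.eigen_unique hL hσ h0 h1 h2
  obtain ⟨e2, c', hc0', hc'⟩ := H.identify hL hV hσ (-n)
  refine ⟨?_, e1.trans e2.symm⟩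
  have hd : tankConj L (f n) = (c / c') • f (-n) := by
    rw [hc, hc', smul_smul, div_mul_cancel₀ _ hc0']
  set d := c / c' with hd'
  have hd1 : ‖d‖ = 1 := by
    rw [hd, norm_smul, H.orthonormal.1, mul_one] at hn
    exact hn
  have h3 : ∀ k, ∃ r : ℝ, 0 < r ∧ inner ℂ (freeE L k) (f k) = (r : ℂ) := fun k =>
    ⟨_, H.phase_re k, Complex.ext rfl ((H.phase_im k).trans (ofReal_im _).symm)⟩
  obtain ⟨r, hr, hr'⟩ := h3 n
  obtain ⟨s, hs, hs'⟩ := h3 (-n)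
  have h4 : (r : ℂ) = d * s := by
    have h5 := inner_tankConj (freeE L n) (f n)
    rw [tankConj_freeE, hd, inner_smul_right, hs', hr', conj_ofReal] at h5
    exact h5.symm
  have h5 : r = s := by
    have := congrArg norm h4
    rwa [norm_mul, hd1, one_mul, norm_real, norm_real, Real.norm_eq_abs, Real.norm_eq_abs,
      abs_of_pos hr, abs_of_pos hs] at this
  have h6 : d = 1 := by
    rw [h5] at h4
    have : (s : ℂ) ≠ 0 := by exact_mod_cast hs.ne'
    exact mul_right_cancel₀ this (by rw [one_mul]; exact h4.symm)
  rw [hd, h6, one_smul]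

/-- Two real test elements suffice: `f_n + f_{-n}` gives opposite imaginary parts and `i (f_n -
f_{-n})` gives equal real parts. -/
lemma IsRealFeedback.conj_coeff {L : ℝ} {f : ℤ → TankL2 L}
    {F : Module.Dual ℂ (finiteCombinations f)} (hF : IsRealFeedback f F)
    (hf : ∀ n, tankConj L (f n) = f (-n)) (n : ℤ) :
    (starRingEnd ℂ) (feedbackCoeff f F n) = feedbackCoeff f F (-n) := by
  set x : ℤ → finiteCombinations f :=
    fun k => ⟨f k, Submodule.subset_span (Set.mem_range_self k)⟩ with hx
  have hFx : ∀ k, F (x k) = feedbackCoeff f F k := fun k => rfl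
  have h1 := hF (x n + x (-n)) ((isRealValued_iff_tankConj _).2 (by
    change tankConj L (f n + f (-n)) = f n + f (-n)
    rw [map_add, hf, hf, neg_neg, add_comm]))
  have h2 := hF (I • (x n - x (-n))) ((isRealValued_iff_tankConj _).2 (by
    change tankConj L (I • (f n - f (-n))) = I • (f n - f (-n))
    rw [tankConj_smul, map_sub, hf, hf, neg_neg, conj_I, neg_smul, ← smul_neg, neg_sub]))
  rw [map_add, hFx, hFx] at h1
  rw [map_smul, map_sub, hFx, hFx] at h2
  simp only [add_im, smul_eq_mul, mul_im, I_re, I_im, zero_mul, one_mul, zero_add, sub_re] at h1 h2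
  apply Complex.ext
  · rw [conj_re]; linarith
  · rw [conj_im]; linarith

/-! ### The controlled eigenvectors and the isomorphism -/

/-- The equation decouples in the coordinates of `V`. Existence of a `w` in the domain with these
coordinates is settled separately, by `Diagonalizes.exists_control_family`. -/
lemma Diagonalizes.resolvent_iff {L γ κ : ℝ} {V : TankL2 L ≃L[ℂ] L2Z} {σ : ℤ → ℂ}
    (hV : Diagonalizes γ κ V σ) {l : ℂ} (hl : ∀ p, σ p - l ≠ 0) (b : TankL2 L)
    (w : tankDomain L γ κ) :
    tankOp w - l • tankFun w = -b ↔ ∀ p, V (tankFun w) p = -V b p / (σ p - l) := by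
  have h1 := (hV _ _).1 (tankDomain_mem_graph w)
  have h2 : ∀ p, V (tankOp w - l • tankFun w) p = (σ p - l) * V (tankFun w) p := fun p => by
    have e : V (tankOp w - l • tankFun w) p = V (tankOp w) p - l * V (tankFun w) p := by
      rw [map_sub, map_smul]; rfl
    rw [e, h1]
    ring
  constructor
  · intro h p
    have h3 := h2 p
    have e : V (-b) p = -V b p := by rw [map_neg]; rfl
    rw [h, e] at h3
    rw [eq_div_iff (hl p), h3, mul_comm]
  · intro h
    apply V.injective
    ext p
    have e : V (-b) p = -V b p := by rw [map_neg]; rfl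
    rw [h2, h, e, mul_div_cancel₀ _ (hl p)]

/-- The solutions of `𝒜̃ k_n - μ_n k_n = -b` form a Riesz basis of the domain when the Cauchy matrix
of the spectra is invertible and `b` is controllable. -/
theorem Diagonalizes.exists_control_family {L γ κ : ℝ} {V : TankL2 L ≃L[ℂ] L2Z} {σ : ℤ → ℂ}
    (hV : Diagonalizes γ κ V σ) {lam : ℤ → ℂ} {N : L2Z ≃L[ℂ] L2Z}
    (hN : ∀ n p, N (l2e n) p = (σ p - lam n)⁻¹) {b : TankL2 L} {m M : ℝ} (hm : 0 < m)
    (hb : ∀ p, m ≤ ‖σ p * V b p‖) (hb' : ∀ p, ‖σ p * V b p‖ ≤ M) {s : ℝ} (hs : 0 < s)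
    (hσ : ∀ p, s ≤ ‖σ p‖) :
    ∃ U : L2Z ≃L[ℂ] tankDomain L γ κ,
      ∀ n p, V (tankFun (U (l2e n))) p = -V b p / (σ p - lam n) := by
  -- In the coordinates `Θ = σ V` of the domain, the wanted vectors are the columns of the Cauchy
  -- matrix followed by the diagonal `-σ_p (V b)_p`, which `hb` and `hb'` make invertible.
  obtain ⟨Θ, hΘ⟩ := hV.exists_domain_equiv 0 hs (fun n => by rw [add_zero]; exact hσ n)
  obtain ⟨D, hD⟩ := exists_diag_equiv (fun p => -(σ p * V b p)) hm
    (fun p => by rw [norm_neg]; exact hb' p) (fun p => by rw [norm_neg]; exact hb p)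
  refine ⟨(N.trans D).trans Θ.symm, fun n p => ?_⟩
  set w : tankDomain L γ κ := Θ.symm (D (N (l2e n))) with hw
  change V (tankFun w) p = _
  have h1 : Θ w p = σ p * V (tankFun w) p := by
    rw [hΘ, zero_smul, add_zero, (hV _ _).1 (tankDomain_mem_graph w)]
  rw [hw, ContinuousLinearEquiv.apply_symm_apply, hD, hN, ← hw] at h1
  have h0 : σ p ≠ 0 := norm_pos_iff.1 (hs.trans_le (hσ p))
  apply mul_left_cancel₀ h0
  rw [← h1]
  ring

/-- Biorthonormality to a complete family determines `φt p`: pairing with it reads off the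
`V`-coordinate divided by the scale `c p`. -/
lemma IsEigenbasisAtilde.coef_mul {L γ mu : ℝ} {V : TankL2 L ≃L[ℂ] L2Z}
    {ft φt : ℤ → TankL2 L} {lamt : ℤ → ℂ} (H : IsEigenbasisAtilde L γ mu ft φt lamt)
    {c : ℤ → ℂ} (hc0 : ∀ n, c n ≠ 0) (hc : ∀ n, ft n = c n • V.symm (l2e n)) (b : TankL2 L)
    (p : ℤ) : tankInner b (φt p) * c p = V b p := by
  have h1 := l2_op_hasSum ((innerSL ℂ (φt p)) ∘L (V.symm : L2Z →L[ℂ] TankL2 L)) (V b)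
  have h2 : ((innerSL ℂ (φt p)) ∘L (V.symm : L2Z →L[ℂ] TankL2 L)) (V b) = tankInner b (φt p) := by
    change inner ℂ (φt p) (V.symm (V b)) = _
    rw [ContinuousLinearEquiv.symm_apply_apply]
    rfl
  rw [h2] at h1
  have h3 : ∀ k, V b k • ((innerSL ℂ (φt p)) ∘L (V.symm : L2Z →L[ℂ] TankL2 L)) (l2e k) =
      if k = p then V b p * (c p)⁻¹ else 0 := fun k => by
    have e : ((innerSL ℂ (φt p)) ∘L (V.symm : L2Z →L[ℂ] TankL2 L)) (l2e k) =
        (c k)⁻¹ * tankInner (ft k) (φt p) := by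
      change inner ℂ (φt p) (V.symm (l2e k)) = _
      rw [hc, tankInner, inner_smul_right, inv_mul_cancel_left₀ (hc0 k)]
    rw [e, H.biorthonormal, smul_eq_mul]
    split_ifs with h
    · rw [h, mul_one]
    · simp
  simp only [h3] at h1
  rw [h1.unique (hasSum_ite_eq p _), inv_mul_cancel_right₀ (hc0 p)]

/-- The shift by `1` avoids the index `0`, where the eigenvalue may vanish: the real part of `l` is
at least `-1/2`. The constants use `3 < π ≤ 4`. -/
lemma one_add_abs_le_norm {L : ℝ} (hL : 0 < L) {l : ℂ} {n : ℤ}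
    (h : ‖l - tankFreq L 0 n‖ ≤ 1 / 2) :
    1 / 2 ≤ ‖l + 1‖ ∧ 1 + |(n : ℝ)| ≤ (2 + 2 * L) * ‖l + 1‖ ∧
      ‖l + 1‖ ≤ (2 + 4 / L) * (1 + |(n : ℝ)|) := by
  have hre : (tankFreq L 0 n).re = 0 := tankFreq_re L 0 n
  have him : (tankFreq L 0 n).im = Real.pi * n / L := by
    have e : tankFreq L 0 n = ((Real.pi * n / L : ℝ) : ℂ) * I := by
      unfold tankFreq; push_cast; ring
    rw [e]; simp
  have h1 := (abs_re_le_norm _).trans h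
  have h2 := (abs_im_le_norm _).trans h
  rw [sub_re, hre, sub_zero] at h1
  rw [sub_im, him] at h2
  have h3 : 1 / 2 ≤ ‖l + 1‖ := by
    have := Complex.re_le_norm (l + 1)
    rw [add_re, one_re] at this
    linarith [neg_abs_le l.re]
  have h4 := abs_im_le_norm (l + 1)
  rw [add_im, one_im, add_zero] at h4
  have h5 : |Real.pi * n / L| = Real.pi * |(n : ℝ)| / L := by
    rw [abs_div, abs_mul, abs_of_pos Real.pi_pos, abs_of_pos hL]
  have h6 : Real.pi * |(n : ℝ)| / L ≤ ‖l + 1‖ + 1 / 2 := by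
    rw [← h5]
    have := abs_sub_abs_le_abs_sub (Real.pi * n / L) l.im
    rw [abs_sub_comm] at this
    linarith
  have hπ := Real.pi_gt_three
  have hπ4 := Real.pi_le_four
  have hn := abs_nonneg (n : ℝ)
  refine ⟨h3, ?_, ?_⟩
  · rw [div_le_iff₀ hL] at h6
    nlinarith
  · have h7 : ‖l + 1‖ ≤ 1 / 2 + ‖tankFreq L 0 n‖ + 1 := by
      have e : l + 1 = (l - tankFreq L 0 n) + tankFreq L 0 n + 1 := by ring
      rw [e]
      refine (norm_add_le _ _).trans (add_le_add ((norm_add_le _ _).trans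
        (add_le_add h le_rfl)) (by simp))
    have h8 : ‖tankFreq L 0 n‖ ≤ 4 / L * |(n : ℝ)| := by
      have := norm_le_abs_re_add_abs_im (tankFreq L 0 n)
      rw [hre, him, h5, abs_zero, zero_add] at this
      refine this.trans ?_
      rw [div_mul_eq_mul_div]
      exact div_le_div_of_nonneg_right (mul_le_mul_of_nonneg_right hπ4 hn) hL.le
    have h9 : 0 < 4 / L := by positivity
    nlinarith

/-- The isomorphism `T`. -/
theorem exists_feedback_isomorphism {L γ κ : ℝ} (hL : 0 < L) {f : ℤ → TankL2 L} {lam : ℤ → ℂ}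
    {W : TankL2 L ≃L[ℂ] L2Z} (hWf : ∀ α n, W α n = tankInner α (f n))
    (hW : Diagonalizes γ 1 W lam) (hlam : ∀ n, ‖lam n - tankFreq L 0 n‖ ≤ 1 / 2)
    (U : L2Z ≃L[ℂ] tankDomain L γ κ) {F : ℤ → ℂ} {c C : ℝ} (hc : 0 < c)
    (hF : ∀ n : ℤ, c * (1 + |(n : ℝ)|) ≤ ‖F n‖ ∧ ‖F n‖ ≤ C * (1 + |(n : ℝ)|)) :
    ∃ T : DomA L γ ≃L[ℂ] tankDomain L γ κ, ∀ α : DomA L γ,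
      HasSum (fun n : ℤ => tankInner (tankFun α) (f n) • F n • U (l2e n)) (T α) := by
  have hb := fun n => one_add_abs_le_norm hL (hlam n)
  have hC : 0 ≤ C := by
    have := (mul_nonneg hc.le (by positivity)).trans ((hF 0).1.trans (hF 0).2)
    simpa using this
  have hpos : ∀ n, 0 < ‖lam n + 1‖ := fun n => lt_of_lt_of_le (by norm_num) (hb n).1
  -- The coordinates of `(𝒜 + 1) α` are `(λ_n + 1) ⟨α, f_n⟩`. As `|F n|` and `|λ_n + 1|` both grow
  -- like `1 + |n|`, the ratio `F n / (λ_n + 1)` is an invertible diagonal.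
  obtain ⟨Θ, hΘ⟩ := hW.exists_domain_equiv 1 (c := 1 / 2) (by norm_num) fun n => (hb n).1
  obtain ⟨D, hD⟩ := exists_diag_equiv (fun n => F n / (lam n + 1)) (c := c / (2 + 4 / L))
    (R := C * (2 + 2 * L)) (by positivity)
    (fun n => by
      rw [norm_div, div_le_iff₀ (hpos n), mul_assoc]
      exact (hF n).2.trans (mul_le_mul_of_nonneg_left (hb n).2.1 hC))
    (fun n => by
      rw [norm_div, le_div_iff₀ (hpos n), div_mul_eq_mul_div, div_le_iff₀ (by positivity)]
      calc c * ‖lam n + 1‖ ≤ c * ((2 + 4 / L) * (1 + |(n : ℝ)|)) :=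
            mul_le_mul_of_nonneg_left (hb n).2.2 hc.le
        _ = (2 + 4 / L) * (c * (1 + |(n : ℝ)|)) := by ring
        _ ≤ (2 + 4 / L) * ‖F n‖ := mul_le_mul_of_nonneg_left (hF n).1 (by positivity)
        _ = ‖F n‖ * (2 + 4 / L) := mul_comm _ _)
  refine ⟨(Θ.trans D).trans U, fun α => ?_⟩
  have h1 := l2_op_hasSum (U : L2Z →L[ℂ] tankDomain L γ κ) (D (Θ α))
  refine HasSum.congr_fun h1 fun n => ?_
  have e : Θ α n = (lam n + 1) * tankInner (tankFun α) (f n) := by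
    rw [hΘ, one_smul, map_add, lp.coeFn_add, Pi.add_apply,
      (hW _ _).1 (tankDomain_mem_graph α), hWf]
    ring
  rw [hD, e, smul_smul, ContinuousLinearEquiv.coe_coe]
  congr 1
  have := norm_pos_iff.1 (hpos n)
  field_simp

/-- A series with conjugation-symmetric terms and coefficients is real-valued. -/
theorem isRealValued_of_hasSum {L γ κ : ℝ} {f : ℤ → TankL2 L}
    (hf : ∀ n, tankConj L (f n) = f (-n)) {g : ℤ → tankDomain L γ κ}
    (hg : ∀ n, tankConj L (tankFun (g n)) = tankFun (g (-n))) {α : TankL2 L}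
    (hα : IsRealValued α) {β : tankDomain L γ κ}
    (h : HasSum (fun n : ℤ => tankInner α (f n) • g n) β) : IsRealValued (tankFun β) := by
  rw [isRealValued_iff_tankConj] at hα ⊢
  have h1 : HasSum (fun n : ℤ => tankInner α (f n) • tankFun (g n)) (tankFun β) := by
    simpa only [map_smul, tankFunL_apply] using (tankFunL L γ κ).hasSum h
  have h2 := (tankConj L).hasSum h1
  have h3 := (Equiv.neg ℤ).hasSum_iff.2 h1
  refine h2.unique (HasSum.congr_fun h3 fun n => ?_)
  simp only [Function.comp_apply, Equiv.neg_apply]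
  rw [tankConj_smul, hg, tankInner, ← inner_tankConj, hf, hα]
  rfl

/-- The properties of the controlled eigenvectors of the two diagonalized systems. -/
theorem feedback_properties {L mu γ : ℝ} (hL : 0 < L) (hγ : 0 < γ) (hγL : γ * L ≤ 1)
    {V₀ V : TankL2 L ≃L[ℂ] L2Z} {σ₀ σ : ℤ → ℂ} (hV₀ : Diagonalizes γ 1 V₀ σ₀)
    (hV : Diagonalizes γ (Real.exp (-2 * mu * L)) V σ)
    (hσ₀ : ∀ n, ‖σ₀ n - tankFreq L 0 n‖ ≤ 1 / (8 * L))
    (hσ₀' : ∀ n, ‖σ₀ n - tankFreq L 0 n‖ ≤ 1 / 2)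
    (hσ : ∀ n, ‖σ n - tankFreq L mu n‖ ≤ 1 / (8 * L)) (hgap : ∀ p n, σ p - σ₀ n ≠ 0)
    {N : L2Z ≃L[ℂ] L2Z} (hN : ∀ n p, N (l2e n) p = (σ p - σ₀ n)⁻¹)
    {s : ℝ} (hs : 0 < s) (hσs : ∀ p, s ≤ ‖σ p‖)
    {f : ℤ → TankL2 L} {lam : ℤ → ℂ} {ft φt : ℤ → TankL2 L} {lamt : ℤ → ℂ}
    (hA : IsEigenbasisA L γ f lam) (hAt : IsEigenbasisAtilde L γ mu ft φt lamt) {ν : ℝ}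
    {m M : ℝ} (hm : 0 < m) (hb : ∀ p, m ≤ ‖σ p * V (tankControl L γ ν f) p‖)
    (hb' : ∀ p, ‖σ p * V (tankControl L γ ν f) p‖ ≤ M)
    (F : Module.Dual ℂ (finiteCombinations f)) :
    (∀ n p, lamt p ≠ lam n) ∧
    ∃ g : ℤ → DomAtilde L γ mu,
      (∀ n, ∀ w : DomAtilde L γ mu,
        tankOp w - lam n • tankFun w = -(feedbackCoeff f F n • tankControl L γ ν f) ↔
          w = g n) ∧
      (∀ n, HasSum (fun p : ℤ =>
        -(feedbackCoeff f F n * tankInner (tankControl L γ ν f) (φt p)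
          / (lamt p - lam n)) • ft p) (tankFun (g n))) ∧
      ((∀ n, feedbackCoeff f F n ≠ 0) →
        IsRieszBasis (fun n : ℤ => (feedbackCoeff f F n)⁻¹ • g n)) ∧
      ((∃ c C : ℝ, 0 < c ∧ 0 < C ∧ ∀ n : ℤ,
          c * (1 + |(n : ℝ)|) ≤ ‖feedbackCoeff f F n‖ ∧
          ‖feedbackCoeff f F n‖ ≤ C * (1 + |(n : ℝ)|)) →
        ∃ T : DomA L γ ≃L[ℂ] DomAtilde L γ mu,
          (∀ α : DomA L γ,
            HasSum (fun n : ℤ => tankInner (tankFun α) (f n) • g n) (T α)) ∧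
          (IsRealFeedback f F →
            ∀ α : DomA L γ, IsRealValued (tankFun α) → IsRealValued (tankFun (T α)))) := by
  obtain rfl : lam = σ₀ := funext fun n => (hA.identify hL hV₀ hσ₀ n).1
  obtain rfl : lamt = σ := funext fun n => (hAt.identify hL hV hσ n).1
  choose c hc0 hc using fun n => (hAt.identify hL hV hσ n).2
  obtain ⟨W, hWf, hW⟩ := hA.exists_diagonalizing hL hV₀ hσ₀
  obtain ⟨U, hU⟩ := hV.exists_control_family hN hm hb hb' hs hσs
  set b := tankControl L γ ν f with hbdef
  have hg : ∀ n p, V (tankFun (feedbackCoeff f F n • U (l2e n))) p =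
      -V (feedbackCoeff f F n • b) p / (lamt p - lam n) := fun n p => by
    have e1 : V (tankFun (feedbackCoeff f F n • U (l2e n))) p =
        feedbackCoeff f F n * V (tankFun (U (l2e n))) p := by
      rw [tankFun_smul, map_smul]; rfl
    have e2 : V (feedbackCoeff f F n • b) p = feedbackCoeff f F n * V b p := by
      rw [map_smul]; rfl
    rw [e1, e2, hU]
    ring
  have huniq : ∀ n, ∀ w : DomAtilde L γ mu,
      tankOp w - lam n • tankFun w = -(feedbackCoeff f F n • b) ↔
        w = feedbackCoeff f F n • U (l2e n) := fun n w => by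
    rw [hV.resolvent_iff fun p => hgap p n]
    constructor
    · intro h
      apply tankFun_injective
      apply V.injective
      ext p
      rw [h, hg]
    · rintro rfl
      exact hg n
  refine ⟨fun n p => sub_ne_zero.1 (hgap p n), fun n => feedbackCoeff f F n • U (l2e n), huniq,
    fun n => ?_, fun hF => ⟨U, fun n => ?_⟩, ?_⟩
  · have h1 := l2_op_hasSum (V.symm : L2Z →L[ℂ] TankL2 L)
      (V (tankFun (feedbackCoeff f F n • U (l2e n))))
    rw [ContinuousLinearEquiv.coe_coe, ContinuousLinearEquiv.symm_apply_apply] at h1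
    refine HasSum.congr_fun h1 fun p => ?_
    have e2 : V (feedbackCoeff f F n • b) p = feedbackCoeff f F n * V b p := by
      rw [map_smul]; rfl
    -- The scale `c p` of `ft p` cancels against that of `φt p`.
    rw [hc p, smul_smul, hg, e2, ← hAt.coef_mul hc0 hc]
    congr 1
    ring
  · exact (inv_smul_smul₀ (hF n) (U (l2e n))).symm
  · rintro ⟨c', C, hc', -, hF⟩
    obtain ⟨T, hT⟩ := exists_feedback_isomorphism hL hWf hW hσ₀' U hc' hF
    refine ⟨T, hT, fun hreal α hα => ?_⟩
    have hcj := hA.conj hL hV₀ hσ₀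
    have hFc := hreal.conj_coeff fun n => (hcj n).1
    refine isRealValued_of_hasSum (fun n => (hcj n).1) (fun n => ?_) hα (hT α)
    have hbc : tankConj L b = b := by
      rw [hbdef, tankControl, map_add, tankConj_smul, conj_ofReal, (hcj 0).1, neg_zero,
        (isRealValued_iff_tankConj _).1 (isRealValued_tankProfile hL hγ (by linarith))]
    -- Conjugating the equation of index `n` gives the equation of index `-n`, and uniqueness
    -- identifies the solutions.
    set w := feedbackCoeff f F n • U (l2e n) with hw
    have h1 := (huniq n w).2 rfl
    have h2 := congrArg (tankConj L) h1
    rw [map_sub, map_neg, tankConj_smul, tankConj_smul, (hcj n).2, hFc, hbc] at h2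
    exact congrArg tankFun
      ((huniq (-n) (tankDomain.mk _ _ (tankDomain_mem_graph w).conj)).1 h2)

/-- The transport of the bounds of the control to the coordinates of the perturbed system. -/
lemma control_bound_transfer {s σ x y : ℂ} {a b η : ℝ} (hs : ‖σ - s‖ ≤ ‖s‖ / 2)
    (hy : ‖s * x - s * y‖ ≤ η) (ha : a ≤ ‖s * y‖) (hb : ‖s * y‖ ≤ b) :
    (a - η) / 2 ≤ ‖σ * x‖ ∧ ‖σ * x‖ ≤ 3 / 2 * (b + η) := by
  have h1 := norm_sub_norm_le (s * y) (s * x)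
  rw [norm_sub_rev] at h1
  have h2 := norm_sub_norm_le (s * x) (s * y)
  have h3 : ‖σ * x - s * x‖ ≤ ‖s * x‖ / 2 := by
    rw [← sub_mul, norm_mul, norm_mul]
    nlinarith [norm_nonneg x]
  have h4 := norm_sub_norm_le (s * x) (σ * x)
  rw [norm_sub_rev] at h4
  have h5 := norm_sub_norm_le (σ * x) (s * x)
  constructor <;> linarith

end

theorem mainTheorem8 (L mu : ℝ) (hL : 0 < L) (hmu : 0 < mu) :
    ∃ γ₀ : ℝ, 0 < γ₀ ∧ ∀ γ : ℝ, 0 < γ → γ < γ₀ →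
      -- the two systems of eigenfunctions exist
      (∃ (f : ℤ → TankL2 L) (lam : ℤ → ℂ), IsEigenbasisA L γ f lam) ∧
      (∃ (ft φt : ℤ → TankL2 L) (lamt : ℤ → ℂ), IsEigenbasisAtilde L γ mu ft φt lamt) ∧
      ∀ (f : ℤ → TankL2 L) (lam : ℤ → ℂ) (ft φt : ℤ → TankL2 L) (lamt : ℤ → ℂ),
        IsEigenbasisA L γ f lam → IsEigenbasisAtilde L γ mu ft φt lamt →
        ∀ ν : ℝ, 0 < ν → ∀ F : Module.Dual ℂ (finiteCombinations f),
          (∀ n p, lamt p ≠ lam n) ∧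
          ∃ g : ℤ → DomAtilde L γ mu,
            -- `g n` is the unique solution in `D(𝒜̃)` of `𝒜̃ g_n - μ_n g_n = -⟨f_n, F⟩ 𝓘_ν`
            (∀ n, ∀ w : DomAtilde L γ mu,
              tankOp w - lam n • tankFun w = -(feedbackCoeff f F n • tankControl L γ ν f) ↔
                w = g n) ∧
            -- its expansion in the Riesz basis `(f̃_p)`
            (∀ n, HasSum (fun p : ℤ =>
              -(feedbackCoeff f F n * tankInner (tankControl L γ ν f) (φt p)
                / (lamt p - lam n)) • ft p) (tankFun (g n))) ∧
            -- the Riesz basis property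
            ((∀ n, feedbackCoeff f F n ≠ 0) →
              IsRieszBasis (fun n : ℤ => (feedbackCoeff f F n)⁻¹ • g n)) ∧
            -- the isomorphism `T`
            ((∃ c C : ℝ, 0 < c ∧ 0 < C ∧ ∀ n : ℤ,
                c * (1 + |(n : ℝ)|) ≤ ‖feedbackCoeff f F n‖ ∧
                ‖feedbackCoeff f F n‖ ≤ C * (1 + |(n : ℝ)|)) →
              ∃ T : DomA L γ ≃L[ℂ] DomAtilde L γ mu,
                (∀ α : DomA L γ,
                  HasSum (fun n : ℤ => tankInner (tankFun α) (f n) • g n) (T α)) ∧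
                (IsRealFeedback f F →
                  ∀ α : DomA L γ, IsRealValued (tankFun α) → IsRealValued (tankFun (T α)))) := by
  obtain ⟨K0, ε0, hK0, hε0, h0⟩ := exists_tank_diagonalization hL 0
  obtain ⟨K1, ε1, hK1, hε1, h1⟩ := exists_tank_diagonalization hL mu
  obtain ⟨m, M, ε2, hm, hM, hε2, h2⟩ := exists_control_bounds hL hmu hK0
  obtain ⟨η, hη, h3⟩ := exists_cauchy_equiv hL hmu
  -- Bound on both eigenvalue shifts: `η` for the Cauchy matrix, `1/(8L)` for localization, `1/2`
  -- for the shift by `1`, `mu/2` to keep `σ` away from zero, and `m/(2M)` so that passing to the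
  -- coordinates `V` costs at most half of the lower bound on the control.
  set q := min (min η (1 / (8 * L))) (min (1 / 2) (min (mu / 2) (m / (2 * M)))) with hq
  have hq0 : 0 < q := by positivity
  refine ⟨min (min ε0 ε1) (min ε2 (min (1 / L) (q / (K0 + K1)))), by positivity,
    fun γ hγ hγ0 => ?_⟩
  simp only [lt_min_iff] at hγ0
  obtain ⟨⟨g0, g1⟩, g2, g3, g4⟩ := hγ0
  have hγL : γ * L ≤ 1 := ((lt_div_iff₀ hL).1 g3).le
  have hKq : γ * (K0 + K1) ≤ q := ((lt_div_iff₀ (by positivity)).1 g4).le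
  have hK0γ : 0 ≤ K0 * γ := by positivity
  have hK1γ : 0 ≤ K1 * γ := by positivity
  have b0 : K0 * γ ≤ q := by linarith
  have b1 : K1 * γ ≤ q := by linarith
  have q1 : q ≤ η := (min_le_left _ _).trans (min_le_left _ _)
  have q2 : q ≤ 1 / (8 * L) := (min_le_left _ _).trans (min_le_right _ _)
  have q3 : q ≤ 1 / 2 := (min_le_right _ _).trans (min_le_left _ _)
  have q4 : q ≤ mu / 2 :=
    (min_le_right _ _).trans ((min_le_right _ _).trans (min_le_left _ _))
  have q5 : q ≤ m / (2 * M) :=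
    (min_le_right _ _).trans ((min_le_right _ _).trans (min_le_right _ _))
  obtain ⟨V₀, σ₀, hV₀, hσ₀, hc₀, hn₀, -⟩ := h0 γ hγ g0.le
  rw [show Real.exp (-2 * 0 * L) = 1 by simp] at hV₀
  obtain ⟨V, σ, hV, hσ, -, -, hd⟩ := h1 γ hγ g1.le
  obtain ⟨hgap, N, hN⟩ := h3 σ σ₀ (fun p => (hσ p).trans (b1.trans q1))
    (fun n => (hσ₀ n).trans (b0.trans q1))
  have hσ₀L : ∀ n, ‖σ₀ n - tankFreq L 0 n‖ ≤ 1 / (8 * L) := fun n =>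
    (hσ₀ n).trans (b0.trans q2)
  have hσL : ∀ n, ‖σ n - tankFreq L mu n‖ ≤ 1 / (8 * L) := fun n => (hσ n).trans (b1.trans q2)
  have hσmu : ∀ p, ‖σ p - tankFreq L mu p‖ ≤ mu / 2 := fun p => (hσ p).trans (b1.trans q4)
  refine ⟨exists_isEigenbasisA hL hγ hγL hV₀ hσ₀L hn₀, exists_isEigenbasisAtilde hL hV hσL,
    fun f lam ft φt lamt hA hAt ν hν F => ?_⟩
  have hlam0 : ‖lam 0‖ ≤ K0 * γ := by
    have h := hσ₀ 0
    rwa [tankFreq_zero_zero, sub_zero, ← (hA.identify hL hV₀ hσ₀L 0).1] at h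
  obtain ⟨c1, c2⟩ := h2 γ hγ g2.le (f 0) (lam 0) (hA.mem_graph 0) (hA.orthonormal.1 0) hlam0
    (hA.norm_sub_freeE_le hL hV₀ hσ₀L hc₀ hn₀ 0) ν hν
  -- The sup-norm estimate is used with `R = M (1 + ν)`; its error again scales with `1 + ν`, so no
  -- condition linking `γ` and `ν` appears.
  have c3 := hd (tankControl L γ ν f) (M * (1 + ν)) c1 fun p => (c2 p).2
  have hν1 : 0 < 1 + ν := by linarith
  have hs : K1 * γ * (M * (1 + ν)) ≤ m / 2 * (1 + ν) := by
    have h := (le_div_iff₀ (by positivity)).1 (b1.trans q5)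
    nlinarith
  have key : ∀ p, (m * (1 + ν) - m / 2 * (1 + ν)) / 2 ≤ ‖σ p * V (tankControl L γ ν f) p‖ ∧
      ‖σ p * V (tankControl L γ ν f) p‖ ≤ 3 / 2 * (M * (1 + ν) + m / 2 * (1 + ν)) := fun p =>
    control_bound_transfer ((hσmu p).trans (by linarith [le_norm_tankFreq L mu p]))
      ((c3 p).trans hs) (c2 p).1 (c2 p).2
  have hσs : ∀ p, mu / 2 ≤ ‖σ p‖ := fun p => by
    have h := norm_sub_norm_le (tankFreq L mu p) (σ p)
    rw [norm_sub_rev] at h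
    linarith [hσmu p, le_norm_tankFreq L mu p]
  exact feedback_properties hL hγ hγL hV₀ hV hσ₀L (fun n => (hσ₀ n).trans (b0.trans q3)) hσL
    (fun p n => norm_pos_iff.1 ((half_pos hmu).trans_le (hgap p n))) hN (half_pos hmu) hσs hA hAt
    (by nlinarith) (fun p => (key p).1) (fun p => (key p).2) F
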